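/- Let $N\ge 1$ be an integer, let $$K(x,y)=\frac{1}{2\pi}\frac{\sin (N(x-y)/2)}{\sin ((x-y)/2)},\qquad \tilde K(x,y)=K(x,y)-K(x,0)K(0,0)^{-1}K(0,y)$$ be the kernel of the eigenphases of a Haar-distributed $N\times N$ unitary matrix (CUE$_N$) and the kernel conditioned on an eigenphase at $0$, and let $$\tilde\varphi(x)=\frac{e^{ix/2}}{\sqrt{2\pi}}\Bigl(e^{iNx/2}-\frac{e^{iNx/2}-e^{-iNx/2}}{N(e^{ix}-1)}\Bigr),\qquad \tilde\psi(x)=\frac{e^{ix/2}}{\sqrt{2\pi}}\Bigl(e^{-iNx/2}-\frac{e^{iNx/2}-e^{-iNx/2}}{N(e^{ix}-1)}\Bigr)$$ (removable singularities are filled by continuity). For $(a_1,a_2)$ in $T=\{a_1<0<a_2,\ a_2-a_1<2\pi\}$ put $I=[a_1,a_2]$, let $\tilde{\mathbb K}_I$ be the integral operator with kernel $\tilde K(x,y)\chi_I(y)$, and let $\tilde J_1(0;[a_1,a_2])=\det(\mathbb I-\tilde{\mathbb K}_I)$ (Fredholm determinant) be the conditional Jánossy density. For $j,k\in\{1,2\}$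 define, as functions of $(a_1,a_2)\in T$, $$R_{jk}=(\mathbb I-\tilde{\mathbb K}_I)^{-1}\tilde K(a_j,a_k),\quad q_j=(\mathbb I-\tilde{\mathbb K}_I)^{-1}\tilde\varphi(a_j),\quad p_j=(\mathbb I-\tilde{\mathbb K}_I)^{-1}\tilde\psi(a_j),$$ $$u=\int_I\tilde\varphi\,(\mathbb I-\tilde{\mathbb K}_I)^{-1}\tilde\varphi\,dx,\quad w=\int_I\tilde\psi\,(\mathbb I-\tilde{\mathbb K}_I)^{-1}\tilde\psi\,dx,\quad v=\int_I\tilde\psi\,(\mathbb I-\tilde{\mathbb K}_I)^{-1}\tilde\varphi\,dx,$$ where $(\mathbb I-\tilde{\mathbb K}_I)^{-1}=\sum_{n\ge0}\tilde{\mathbb K}_I^n$. Then on $T$ the Neumann series converge (pointwise on $I$, on continuous functions) and invert $\mathbb I-\tilde{\mathbb K}_I$, $\tilde J_1(0;[a_1,a_2])>0$, the functions $q_j,p_j,u,w,v,\log\tilde J_1$ are differentiable, and for $(j,k)=(1,2)$ and $(2,1)$ $$i(1-e^{ia_j})\frac{\partial q_j}{\partial a_j}=-\Bigl\{\tfrac{N+1}{2}(1-e^{ia_j})+v-\tfrac1N\Bigr\}q_j+(N+1)\Bigl(u-\tfrac1N\Bigr)p_j-(-1)^k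 i(1-e^{ia_k})R_{jk}q_k,$$ $$i(1-e^{ia_j})\frac{\partial p_j}{\partial a_j}=\Bigl\{\tfrac{N-1}{2}(1-e^{ia_j})+v-\tfrac1N\Bigr\}p_j+(N-1)\Bigl(w-\tfrac1N\Bigr)q_j-(-1)^k i(1-e^{ia_k})R_{jk}p_k,$$ $$\frac{\partial q_j}{\partial a_k}=(-1)^kR_{jk}q_k,\qquad \frac{\partial p_j}{\partial a_k}=(-1)^kR_{jk}p_k,$$ $$\frac{\partial u}{\partial a_j}=(-1)^jq_j^2,\quad \frac{\partial w}{\partial a_j}=(-1)^jp_j^2,\quad \frac{\partial v}{\partial a_j}=(-1)^jq_jp_j,\quad \frac{\partial}{\partial a_j}\log\tilde J_1(0;[a_1,a_2])=-(-1)^jR_{jj},$$ $$R_{jk}=\frac{q_jp_k-p_jq_k}{e^{ia_j}-e^{ia_k}},\qquad R_{jj}=-i\,e^{-ia_j}\Bigl(p_j\frac{\partial q_j}{\partial a_j}-q_j\frac{\partial p_j}{\partial a_j}\Bigr).$$ Moreover, as $(a_1,a_2)\to(0,0)$ in $T$, up to errors $O(|(a_1,a_2)|^4)$, $$q_j=i\tfrac{N+1}{2\sqrt{2\pi}}a_j-\tfrac{(N+1)(N+2)}{12\sqrt{2\pi}}a_j^2-i\tfrac{(N+1)^3}{48\sqrt{2\pi}}a_j^3,\qquad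 p_j=-i\tfrac{N-1}{2\sqrt{2\pi}}a_j-\tfrac{(N-1)(N-2)}{12\sqrt{2\pi}}a_j^2+i\tfrac{(N-1)^3}{48\sqrt{2\pi}}a_j^3,$$ $$u=\tfrac{(N+1)^2}{24\pi}(a_1^3-a_2^3),\quad w=\tfrac{(N-1)^2}{24\pi}(a_1^3-a_2^3),\quad v=-\tfrac{N^2-1}{24\pi}(a_1^3-a_2^3),\quad \log\tilde J_1(0;[a_1,a_2])=\tfrac{N(N^2-1)}{72\pi}(a_1^3-a_2^3).$$ Finally, this system with these boundary conditions is closed and determines $\tilde J_1$: if complex-valued functions $q_j,p_j,u,w,v,R_{jk},L$ on $T$, all but the $R_{jk}$ assumed differentiable, satisfy all the equations above (with $L$ in place of $\log\tilde J_1$) and the same expansions up to $O(|(a_1,a_2)|^4)$ at $(0,0)$, then they coincide on $T$ with the functions defined above. -/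

import Mathlib

open Asymptotics Filter Topology

noncomputable section

namespace CUEJanossy

/-! ### The kernels -/

/-- The `CUE_N` kernel `K(x,y) = sin(N(x-y)/2) / (2π sin((x-y)/2))`, with its limiting value at the
removable singularities `x - y ∈ 2πℤ` (in particular `K(x,x) = N/(2π)`). -/
def cueKernel (N : ℕ) (x y : ℝ) : ℝ :=
  if Real.sin ((x - y) / 2) = 0 then
    (1 / (2 * Real.pi)) * (N * Real.cos (N * (x - y) / 2) / Real.cos ((x - y) / 2))
  else
    (1 / (2 * Real.pi)) * (Real.sin (N * (x - y) / 2) / Real.sin ((x - y) / 2))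

/-- The kernel conditioned on an eigenphase at `0`:
`K̃(x,y) = K(x,y) - K(x,0) K(0,0)⁻¹ K(0,y)`. -/
def condKernel (N : ℕ) (x y : ℝ) : ℝ :=
  cueKernel N x y - cueKernel N x 0 * (cueKernel N 0 0)⁻¹ * cueKernel N 0 y

/-- `φ̃(x) = e^{ix/2}/√(2π) * (e^{iNx/2} - (e^{iNx/2} - e^{-iNx/2}) / (N (e^{ix} - 1)))`, with its
limiting value `0` at the removable singularities `e^{ix} = 1`. -/
def phi (N : ℕ) (x : ℝ) : ℂ :=
  if Complex.exp (Complex.I * x) = 1 then 0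
  else
    Complex.exp (Complex.I * x / 2) / (Real.sqrt (2 * Real.pi) : ℂ) *
      (Complex.exp (Complex.I * N * x / 2) -
        (Complex.exp (Complex.I * N * x / 2) - Complex.exp (-(Complex.I * N * x / 2))) /
          (N * (Complex.exp (Complex.I * x) - 1)))

/-- `ψ̃(x) = e^{ix/2}/√(2π) * (e^{-iNx/2} - (e^{iNx/2} - e^{-iNx/2}) / (N (e^{ix} - 1)))`, with its
limiting value `0` at the removable singularities `e^{ix} = 1`. -/
def psi (N : ℕ) (x : ℝ) : ℂ :=
  if Complex.exp (Complex.I * x) = 1 then 0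
  else
    Complex.exp (Complex.I * x / 2) / (Real.sqrt (2 * Real.pi) : ℂ) *
      (Complex.exp (-(Complex.I * N * x / 2)) -
        (Complex.exp (Complex.I * N * x / 2) - Complex.exp (-(Complex.I * N * x / 2))) /
          (N * (Complex.exp (Complex.I * x) - 1)))

/-! ### The integral operator on an interval, its resolvent and its Fredholm determinant

A pair of end-points `(a₁, a₂)` is a vector `a : Fin 2 → ℝ` with `a₁ = a 0` and `a₂ = a 1`. -/

/-- The admissible end-points: `a₁ < 0 < a₂` and `a₂ - a₁ < 2π`. -/
def endpoints : Set (Fin 2 → ℝ) :=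
  {a | a 0 < 0 ∧ 0 < a 1 ∧ a 1 - a 0 < 2 * Real.pi}

/-- The integral operator with kernel `k(x,y) χ_I(y)`, where `I = [a₁, a₂]`. -/
def intOp (k : ℝ → ℝ → ℝ) (a : Fin 2 → ℝ) (f : ℝ → ℂ) (x : ℝ) : ℂ :=
  ∫ y in (a 0)..(a 1), (k x y : ℂ) * f y

/-- `((𝕀 - k_I)⁻¹ f)(x)`, as the Neumann series
`f(x) + ∫_I k(x,y) f(y) dy + ∫∫_{I²} k(x,y) k(y,z) f(z) dy dz + ⋯`. -/
def resolvent (k : ℝ → ℝ → ℝ) (a : Fin 2 → ℝ) (f : ℝ → ℂ) (x : ℝ) : ℂ :=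
  ∑' n : ℕ, ((intOp k a)^[n] f) x

/-- The Fredholm determinant `det(𝕀 - k_I)`, as the Fredholm series
`∑_n (-1)ⁿ/n! ∫_{Iⁿ} det[k(x_i, x_j)]_{i,j=1}^n dx`. -/
def fredholmDet (k : ℝ → ℝ → ℝ) (a : Fin 2 → ℝ) : ℝ :=
  ∑' n : ℕ, ((-1 : ℝ) ^ n / (n.factorial : ℝ)) *
    ∫ x in Set.pi Set.univ (fun _ : Fin n => Set.Icc (a 0) (a 1)),
      (Matrix.of fun i j : Fin n => k (x i) (x j)).det

/-! ### The unknowns -/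

/-- The conditional Jánossy density `J̃₁(0; [a₁, a₂]) = det(𝕀 - K̃_I)`. -/
def janossy (N : ℕ) (a : Fin 2 → ℝ) : ℝ := fredholmDet (condKernel N) a

/-- `log J̃₁(0; [a₁, a₂])`, regarded as a complex number. -/
def logJanossy (N : ℕ) (a : Fin 2 → ℝ) : ℂ := (Real.log (janossy N a) : ℂ)

/-- `q_j = ((𝕀 - K̃_I)⁻¹ φ̃)(a_j)`. -/
def qVar (N : ℕ) (j : Fin 2) (a : Fin 2 → ℝ) : ℂ := resolvent (condKernel N) a (phi N) (a j)

/-- `p_j = ((𝕀 - K̃_I)⁻¹ ψ̃)(a_j)`. -/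
def pVar (N : ℕ) (j : Fin 2) (a : Fin 2 → ℝ) : ℂ := resolvent (condKernel N) a (psi N) (a j)

/-- `u = ∫_I φ̃(x) ((𝕀 - K̃_I)⁻¹ φ̃)(x) dx`. -/
def uVar (N : ℕ) (a : Fin 2 → ℝ) : ℂ :=
  ∫ x in (a 0)..(a 1), phi N x * resolvent (condKernel N) a (phi N) x

/-- `w = ∫_I ψ̃(x) ((𝕀 - K̃_I)⁻¹ ψ̃)(x) dx`. -/
def wVar (N : ℕ) (a : Fin 2 → ℝ) : ℂ :=
  ∫ x in (a 0)..(a 1), psi N x * resolvent (condKernel N) a (psi N) x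

/-- `v = ∫_I ψ̃(x) ((𝕀 - K̃_I)⁻¹ φ̃)(x) dx`. -/
def vVar (N : ℕ) (a : Fin 2 → ℝ) : ℂ :=
  ∫ x in (a 0)..(a 1), psi N x * resolvent (condKernel N) a (phi N) x

/-- `R_{jk} = ((𝕀 - K̃_I)⁻¹ K̃)(a_j, a_k)`. -/
def RVar (N : ℕ) (j k : Fin 2) (a : Fin 2 → ℝ) : ℂ :=
  resolvent (condKernel N) a (fun x => (condKernel N x (a k) : ℂ)) (a j)

/-! ### The system of partial differential equations with its boundary conditions -/

/-- The partial derivative `∂f/∂a_k`. -/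
def pderiv (k : Fin 2) (f : (Fin 2 → ℝ) → ℂ) (a : Fin 2 → ℝ) : ℂ :=
  deriv (fun t : ℝ => f (Function.update a k t)) (a k)

/-- The sign `(-1)^j` for `j = 1, 2`; the index `j = 1` is `0 : Fin 2`, and `j = 2` is
`1 : Fin 2`. -/
def sgn (j : Fin 2) : ℂ := (-1) ^ ((j : ℕ) + 1)

/-- `e^{i a_j}`. -/
def ex (a : Fin 2 → ℝ) (j : Fin 2) : ℂ := Complex.exp (Complex.I * (a j : ℂ))

/-- `f = O((a₁, a₂)⁴)` as `(a₁, a₂) → (0, 0)` through admissible end-points. -/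
def IsOrderFour (f : (Fin 2 → ℝ) → ℂ) : Prop :=
  f =O[𝓝[endpoints] (0 : Fin 2 → ℝ)] (fun a => ‖a‖ ^ 4)

/-- The functions `q_j, p_j, u, w, v, R_{jk}, L` of the end-points solve the Tracy-Widom system of
`CUE_N` (with `L` in the place of `log J̃₁`) on the set of admissible end-points, with the stated
behaviour at `(0, 0)`. -/
structure IsTWSolution (N : ℕ) (q p : Fin 2 → (Fin 2 → ℝ) → ℂ) (u w v : (Fin 2 → ℝ) → ℂ)
    (R : Fin 2 → Fin 2 → (Fin 2 → ℝ) → ℂ) (L : (Fin 2 → ℝ) → ℂ) : Prop where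
  diff_q : ∀ j, DifferentiableOn ℝ (q j) endpoints
  diff_p : ∀ j, DifferentiableOn ℝ (p j) endpoints
  diff_u : DifferentiableOn ℝ u endpoints
  diff_w : DifferentiableOn ℝ w endpoints
  diff_v : DifferentiableOn ℝ v endpoints
  diff_L : DifferentiableOn ℝ L endpoints
  /-- `R_{jk}` off the diagonal -/
  R_off : ∀ a ∈ endpoints, ∀ j k, j ≠ k →
    R j k a = (q j a * p k a - p j a * q k a) / (ex a j - ex a k)
  /-- `R_{jj}` -/
  R_diag : ∀ a ∈ endpoints, ∀ j,
    R j j a = -Complex.I * Complex.exp (-(Complex.I * (a j : ℂ))) *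
      (p j a * pderiv j (q j) a - q j a * pderiv j (p j) a)
  /-- `∂q_j/∂a_j` -/
  q_self : ∀ a ∈ endpoints, ∀ j k, j ≠ k →
    Complex.I * (1 - ex a j) * pderiv j (q j) a =
      -(((N : ℂ) + 1) / 2 * (1 - ex a j) + v a - 1 / (N : ℂ)) * q j a
        + ((N : ℂ) + 1) * (u a - 1 / (N : ℂ)) * p j a
        - sgn k * Complex.I * (1 - ex a k) * R j k a * q k a
  /-- `∂p_j/∂a_j` -/
  p_self : ∀ a ∈ endpoints, ∀ j k, j ≠ k →
    Complex.I * (1 - ex a j) * pderiv j (p j) a =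
      (((N : ℂ) - 1) / 2 * (1 - ex a j) + v a - 1 / (N : ℂ)) * p j a
        + ((N : ℂ) - 1) * (w a - 1 / (N : ℂ)) * q j a
        - sgn k * Complex.I * (1 - ex a k) * R j k a * p k a
  /-- `∂q_j/∂a_k` for `k ≠ j` -/
  q_other : ∀ a ∈ endpoints, ∀ j k, j ≠ k → pderiv k (q j) a = sgn k * R j k a * q k a
  /-- `∂p_j/∂a_k` for `k ≠ j` -/
  p_other : ∀ a ∈ endpoints, ∀ j k, j ≠ k → pderiv k (p j) a = sgn k * R j k a * p k a
  u_eq : ∀ a ∈ endpoints, ∀ j, pderiv j u a = sgn j * q j a ^ 2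
  w_eq : ∀ a ∈ endpoints, ∀ j, pderiv j w a = sgn j * p j a ^ 2
  v_eq : ∀ a ∈ endpoints, ∀ j, pderiv j v a = sgn j * (q j a * p j a)
  L_eq : ∀ a ∈ endpoints, ∀ j, pderiv j L a = -sgn j * R j j a
  bc_q : ∀ j, IsOrderFour fun a => q j a -
    (Complex.I * ((N + 1) / (2 * Real.sqrt (2 * Real.pi)) * a j : ℝ)
      - ((N + 1) * (N + 2) / (12 * Real.sqrt (2 * Real.pi)) * a j ^ 2 : ℝ)
      - Complex.I * ((N + 1) ^ 3 / (48 * Real.sqrt (2 * Real.pi)) * a j ^ 3 : ℝ))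
  bc_p : ∀ j, IsOrderFour fun a => p j a -
    (-Complex.I * ((N - 1) / (2 * Real.sqrt (2 * Real.pi)) * a j : ℝ)
      - ((N - 1) * (N - 2) / (12 * Real.sqrt (2 * Real.pi)) * a j ^ 2 : ℝ)
      + Complex.I * ((N - 1) ^ 3 / (48 * Real.sqrt (2 * Real.pi)) * a j ^ 3 : ℝ))
  bc_u : IsOrderFour fun a => u a -
    ((N + 1) ^ 2 / (24 * Real.pi) * (a 0 ^ 3 - a 1 ^ 3) : ℝ)
  bc_w : IsOrderFour fun a => w a -
    ((N - 1) ^ 2 / (24 * Real.pi) * (a 0 ^ 3 - a 1 ^ 3) : ℝ)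
  bc_v : IsOrderFour fun a => v a -
    (-(((N : ℝ) ^ 2 - 1) / (24 * Real.pi)) * (a 0 ^ 3 - a 1 ^ 3) : ℝ)
  bc_L : IsOrderFour fun a => L a -
    (N * ((N : ℝ) ^ 2 - 1) / (72 * Real.pi) * (a 0 ^ 3 - a 1 ^ 3) : ℝ)

end CUEJanossy

end

set_option linter.unusedSectionVars false

/-! The conditioned kernel has finite rank. Let c_m be the exponential e^{i(m-(N-1)/2)x} minus the
mean of those with indices 0, ..., N-1, divided by √(2π). The geometric sum behind the Dirichlet
kernel gives K̃(x,y) = ∑_{m<N} c_m(x) c_m(-y) (`condKernel_eq_sum`), and φ̃ = c_N, ψ̃ = c_0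
(`phi_eq`, `psi_eq`). Inverting 𝕀 - K̃_I therefore amounts to inverting 1 - G for an N × N Gram
matrix G, and the Fredholm series sums to det(1 - G) (`fredholmDet_eq`). G is positive semidefinite;
Bessel's inequality on a full period together with analyticity makes 1 - G positive definite
(`posDef_one_sub_gram`). Convergence of the Neumann series and positivity of J̃₁ follow.

The equations rest on two telescoping sums. The commutators of the kernel with multiplication by
e^{ix} and with D = i(1 - e^{ix}) d/dx reduce to products of φ̃ and ψ̃ (`sum_cwave_commutator`,
`sum_cwave_diff_commutator`). Uniqueness for the integral equation carries them through the
resolvent: the first gives R_{jk} (`resKernel_commutator`), the second the spatial equations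
(`mul_dresWave_last`, `mul_dresWave_zero`), in which integration by parts leaves boundary terms at
a_1 and a_2. Derivatives in the end-points come from differentiating the finite linear system
(`hasDerivAt_sol`) and from Jacobi's formula. The expansions are short because every c_m vanishes at
0, so the resolvent corrects only orders four and higher.

For uniqueness, restrict to a ray t ↦ t a with 0 < t ≤ 1. The system acquires a regular singular
point at t = 0, where the difference f of two solutions satisfies t ‖f'‖ ≤ (3 + Ct) ‖f‖ in the sup
norm; the 3 bounds 1/N + (N+1)/N. Equal expansions give f = O(t⁴), and comparison with t³e^{(C+1)t}
forces f = 0 (`eq_zero_of_singular_ode`). The R_{jk} are then expressed through the other functions,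
and L is recovered along the same rays. -/

namespace CUEJanossy

/-! ### Exponentials, their mean and the centred exponentials -/

/-- The exponentials `e^{i (m - (N-1)/2) x}`, an orthogonal system for `0 ≤ m < N`. -/
noncomputable def wave (N m : ℕ) (x : ℝ) : ℂ :=
  Complex.exp (Complex.I * (m - (N - 1) / 2) * x)

/-- The derivative of `wave`. -/
noncomputable def dwave (N m : ℕ) (x : ℝ) : ℂ :=
  Complex.I * (m - (N - 1) / 2) * wave N m x

/-- The mean of the first `N` exponentials. -/
noncomputable def waveMean (N : ℕ) (x : ℝ) : ℂ :=
  (∑ l ∈ Finset.range N, wave N l x) / N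

/-- The derivative of `waveMean`. -/
noncomputable def dwaveMean (N : ℕ) (x : ℝ) : ℂ :=
  (∑ l ∈ Finset.range N, dwave N l x) / N

/-- The centred, normalised exponentials. -/
noncomputable def cwave (N m : ℕ) (x : ℝ) : ℂ :=
  (wave N m x - waveMean N x) / (Real.sqrt (2 * Real.pi) : ℂ)

/-- The derivative of `cwave`. -/
noncomputable def dcwave (N m : ℕ) (x : ℝ) : ℂ :=
  (dwave N m x - dwaveMean N x) / (Real.sqrt (2 * Real.pi) : ℂ)

theorem sqrt_two_pi_ne_zero : ((Real.sqrt (2 * Real.pi) : ℝ) : ℂ) ≠ 0 := by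
  rw [Complex.ofReal_ne_zero]; positivity

theorem sqrt_two_pi_sq :
    ((Real.sqrt (2 * Real.pi) : ℝ) : ℂ) * (Real.sqrt (2 * Real.pi) : ℝ) = 2 * Real.pi := by
  rw [← Complex.ofReal_mul, Real.mul_self_sqrt (by positivity)]; push_cast; ring

theorem hasDerivAt_cexp_I (x : ℝ) :
    HasDerivAt (fun x : ℝ => Complex.exp (Complex.I * x)) (Complex.I * Complex.exp (Complex.I * x))
      x := by
  have h : HasDerivAt (fun x : ℝ => Complex.I * (x : ℂ)) (Complex.I * 1) x :=
    (Complex.ofRealCLM.hasDerivAt (x := x)).const_mul _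
  simpa [mul_comm] using h.cexp

theorem hasDerivAt_wave (N m : ℕ) (x : ℝ) : HasDerivAt (wave N m) (dwave N m x) x := by
  have h : HasDerivAt (fun x : ℝ => Complex.I * (m - (N - 1) / 2) * (x : ℂ))
      (Complex.I * (m - (N - 1) / 2) * 1) x :=
    (Complex.ofRealCLM.hasDerivAt (x := x)).const_mul _
  rw [dwave, mul_comm]
  rw [mul_one] at h
  exact h.cexp

theorem hasDerivAt_waveMean (N : ℕ) (x : ℝ) : HasDerivAt (waveMean N) (dwaveMean N x) x := by
  exact (HasDerivAt.fun_sum (u := Finset.range N) fun m _ =>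
    hasDerivAt_wave N m x).div_const (N : ℂ)

theorem hasDerivAt_cwave (N m : ℕ) (x : ℝ) : HasDerivAt (cwave N m) (dcwave N m x) x :=
  ((hasDerivAt_wave N m x).sub (hasDerivAt_waveMean N x)).div_const _

theorem continuous_wave (N m : ℕ) : Continuous (wave N m) := by
  unfold wave; fun_prop

theorem continuous_dwave (N m : ℕ) : Continuous (dwave N m) :=
  continuous_const.mul (continuous_wave N m)

theorem continuous_waveMean (N : ℕ) : Continuous (waveMean N) :=
  (continuous_finsetSum _ fun m _ => continuous_wave N m).div_const _

theorem continuous_dwaveMean (N : ℕ) : Continuous (dwaveMean N) :=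
  (continuous_finsetSum _ fun m _ => continuous_dwave N m).div_const _

theorem continuous_cwave (N m : ℕ) : Continuous (cwave N m) :=
  ((continuous_wave N m).sub (continuous_waveMean N)).div_const _

theorem continuous_dcwave (N m : ℕ) : Continuous (dcwave N m) :=
  ((continuous_dwave N m).sub (continuous_dwaveMean N)).div_const _

theorem wave_sub (N m : ℕ) (x y : ℝ) : wave N m (x - y) = wave N m x * wave N m (-y) := by
  rw [wave, wave, wave, ← Complex.exp_add]; push_cast; ring_nf

theorem wave_zero_right (N m : ℕ) : wave N m 0 = 1 := by simp [wave]

theorem wave_succ (N m : ℕ) (x : ℝ) :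
    wave N (m + 1) x = Complex.exp (Complex.I * x) * wave N m x := by
  rw [wave, wave, ← Complex.exp_add]; push_cast; ring_nf

theorem conj_wave (N m : ℕ) (x : ℝ) : starRingEnd ℂ (wave N m x) = wave N m (-x) := by
  rw [wave, wave, ← Complex.exp_conj]; simp [map_ofNat]

theorem conj_waveMean (N : ℕ) (x : ℝ) : starRingEnd ℂ (waveMean N x) = waveMean N (-x) := by
  simp [waveMean, conj_wave]

theorem conj_cwave (N m : ℕ) (x : ℝ) : starRingEnd ℂ (cwave N m x) = cwave N m (-x) := by
  simp [cwave, conj_wave, conj_waveMean, Complex.conj_ofReal]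

theorem sum_wave_eq (N : ℕ) (x : ℝ) :
    (Complex.exp (Complex.I * x) - 1) * ∑ l ∈ Finset.range N, wave N l x =
      wave N N x - wave N 0 x := by
  rw [← Finset.sum_range_sub (fun l => wave N l x), Finset.mul_sum]
  refine Finset.sum_congr rfl fun l _ => ?_
  rw [wave_succ]; ring

/-- Multiplication by e^{ix} shifts the band of frequencies by one, so only the two ends of the band
change. This division-free form of the geometric sum also holds where e^{ix} = 1. -/
theorem cexp_I_mul_waveMean {N : ℕ} (hN : 1 ≤ N) (x : ℝ) :
    Complex.exp (Complex.I * x) * waveMean N x =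
      waveMean N x + (wave N N x - wave N 0 x) / N := by
  have h := sum_wave_eq N x
  have hN' : (N : ℂ) ≠ 0 := by exact_mod_cast (by omega : N ≠ 0)
  rw [waveMean, ← h]; field_simp; ring

theorem sum_wave {N : ℕ} (hN : 1 ≤ N) (x : ℝ) :
    ∑ l ∈ Finset.range N, wave N l x = N * waveMean N x := by
  have hN' : (N : ℂ) ≠ 0 := by exact_mod_cast (by omega : N ≠ 0)
  rw [waveMean]; field_simp

theorem sum_dwave {N : ℕ} (hN : 1 ≤ N) (x : ℝ) :
    ∑ l ∈ Finset.range N, dwave N l x = N * dwaveMean N x := by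
  have hN' : (N : ℂ) ≠ 0 := by exact_mod_cast (by omega : N ≠ 0)
  rw [dwaveMean]; field_simp

/-- The frequencies l - (N-1)/2 are symmetric about 0; the reflection is l ↦ N - 1 - l. -/
theorem waveMean_neg (N : ℕ) (x : ℝ) : waveMean N (-x) = waveMean N x := by
  unfold waveMean
  rw [← Finset.sum_range_reflect]
  congr 1
  refine Finset.sum_congr rfl fun l hl => ?_
  rw [Finset.mem_range] at hl
  unfold wave
  have : ((N - 1 - l : ℕ) : ℂ) = N - 1 - l := by
    rw [Nat.sub_sub, Nat.cast_sub (by omega)]; push_cast; ring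
  rw [this]; push_cast; ring_nf

theorem dwaveMean_neg (N : ℕ) (x : ℝ) : dwaveMean N (-x) = -dwaveMean N x := by
  have h1 := hasDerivAt_waveMean N x
  have h2 := (hasDerivAt_waveMean N (-x)).scomp x (hasDerivAt_neg x)
  have h3 : waveMean N ∘ Neg.neg = waveMean N := by ext y; simp [waveMean_neg]
  rw [h3] at h2
  have := h1.unique h2
  simp at this
  rw [this]; ring

/-! ### First-order differential equations of the centred exponentials -/

/-- `i (1 - e^{ix}) d/dx` applied to `waveMean`. -/
theorem mul_dwaveMean {N : ℕ} (hN : 1 ≤ N) (x : ℝ) :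
    Complex.I * (1 - Complex.exp (Complex.I * x)) * dwaveMean N x =
      ((N - 1) / 2 * wave N N x + (N + 1) / 2 * wave N 0 x) / N - waveMean N x := by
  have hN' : (N : ℂ) ≠ 0 := by exact_mod_cast (by omega : N ≠ 0)
  -- Both sides of `cexp_I_mul_waveMean` are differentiated and the derivatives equated; no quotient
  -- by e^{ix} - 1 appears.
  have h1 := (hasDerivAt_cexp_I x).mul (hasDerivAt_waveMean N x)
  have h2 := (hasDerivAt_waveMean N x).add
    (((hasDerivAt_wave N N x).sub (hasDerivAt_wave N 0 x)).div_const (N : ℂ))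
  have h3 : (fun x : ℝ => Complex.exp (Complex.I * x)) * waveMean N =
      waveMean N + fun x => (wave N N - wave N 0) x / (N : ℂ) := by
    ext y; simpa using cexp_I_mul_waveMean hN y
  rw [h3] at h1
  have h4 := h1.unique h2
  have h5 := cexp_I_mul_waveMean hN x
  rw [dwave, dwave] at h4
  push_cast at h4
  have hI : Complex.I * Complex.I = -1 := Complex.I_mul_I
  field_simp at h4 h5 ⊢
  linear_combination (-Complex.I) * h4 + (2 * N * waveMean N x * Complex.exp (Complex.I * x)
    - wave N N x * (N + 1) - wave N 0 x * (N - 1)) * hI - 2 * h5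

theorem dcwave_eq {N : ℕ} (m : ℕ) (x : ℝ) : Complex.I * (1 - Complex.exp (Complex.I * x)) *
    dcwave N m x = (-(m - (N - 1) / 2) * (1 - Complex.exp (Complex.I * x)) * wave N m x -
      Complex.I * (1 - Complex.exp (Complex.I * x)) * dwaveMean N x) /
        (Real.sqrt (2 * Real.pi) : ℂ) := by
  rw [dcwave, dwave]
  have hI : Complex.I * Complex.I = -1 := Complex.I_mul_I
  linear_combination ((1 - Complex.exp (Complex.I * x)) * (m - (N - 1) / 2) * wave N m x /
    (Real.sqrt (2 * Real.pi) : ℂ)) * hI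

/-- The differential equation of `φ̃`. -/
theorem mul_dcwave_last {N : ℕ} (hN : 1 ≤ N) (x : ℝ) :
    Complex.I * (1 - Complex.exp (Complex.I * x)) * dcwave N N x =
      -((N + 1) / 2 * (1 - Complex.exp (Complex.I * x)) - 1 / N) * cwave N N x -
        (N + 1) / N * cwave N 0 x := by
  have hN' : (N : ℂ) ≠ 0 := by exact_mod_cast (by omega : N ≠ 0)
  have hs := sqrt_two_pi_ne_zero
  have h5 := cexp_I_mul_waveMean hN x
  rw [dcwave_eq, mul_dwaveMean hN, cwave, cwave]
  field_simp at h5 ⊢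
  linear_combination ((N : ℂ) + 1) * h5

/-- The differential equation of `ψ̃`. -/
theorem mul_dcwave_zero {N : ℕ} (hN : 1 ≤ N) (x : ℝ) :
    Complex.I * (1 - Complex.exp (Complex.I * x)) * dcwave N 0 x =
      ((N - 1) / 2 * (1 - Complex.exp (Complex.I * x)) - 1 / N) * cwave N 0 x -
        (N - 1) / N * cwave N N x := by
  have hN' : (N : ℂ) ≠ 0 := by exact_mod_cast (by omega : N ≠ 0)
  have hs := sqrt_two_pi_ne_zero
  have h5 := cexp_I_mul_waveMean hN x
  rw [dcwave_eq, mul_dwaveMean hN, cwave, cwave]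
  push_cast
  field_simp at h5 ⊢
  linear_combination (1 - (N : ℂ)) * h5

/-! ### Commutators of the finite-rank kernel -/

/-- A covariance identity. -/
theorem sum_sub_mul_sub {N : ℕ} {f g : ℕ → ℂ} {F G : ℂ}
    (hf : ∑ m ∈ Finset.range N, f m = N * F) (hg : ∑ m ∈ Finset.range N, g m = N * G) :
    ∑ m ∈ Finset.range N, (f m - F) * (g m - G) =
      ∑ m ∈ Finset.range N, f m * g m - N * F * G := by
  simp only [sub_mul, mul_sub, Finset.sum_sub_distrib, ← Finset.mul_sum, ← Finset.sum_mul, hf, hg,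
    Finset.sum_const, Finset.card_range, nsmul_eq_mul]
  ring

/-- Centring turns the sum into a covariance; the subtracted product of means is the term K(x,0)
K(0,0)⁻¹ K(0,y) of the conditioning. -/
theorem sum_cwave_mul {N : ℕ} (hN : 1 ≤ N) (x y : ℝ) :
    ∑ m ∈ Finset.range N, cwave N m x * cwave N m (-y) =
      (∑ m ∈ Finset.range N, wave N m x * wave N m (-y) - N * waveMean N x * waveMean N y) /
        (2 * Real.pi) := by
  rw [← waveMean_neg N y, ← sum_sub_mul_sub (sum_wave hN x) (sum_wave hN (-y)), Finset.sum_div]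
  refine Finset.sum_congr rfl fun m _ => ?_
  rw [cwave, cwave, div_mul_div_comm, sqrt_two_pi_sq]

theorem sum_dcwave_mul {N : ℕ} (hN : 1 ≤ N) (x y : ℝ) :
    ∑ m ∈ Finset.range N, dcwave N m x * cwave N m (-y) =
      (∑ m ∈ Finset.range N, dwave N m x * wave N m (-y) - N * dwaveMean N x * waveMean N y) /
        (2 * Real.pi) := by
  rw [← waveMean_neg N y, ← sum_sub_mul_sub (sum_dwave hN x) (sum_wave hN (-y)), Finset.sum_div]
  refine Finset.sum_congr rfl fun m _ => ?_
  rw [cwave, dcwave, div_mul_div_comm, sqrt_two_pi_sq]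

theorem sum_cwave_mul_dcwave {N : ℕ} (hN : 1 ≤ N) (x y : ℝ) :
    ∑ m ∈ Finset.range N, cwave N m x * dcwave N m (-y) =
      (∑ m ∈ Finset.range N, wave N m x * dwave N m (-y) + N * waveMean N x * dwaveMean N y) /
        (2 * Real.pi) := by
  have := sum_sub_mul_sub (sum_wave hN x) (sum_dwave hN (-y))
  rw [dwaveMean_neg] at this
  rw [show ∀ s : ℂ, s + N * waveMean N x * dwaveMean N y = s - N * waveMean N x * -dwaveMean N y
    from fun s => by ring, ← this, Finset.sum_div]
  refine Finset.sum_congr rfl fun m _ => ?_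
  rw [cwave, dcwave, div_mul_div_comm, sqrt_two_pi_sq, dwaveMean_neg]

theorem cexp_mul_wave_last_neg (N : ℕ) (y : ℝ) :
    Complex.exp (Complex.I * y) * wave N N (-y) = wave N 0 y := by
  rw [wave, wave, ← Complex.exp_add]; push_cast; ring_nf

theorem cexp_mul_wave_zero_neg (N : ℕ) (y : ℝ) :
    Complex.exp (Complex.I * y) * wave N 0 (-y) = wave N N y := by
  rw [wave, wave, ← Complex.exp_add]; push_cast; ring_nf

theorem wave_succ_neg (N m : ℕ) (y : ℝ) :
    Complex.exp (Complex.I * y) * wave N (m + 1) (-y) = wave N m (-y) := by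
  rw [wave, wave, ← Complex.exp_add]; push_cast; ring_nf

/-- In the m-th summand e^{ix} raises the index at x, while w_m(-y) = e^{iy} w_{m+1}(-y). The sum
telescopes, and its ends pair the waves of index N and 0. -/
theorem sum_wave_commutator (N : ℕ) (x y : ℝ) :
    (Complex.exp (Complex.I * x) - Complex.exp (Complex.I * y)) *
      ∑ m ∈ Finset.range N, wave N m x * wave N m (-y) =
      wave N N x * wave N 0 y - wave N 0 x * wave N N y := by
  have h := Finset.sum_range_sub
    (fun m => wave N m x * (Complex.exp (Complex.I * y) * wave N m (-y))) N
  simp only [cexp_mul_wave_last_neg, cexp_mul_wave_zero_neg, wave_succ_neg] at h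
  rw [← h, Finset.mul_sum]
  refine Finset.sum_congr rfl fun m _ => ?_
  rw [wave_succ]; ring

/-- Differentiation weights each summand by its frequency c, so the m-th term is c e^{ix} - (c-1)
e^{iy} times w_m(x) w_m(-y). The extra e^{iy} term on the left makes this telescope; it matches the
derivative of i(1 - e^{iy}) in the later integration by parts. -/
theorem sum_wave_diff_commutator (N : ℕ) (x y : ℝ) :
    Complex.I * (1 - Complex.exp (Complex.I * x)) *
      ∑ m ∈ Finset.range N, dwave N m x * wave N m (-y)
    - Complex.I * (1 - Complex.exp (Complex.I * y)) *
      ∑ m ∈ Finset.range N, wave N m x * dwave N m (-y)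
    + Complex.exp (Complex.I * y) * ∑ m ∈ Finset.range N, wave N m x * wave N m (-y) =
      (N - 1) / 2 * (wave N N x * wave N 0 y) + (N + 1) / 2 * (wave N 0 x * wave N N y) := by
  -- The weight is the frequency minus one: it produces the pair c, c - 1 and takes the values
  -- (N-1)/2 at m = N and -(N+1)/2 at m = 0.
  have h := Finset.sum_range_sub
    (fun m : ℕ => ((m : ℂ) - (N - 1) / 2 - 1) *
      (wave N m x * (Complex.exp (Complex.I * y) * wave N m (-y)))) N
  simp only [cexp_mul_wave_last_neg, cexp_mul_wave_zero_neg, wave_succ_neg] at h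
  have h' : ((N : ℂ) - 1) / 2 * (wave N N x * wave N 0 y) +
      (N + 1) / 2 * (wave N 0 x * wave N N y) =
      ((N : ℂ) - (N - 1) / 2 - 1) * (wave N N x * wave N 0 y) -
      (((0 : ℕ) : ℂ) - (N - 1) / 2 - 1) * (wave N 0 x * wave N N y) := by push_cast; ring
  rw [h', ← h, Finset.mul_sum, Finset.mul_sum, Finset.mul_sum, ← Finset.sum_sub_distrib,
    ← Finset.sum_add_distrib]
  refine Finset.sum_congr rfl fun m _ => ?_
  have hI : Complex.I * Complex.I = -1 := Complex.I_mul_I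
  rw [wave_succ, dwave, dwave]
  push_cast
  linear_combination ((m - (N - 1) / 2) * wave N m x * wave N m (-y) *
    (Complex.exp (Complex.I * y) - Complex.exp (Complex.I * x))) * hI

/-- The commutator of the conditioned kernel with multiplication by `e^{ix}`. -/
theorem sum_cwave_commutator {N : ℕ} (hN : 1 ≤ N) (x y : ℝ) :
    (Complex.exp (Complex.I * x) - Complex.exp (Complex.I * y)) *
      ∑ m ∈ Finset.range N, cwave N m x * cwave N m (-y) =
      cwave N N x * cwave N 0 y - cwave N 0 x * cwave N N y := by
  have hN' : (N : ℂ) ≠ 0 := by exact_mod_cast (by omega : N ≠ 0)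
  have h := sum_wave_commutator N x y
  have hx := cexp_I_mul_waveMean hN x
  have hy := cexp_I_mul_waveMean hN y
  rw [sum_cwave_mul hN]
  simp only [cwave]
  rw [div_mul_div_comm, div_mul_div_comm, sqrt_two_pi_sq, ← sub_div, ← mul_div_assoc]
  congr 1
  field_simp at hx hy
  linear_combination h - waveMean N y * hx + waveMean N x * hy

/-- The commutator of the conditioned kernel with `i (1 - e^{ix}) d/dx`. -/
theorem sum_cwave_diff_commutator {N : ℕ} (hN : 1 ≤ N) (x y : ℝ) :
    Complex.I * (1 - Complex.exp (Complex.I * x)) *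
      ∑ m ∈ Finset.range N, dcwave N m x * cwave N m (-y)
    - Complex.I * (1 - Complex.exp (Complex.I * y)) *
      ∑ m ∈ Finset.range N, cwave N m x * dcwave N m (-y)
    + Complex.exp (Complex.I * y) * ∑ m ∈ Finset.range N, cwave N m x * cwave N m (-y) =
      (N - 1) / 2 * (cwave N N x * cwave N 0 y) + (N + 1) / 2 * (cwave N 0 x * cwave N N y) := by
  have hN' : (N : ℂ) ≠ 0 := by exact_mod_cast (by omega : N ≠ 0)
  have h := sum_wave_diff_commutator N x y
  have hx := mul_dwaveMean hN x
  have hy := mul_dwaveMean hN y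
  have hy' := cexp_I_mul_waveMean hN y
  rw [sum_cwave_mul hN, sum_dcwave_mul hN, sum_cwave_mul_dcwave hN]
  simp only [cwave, div_mul_div_comm _ ((Real.sqrt (2 * Real.pi) : ℝ) : ℂ), sqrt_two_pi_sq]
  simp only [← mul_div_assoc, ← sub_div, ← add_div]
  congr 1
  field_simp at hx hy hy' ⊢
  linear_combination 2 * h - waveMean N y * hx - waveMean N x * hy - 2 * waveMean N x * hy'

/-! ### Identification of K̃, φ̃ and ψ̃ with the centred exponentials -/

theorem wave_int_mul_two_pi (N m : ℕ) (x : ℝ) (n : ℤ) (hx : x = n * (2 * Real.pi)) :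
    wave N m x = wave N 0 x := by
  rw [wave, wave, Complex.exp_eq_exp_iff_exists_int]
  refine ⟨m * n, ?_⟩
  rw [hx]; push_cast; ring

/-- This is the Dirichlet kernel. Off the singular set the geometric sum is divided by e^{it} - 1;
on it the frequencies differ by integers, so all N summands coincide. -/
theorem sum_wave_eq_cueKernel (N : ℕ) (x y : ℝ) :
    (cueKernel N x y : ℂ) = (∑ m ∈ Finset.range N, wave N m (x - y)) / (2 * Real.pi) := by
  unfold cueKernel
  set t := x - y with ht
  have hexp : ∀ s : ℝ, Complex.exp (Complex.I * s) = Real.cos s + Real.sin s * Complex.I := by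
    intro s; rw [mul_comm, Complex.exp_mul_I]; push_cast; rfl
  split_ifs with h
  · obtain ⟨n, hn⟩ := Real.sin_eq_zero_iff.mp h
    have ht2 : t = n * (2 * Real.pi) := by linarith
    rw [Finset.sum_congr rfl fun m _ => wave_int_mul_two_pi N m t n ht2, Finset.sum_const,
      Finset.card_range, nsmul_eq_mul]
    have hs : Real.sin (N * t / 2) = 0 :=
      Real.sin_eq_zero_iff.mpr ⟨N * n, by rw [ht2]; push_cast; ring⟩
    -- Since cos(t/2) = ±1, multiplying and dividing by it agree, as the stated limiting value
    -- requires.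
    have hc : Real.cos (t / 2) * Real.cos (t / 2) = 1 := by
      have := Real.sin_sq_add_cos_sq (t / 2)
      rw [h] at this; linarith
    have hc0 : Real.cos (t / 2) ≠ 0 := fun h0 => by rw [h0] at hc; simp at hc
    have hw : wave N 0 t = (Real.cos (N * t / 2) / Real.cos (t / 2) : ℝ) := by
      have h1 := hexp (-(N * t / 2))
      have h2 := hexp (t / 2)
      rw [Real.cos_neg, Real.sin_neg, hs] at h1
      rw [h] at h2
      have h3 : wave N 0 t = Complex.exp (Complex.I * ((-(N * t / 2) : ℝ) : ℂ)) *
          Complex.exp (Complex.I * ((t / 2 : ℝ) : ℂ)) := by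
        rw [wave, ← Complex.exp_add]; push_cast; ring_nf
      have hcC : ((Real.cos (t / 2) : ℝ) : ℂ) * (Real.cos (t / 2) : ℝ) = 1 := by exact_mod_cast hc
      rw [h3, h1, h2, Complex.ofReal_div, eq_div_iff (by exact_mod_cast hc0)]
      simp only [neg_zero, Complex.ofReal_zero, zero_mul, add_zero]
      linear_combination ((Real.cos (N * t / 2) : ℝ) : ℂ) * hcC
    rw [hw]; push_cast; ring
  · have h1 := sum_wave_eq N t
    have h2 : Complex.exp (Complex.I * t) - 1 =
        Complex.exp (Complex.I * (t / 2 : ℝ)) * (2 * Complex.I * Real.sin (t / 2)) := by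
      have e1 : Complex.exp (Complex.I * t) =
          Complex.exp (Complex.I * (t / 2 : ℝ)) * Complex.exp (Complex.I * (t / 2 : ℝ)) := by
        rw [← Complex.exp_add]; push_cast; ring_nf
      have e2 : Complex.exp (Complex.I * (t / 2 : ℝ)) * Complex.exp (Complex.I * (-(t / 2) : ℝ)) =
          1 := by
        rw [← Complex.exp_add]; push_cast; ring_nf; simp
      have e3 := hexp (t / 2)
      have e4 := hexp (-(t / 2))
      rw [Real.cos_neg, Real.sin_neg] at e4
      rw [e1, ← e2, ← mul_sub]
      congr 1
      rw [e3, e4]; push_cast; ring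
    have h3 : wave N N t - wave N 0 t =
        Complex.exp (Complex.I * (t / 2 : ℝ)) * (2 * Complex.I * Real.sin (N * t / 2)) := by
      have e3 := hexp (N * t / 2)
      have e4 := hexp (-(N * t / 2))
      rw [Real.cos_neg, Real.sin_neg] at e4
      have e5 : 2 * Complex.I * Real.sin (N * t / 2) =
          Complex.exp (Complex.I * (N * t / 2 : ℝ)) - Complex.exp (Complex.I * (-(N * t / 2) : ℝ)) := by
        rw [e3, e4]; push_cast; ring
      rw [e5, mul_sub, ← Complex.exp_add, ← Complex.exp_add, wave, wave]
      push_cast; ring_nf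
    rw [h2, h3, mul_assoc] at h1
    have h4 := mul_left_cancel₀ (Complex.exp_ne_zero _) h1
    have h5 : ((Real.sin (t / 2) : ℝ) : ℂ) ≠ 0 := by exact_mod_cast h
    have h6 : ((Real.sin (t / 2) : ℝ) : ℂ) * ∑ l ∈ Finset.range N, wave N l t =
        (Real.sin (N * t / 2) : ℝ) := by
      have hI := Complex.I_ne_zero
      apply mul_left_cancel₀ (mul_ne_zero two_ne_zero hI)
      rw [← h4]; ring
    have h7 : ∑ l ∈ Finset.range N, wave N l t =
        (Real.sin (N * t / 2) : ℝ) / (Real.sin (t / 2) : ℝ) := by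
      rw [eq_div_iff h5, ← h6]; ring
    rw [h7]; push_cast; ring

/-- At y = 0 every wave is 1, so K(x,0) = N/(2π) times the mean and K(0,0) = N/(2π); conditioning is
exactly centring. -/
theorem condKernel_eq_sum {N : ℕ} (hN : 1 ≤ N) (x y : ℝ) :
    (condKernel N x y : ℂ) = ∑ m ∈ Finset.range N, cwave N m x * cwave N m (-y) := by
  have hN' : (N : ℂ) ≠ 0 := by exact_mod_cast (by omega : N ≠ 0)
  have hpi : (Real.pi : ℂ) ≠ 0 := by exact_mod_cast Real.pi_ne_zero
  rw [sum_cwave_mul hN, condKernel]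
  push_cast
  simp only [sum_wave_eq_cueKernel, sub_zero, zero_sub, wave_zero_right, wave_sub]
  rw [sum_wave hN, sum_wave hN, waveMean_neg, Finset.sum_const, Finset.card_range, nsmul_eq_mul]
  field_simp

/-- The kernel is real, and conjugating the sum exchanges x and y. -/
theorem condKernel_symm {N : ℕ} (hN : 1 ≤ N) (x y : ℝ) : condKernel N x y = condKernel N y x := by
  have h : (condKernel N x y : ℂ) = condKernel N y x := by
    rw [← Complex.conj_ofReal (condKernel N y x), condKernel_eq_sum hN, condKernel_eq_sum hN,
      map_sum]
    refine Finset.sum_congr rfl fun m _ => ?_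
    rw [map_mul, conj_cwave, conj_cwave, neg_neg, mul_comm]
  exact_mod_cast h

theorem cwave_eq {N : ℕ} (hN : 1 ≤ N) (m : ℕ) (x : ℝ) (hx : Complex.exp (Complex.I * x) ≠ 1) :
    cwave N m x = Complex.exp (Complex.I * x / 2) / (Real.sqrt (2 * Real.pi) : ℂ) *
      (Complex.exp (Complex.I * (2 * m - N) / 2 * x) -
        (Complex.exp (Complex.I * N * x / 2) - Complex.exp (-(Complex.I * N * x / 2))) /
          (N * (Complex.exp (Complex.I * x) - 1))) := by
  have hN' : (N : ℂ) ≠ 0 := by exact_mod_cast (by omega : N ≠ 0)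
  have hx' := sub_ne_zero.mpr hx
  have h := sum_wave_eq N x
  rw [sum_wave hN] at h
  have h1 : wave N m x = Complex.exp (Complex.I * x / 2) *
      Complex.exp (Complex.I * (2 * m - N) / 2 * x) := by
    rw [wave, ← Complex.exp_add]; ring_nf
  have h2 : waveMean N x = Complex.exp (Complex.I * x / 2) *
      ((Complex.exp (Complex.I * N * x / 2) - Complex.exp (-(Complex.I * N * x / 2))) /
          (N * (Complex.exp (Complex.I * x) - 1))) := by
    have h3 : wave N N x = Complex.exp (Complex.I * x / 2) * Complex.exp (Complex.I * N * x / 2) := by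
      rw [wave, ← Complex.exp_add]; ring_nf
    have h4 : wave N 0 x = Complex.exp (Complex.I * x / 2) *
        Complex.exp (-(Complex.I * N * x / 2)) := by
      rw [wave, ← Complex.exp_add]; push_cast; ring_nf
    rw [h3, h4] at h
    rw [← mul_div_assoc, eq_div_iff (mul_ne_zero hN' hx')]
    linear_combination h
  rw [cwave, h1, h2]; ring

theorem cwave_eq_zero {N : ℕ} (hN : 1 ≤ N) (m : ℕ) (x : ℝ)
    (hx : Complex.exp (Complex.I * x) = 1) : cwave N m x = 0 := by
  have hN' : (N : ℂ) ≠ 0 := by exact_mod_cast (by omega : N ≠ 0)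
  obtain ⟨n, hn⟩ := Complex.exp_eq_one_iff.mp hx
  have hx' : x = n * (2 * Real.pi) := by
    have : (x : ℂ) = n * (2 * Real.pi) := by
      apply mul_left_cancel₀ Complex.I_ne_zero
      rw [hn]; ring
    exact_mod_cast this
  have h := sum_wave hN x
  rw [Finset.sum_congr rfl fun m _ => wave_int_mul_two_pi N m x n hx', Finset.sum_const,
    Finset.card_range, nsmul_eq_mul] at h
  rw [cwave, ← mul_left_cancel₀ hN' h, wave_int_mul_two_pi N m x n hx', sub_self, zero_div]

/-- The index N lies one step above the band 0, ..., N-1 that spans the kernel; ψ̃ has the lowest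
index of the band. -/
theorem phi_eq {N : ℕ} (hN : 1 ≤ N) : phi N = cwave N N := by
  ext x
  unfold phi
  split_ifs with hx
  · rw [cwave_eq_zero hN _ _ hx]
  · rw [cwave_eq hN _ _ hx]; ring_nf

theorem psi_eq {N : ℕ} (hN : 1 ≤ N) : psi N = cwave N 0 := by
  ext x
  unfold psi
  split_ifs with hx
  · rw [cwave_eq_zero hN _ _ hx]
  · rw [cwave_eq hN _ _ hx]; push_cast; ring_nf

/-! ### Integral equations with a kernel of finite rank -/

section FiniteRank

variable {ι : Type*} [Fintype ι] [DecidableEq ι]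

/-- The moments `∫_I F_m f` of a function. -/
noncomputable def moment (F : ι → ℝ → ℂ) (f : ℝ → ℂ) (a : Fin 2 → ℝ) : ι → ℂ :=
  fun m => ∫ y in (a 0)..(a 1), F m y * f y

/-- The Gram matrix `∫_I F_m E_l` of a kernel `∑ E_m(x) F_m(y)`. -/
noncomputable def gram (E F : ι → ℝ → ℂ) (a : Fin 2 → ℝ) : Matrix ι ι ℂ :=
  Matrix.of fun m l => ∫ y in (a 0)..(a 1), F m y * E l y

/-- The coefficients of the solution of the integral equation. -/
noncomputable def coef (E F : ι → ℝ → ℂ) (f : ℝ → ℂ) (a : Fin 2 → ℝ) : ι → ℂ :=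
  (1 - gram E F a)⁻¹.mulVec (moment F f a)

/-- The solution `g` of the integral equation `g - k_I g = f` for `k(x,y) = ∑ E_m(x) F_m(y)`. -/
noncomputable def sol (E F : ι → ℝ → ℂ) (f : ℝ → ℂ) (a : Fin 2 → ℝ) (x : ℝ) : ℂ :=
  f x + ∑ m, E m x * coef E F f a m

variable {E F : ι → ℝ → ℂ} {k : ℝ → ℝ → ℝ} {a : Fin 2 → ℝ}

theorem intOp_eq_sum (hF : ∀ m, Continuous (F m))
    (hk : ∀ x y, (k x y : ℂ) = ∑ m, E m x * F m y) {f : ℝ → ℂ} (hf : Continuous f) (x : ℝ) :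
    intOp k a f x = ∑ m, E m x * moment F f a m := by
  unfold intOp moment
  simp only [hk, Finset.sum_mul, mul_assoc]
  rw [intervalIntegral.integral_finsetSum]
  · simp only [intervalIntegral.integral_const_mul]
  · intro m _
    exact (continuous_const.mul ((hF m).mul hf)).intervalIntegrable _ _

theorem continuous_sum_mul (hE : ∀ m, Continuous (E m)) (c : ι → ℂ) :
    Continuous fun x => ∑ m, E m x * c m :=
  continuous_finsetSum _ fun m _ => (hE m).mul continuous_const

theorem moment_add (hF : ∀ m, Continuous (F m)) {f g : ℝ → ℂ} (hf : Continuous f)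
    (hg : Continuous g) : moment F (fun x => f x + g x) a = moment F f a + moment F g a := by
  ext m
  simp only [moment, Pi.add_apply, mul_add]
  exact intervalIntegral.integral_add (((hF m).mul hf).intervalIntegrable _ _)
    (((hF m).mul hg).intervalIntegrable _ _)

theorem moment_sum_mul (hE : ∀ m, Continuous (E m)) (hF : ∀ m, Continuous (F m)) (c : ι → ℂ) :
    moment F (fun x => ∑ m, E m x * c m) a = (gram E F a).mulVec c := by
  ext m
  simp only [moment, gram, Matrix.mulVec, dotProduct, Matrix.of_apply, Finset.mul_sum, ← mul_assoc]
  rw [intervalIntegral.integral_finsetSum]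
  · simp only [intervalIntegral.integral_mul_const]
  · intro l _
    exact (((hF m).mul (hE l)).mul continuous_const).intervalIntegrable _ _

/-- After one application everything lies in the span of the `E m`, where the operator acts through
the Gram matrix. Hence the Neumann series of the operator is that of a matrix. -/
theorem intOp_iterate_succ (hE : ∀ m, Continuous (E m)) (hF : ∀ m, Continuous (F m))
    (hk : ∀ x y, (k x y : ℂ) = ∑ m, E m x * F m y) {f : ℝ → ℂ} (hf : Continuous f) (n : ℕ) :
    (intOp k a)^[n + 1] f =
      fun x => ∑ m, E m x * ((gram E F a ^ n).mulVec (moment F f a)) m := by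
  induction n with
  | zero => ext x; simp [intOp_eq_sum hF hk hf]
  | succ n ih =>
    rw [Function.iterate_succ_apply', ih]
    ext x
    rw [intOp_eq_sum hF hk (continuous_sum_mul hE _), moment_sum_mul hE hF, Matrix.mulVec_mulVec,
      ← pow_succ']

theorem hasSum_iterate_intOp (hE : ∀ m, Continuous (E m)) (hF : ∀ m, Continuous (F m))
    (hk : ∀ x y, (k x y : ℂ) = ∑ m, E m x * F m y)
    (hG : HasSum (fun n => gram E F a ^ n) (1 - gram E F a)⁻¹)
    {f : ℝ → ℂ} (hf : Continuous f) (x : ℝ) :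
    HasSum (fun n => (intOp k a)^[n] f x) (sol E F f a x) := by
  rw [← hasSum_nat_add_iff' 1]
  simp only [Finset.range_one, Finset.sum_singleton, Function.iterate_zero, id_eq,
    intOp_iterate_succ hE hF hk hf, sol, add_sub_cancel_left]
  refine hasSum_sum fun m _ => HasSum.mul_left _ ?_
  simp only [coef, Matrix.mulVec, dotProduct]
  refine hasSum_sum fun l _ => HasSum.mul_right _ ?_
  exact Pi.hasSum.mp (Pi.hasSum.mp hG m) l

theorem continuous_sol (hE : ∀ m, Continuous (E m)) {f : ℝ → ℂ} (hf : Continuous f) :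
    Continuous (sol E F f a) :=
  hf.add (continuous_sum_mul hE _)

theorem moment_sol (hE : ∀ m, Continuous (E m)) (hF : ∀ m, Continuous (F m))
    (hdet : IsUnit (1 - gram E F a).det) {f : ℝ → ℂ} (hf : Continuous f) :
    moment F (sol E F f a) a = coef E F f a := by
  have h1 : moment F (sol E F f a) a = moment F f a + (gram E F a).mulVec (coef E F f a) := by
    rw [← moment_sum_mul hE hF, ← moment_add hF hf (continuous_sum_mul hE _)]
    rfl
  have h2 : (1 - gram E F a).mulVec (coef E F f a) = moment F f a := by
    rw [coef, Matrix.mulVec_mulVec, Matrix.mul_nonsing_inv _ hdet, Matrix.one_mulVec]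
  rw [Matrix.sub_mulVec, Matrix.one_mulVec] at h2
  rw [h1, ← h2, sub_add_cancel]

theorem sol_sub_intOp (hE : ∀ m, Continuous (E m)) (hF : ∀ m, Continuous (F m))
    (hk : ∀ x y, (k x y : ℂ) = ∑ m, E m x * F m y)
    (hdet : IsUnit (1 - gram E F a).det) {f : ℝ → ℂ} (hf : Continuous f) (x : ℝ) :
    sol E F f a x - intOp k a (sol E F f a) x = f x := by
  rw [intOp_eq_sum hF hk (continuous_sol hE hf), moment_sol hE hF hdet hf, sol, add_sub_cancel_right]

/-- A solution is determined by its moments against `F`, and these satisfy a linear system with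
matrix 1 - G. -/
theorem eq_sol (hE : ∀ m, Continuous (E m)) (hF : ∀ m, Continuous (F m))
    (hk : ∀ x y, (k x y : ℂ) = ∑ m, E m x * F m y)
    (hdet : IsUnit (1 - gram E F a).det) {f g : ℝ → ℂ} (hf : Continuous f) (hg : Continuous g)
    (h : ∀ x, g x - intOp k a g x = f x) (x : ℝ) : g x = sol E F f a x := by
  have h1 : g = fun x => f x + ∑ m, E m x * moment F g a m := by
    ext x; rw [← h, intOp_eq_sum hF hk hg]; ring
  have h2 : moment F g a = moment F f a + (gram E F a).mulVec (moment F g a) := by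
    conv_lhs => rw [h1]
    rw [moment_add hF hf (continuous_sum_mul hE _), moment_sum_mul hE hF]
  have h3 : (1 - gram E F a).mulVec (moment F g a) = moment F f a := by
    rw [Matrix.sub_mulVec, Matrix.one_mulVec]
    nth_rewrite 1 [h2]; simp
  have h4 : moment F g a = coef E F f a := by
    rw [coef, ← h3, Matrix.mulVec_mulVec, Matrix.nonsing_inv_mul _ hdet, Matrix.one_mulVec]
  rw [h1, sol, h4]

theorem integral_mul_intOp_comm (hE : ∀ m, Continuous (E m)) (hF : ∀ m, Continuous (F m))
    (hk : ∀ x y, (k x y : ℂ) = ∑ m, E m x * F m y) (hsymm : ∀ x y, k x y = k y x)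
    {f g : ℝ → ℂ} (hf : Continuous f) (hg : Continuous g) :
    ∫ x in (a 0)..(a 1), f x * intOp k a g x = ∫ x in (a 0)..(a 1), g x * intOp k a f x := by
  -- Symmetry permits exchanging `E` and `F`, so both double integrals become the same finite sum of
  -- products of moments.
  have hk' : ∀ x y, (k x y : ℂ) = ∑ m, F m x * E m y := by
    intro x y; rw [hsymm, hk]; simp only [mul_comm]
  have key : ∀ (A B : ι → ℝ → ℂ) (f g : ℝ → ℂ), (∀ m, Continuous (A m)) → (∀ m, Continuous (B m)) →
      (∀ x y, (k x y : ℂ) = ∑ m, A m x * B m y) → Continuous f → Continuous g →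
      ∫ x in (a 0)..(a 1), f x * intOp k a g x = ∑ m, moment A f a m * moment B g a m := by
    intro A B f g hA hB hAB hf hg
    simp only [intOp_eq_sum hB hAB hg, Finset.mul_sum, ← mul_assoc]
    rw [intervalIntegral.integral_finsetSum]
    · simp only [intervalIntegral.integral_mul_const, mul_comm (f _)]
      rfl
    · intro m _
      exact ((hf.mul (hA m)).mul continuous_const).intervalIntegrable _ _
  rw [key E F f g hE hF hk hf hg, key F E g f hF hE hk' hg hf]
  simp only [mul_comm]

theorem continuous_intOp (hE : ∀ m, Continuous (E m)) (hF : ∀ m, Continuous (F m))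
    (hk : ∀ x y, (k x y : ℂ) = ∑ m, E m x * F m y)
    {f : ℝ → ℂ} (hf : Continuous f) : Continuous (intOp k a f) := by
  rw [funext (intOp_eq_sum hF hk hf)]
  exact continuous_sum_mul hE _

theorem integral_mul_sol_comm (hE : ∀ m, Continuous (E m)) (hF : ∀ m, Continuous (F m))
    (hk : ∀ x y, (k x y : ℂ) = ∑ m, E m x * F m y) (hsymm : ∀ x y, k x y = k y x)
    (hdet : IsUnit (1 - gram E F a).det) {f g : ℝ → ℂ} (hf : Continuous f) (hg : Continuous g) :
    ∫ x in (a 0)..(a 1), f x * sol E F g a x = ∫ x in (a 0)..(a 1), g x * sol E F f a x := by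
  -- Substituting f = (1 - k) applied to its solution makes the expression visibly symmetric in f
  -- and g.
  have key : ∀ f g : ℝ → ℂ, Continuous f → Continuous g →
      ∫ x in (a 0)..(a 1), f x * sol E F g a x =
        (∫ x in (a 0)..(a 1), sol E F f a x * sol E F g a x) -
          ∫ x in (a 0)..(a 1), sol E F g a x * intOp k a (sol E F f a) x := by
    intro f g hf hg
    have hsf : Continuous (sol E F f a) := continuous_sol hE hf
    have hsg : Continuous (sol E F g a) := continuous_sol hE hg
    have hif := continuous_intOp (a := a) hE hF hk hsf
    have hsub := intervalIntegral.integral_sub (μ := MeasureTheory.volume)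
      ((hsf.mul hsg).intervalIntegrable (a 0) (a 1)) ((hsg.mul hif).intervalIntegrable (a 0) (a 1))
    simp only [Pi.mul_apply] at hsub
    rw [← hsub]
    refine intervalIntegral.integral_congr fun x _ => ?_
    simp only [← sol_sub_intOp hE hF hk hdet hf x]
    ring
  rw [key f g hf hg, key g f hg hf, integral_mul_intOp_comm hE hF hk hsymm
    (continuous_sol hE hg) (continuous_sol hE hf)]
  simp only [mul_comm]

end FiniteRank

/-! ### Differentiation in the end-points, of determinants and of inverse matrices -/

section Calculus

/-- `sgn k` encodes the two cases of the fundamental theorem: minus at the lower end-point, plus at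
the upper. -/
theorem hasDerivAt_integral_update {g : ℝ → ℂ} (hg : Continuous g) (a : Fin 2 → ℝ) (k : Fin 2) :
    HasDerivAt (fun t => ∫ y in (Function.update a k t 0)..(Function.update a k t 1), g y)
      (sgn k * g (a k)) (a k) := by
  fin_cases k
  · simpa [sgn] using intervalIntegral.integral_hasDerivAt_left (hg.intervalIntegrable (a 0) (a 1))
      (hg.stronglyMeasurableAtFilter _ _) hg.continuousAt
  · simpa [sgn] using intervalIntegral.integral_hasDerivAt_right (hg.intervalIntegrable (a 0) (a 1))
      (hg.stronglyMeasurableAtFilter _ _) hg.continuousAt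

theorem differentiable_integral_endpoints {g : ℝ → ℂ} (hg : Continuous g) :
    Differentiable ℝ fun a : Fin 2 → ℝ => ∫ y in (a 0)..(a 1), g y := by
  have h1 : ∀ a : Fin 2 → ℝ, ∫ y in (a 0)..(a 1), g y =
      (∫ y in (0 : ℝ)..(a 1), g y) - ∫ y in (0 : ℝ)..(a 0), g y := fun a =>
    (intervalIntegral.integral_interval_sub_left (hg.intervalIntegrable _ _)
      (hg.intervalIntegrable _ _)).symm
  have h2 : Differentiable ℝ fun t : ℝ => ∫ y in (0 : ℝ)..t, g y := fun t =>
    (intervalIntegral.integral_hasDerivAt_right (hg.intervalIntegrable 0 t)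
      (hg.stronglyMeasurableAtFilter _ _) hg.continuousAt).differentiableAt
  simp only [h1]
  exact (h2.comp (differentiable_apply (1 : Fin 2))).sub (h2.comp (differentiable_apply (0 : Fin 2)))

theorem hasDerivAt_comp_update {f : (Fin 2 → ℝ) → ℂ} {a : Fin 2 → ℝ}
    (hf : DifferentiableAt ℝ f a) (k : Fin 2) :
    HasDerivAt (fun t => f (Function.update a k t)) (pderiv k f a) (a k) := by
  have h : DifferentiableAt ℝ (fun t => f (Function.update a k t)) (a k) := by
    refine DifferentiableAt.comp (a k) ?_ (hasDerivAt_update a k (a k)).differentiableAt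
    rwa [Function.update_eq_self]
  exact h.hasDerivAt

theorem pderiv_eq_fderiv {f : (Fin 2 → ℝ) → ℂ} {a : Fin 2 → ℝ}
    (hf : DifferentiableAt ℝ f a) (k : Fin 2) :
    pderiv k f a = fderiv ℝ f a (Pi.single k 1) := by
  have hf' : HasFDerivAt f (fderiv ℝ f a) (Function.update a k (a k)) := by
    rw [Function.update_eq_self]; exact hf.hasFDerivAt
  exact (hf'.comp_hasDerivAt (a k) (hasDerivAt_update a k (a k))).deriv

variable {ι : Type*} [Fintype ι] [DecidableEq ι]

theorem differentiableAt_det {X : Type*} [NormedAddCommGroup X] [NormedSpace ℝ X]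
    {M : X → Matrix ι ι ℂ} {x : X} (h : ∀ i j, DifferentiableAt ℝ (fun y => M y i j) x) :
    DifferentiableAt ℝ (fun y => (M y).det) x := by
  simp only [Matrix.det_apply']
  refine DifferentiableAt.fun_sum fun σ _ => DifferentiableAt.const_mul ?_ _
  exact (HasFDerivAt.finsetProd (u := Finset.univ) fun i _ => (h (σ i) i).hasFDerivAt).differentiableAt

theorem differentiableAt_inv {X : Type*} [NormedAddCommGroup X] [NormedSpace ℝ X]
    {M : X → Matrix ι ι ℂ} {x : X} (h : ∀ i j, DifferentiableAt ℝ (fun y => M y i j) x)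
    (hx : (M x).det ≠ 0) (i j : ι) : DifferentiableAt ℝ (fun y => (M y)⁻¹ i j) x := by
  simp only [Matrix.inv_def, Matrix.smul_apply, smul_eq_mul, Matrix.adjugate_apply,
    Ring.inverse_eq_inv']
  refine ((differentiableAt_det h).inv hx).mul (differentiableAt_det fun i' j' => ?_)
  by_cases hi : i' = j
  · subst hi; simp
  · simp [Matrix.updateRow_ne hi, h]

/-- Jacobi's formula: the determinant is multilinear in the rows, and replacing one row is evaluated
by Cramer's rule. -/
theorem hasDerivAt_det {M : ℝ → Matrix ι ι ℂ} {M' : Matrix ι ι ℂ} {t : ℝ}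
    (h : ∀ i j, HasDerivAt (fun s => M s i j) (M' i j) t) :
    HasDerivAt (fun s => (M s).det) (∑ i, ∑ j, (M t).adjugate j i * M' i j) t := by
  let D : ContinuousMultilinearMap ℂ (fun _ : ι => ι → ℂ) ℂ :=
    ⟨(Matrix.detRowAlternating (n := ι) (R := ℂ)).toMultilinearMap,
      Continuous.matrix_det continuous_id⟩
  have h1 : HasFDerivAt (𝕜 := ℝ) (fun x : ι → ι → ℂ => D x)
      ((D.linearDeriv (M t)).restrictScalars ℝ) (M t) :=
    (D.hasFDerivAt (M t)).restrictScalars ℝ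
  have h2 : HasDerivAt (fun s => (fun i j => M s i j : ι → ι → ℂ)) (fun i j => M' i j) t :=
    hasDerivAt_pi.mpr fun i => hasDerivAt_pi.mpr fun j => h i j
  have h3 := h1.comp_hasDerivAt t h2
  refine h3.congr_deriv ?_
  change D.linearDeriv (M t) (fun i j => M' i j) = _
  refine (D.linearDeriv_apply _ _).trans ?_
  refine Finset.sum_congr rfl fun i _ => ?_
  change ((M t).updateRow i (M' i)).det = _
  rw [← Matrix.cramer_transpose_apply, Matrix.cramer_eq_adjugate_mulVec,
    ← Matrix.adjugate_transpose]
  rfl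

end Calculus

/-! ### Dependence of the solution and the determinant on the end-points -/

section FiniteRank

variable {ι : Type*} [Fintype ι] [DecidableEq ι]
variable {E F E' : ι → ℝ → ℂ} {K : ℝ → ℝ → ℝ} {a : Fin 2 → ℝ}

theorem isUnit_det_of_ne_zero {M : Matrix ι ι ℂ} (h : M.det ≠ 0) : IsUnit M.det :=
  isUnit_iff_ne_zero.mpr h

theorem differentiable_gram (hE : ∀ m, Continuous (E m)) (hF : ∀ m, Continuous (F m)) (m l : ι) :
    Differentiable ℝ fun a => gram E F a m l :=
  differentiable_integral_endpoints ((hF m).mul (hE l))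

theorem differentiable_moment (hF : ∀ m, Continuous (F m)) {f : ℝ → ℂ} (hf : Continuous f)
    (m : ι) : Differentiable ℝ fun a => moment F f a m :=
  differentiable_integral_endpoints ((hF m).mul hf)

theorem differentiable_one_sub_gram (hE : ∀ m, Continuous (E m)) (hF : ∀ m, Continuous (F m))
    (m l : ι) : Differentiable ℝ fun a => (1 - gram E F a) m l :=
  (differentiable_const _).sub (differentiable_gram hE hF m l)

theorem differentiableAt_coef (hE : ∀ m, Continuous (E m)) (hF : ∀ m, Continuous (F m))
    (hdet : (1 - gram E F a).det ≠ 0) {f : ℝ → ℂ} (hf : Continuous f) (m : ι) :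
    DifferentiableAt ℝ (fun a => coef E F f a m) a := by
  simp only [coef, Matrix.mulVec, dotProduct]
  exact DifferentiableAt.fun_sum fun l _ =>
    (differentiableAt_inv (fun i j => (differentiable_one_sub_gram hE hF i j) a) hdet m l).mul
      (differentiable_moment hF hf l a)

theorem coef_eq (hdet : (1 - gram E F a).det ≠ 0) (f : ℝ → ℂ) (m : ι) :
    coef E F f a m = moment F f a m + ∑ l, gram E F a m l * coef E F f a l := by
  have h2 : (1 - gram E F a).mulVec (coef E F f a) = moment F f a := by
    rw [coef, Matrix.mulVec_mulVec, Matrix.mul_nonsing_inv _ (isUnit_det_of_ne_zero hdet),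
      Matrix.one_mulVec]
  rw [Matrix.sub_mulVec, Matrix.one_mulVec] at h2
  rw [← h2, Pi.sub_apply, Matrix.mulVec, dotProduct, sub_add_cancel]

/-- Implicit differentiation of `coef_eq`: the derivative solves a system with the same matrix 1 -
G, whose source is the boundary value F(a_k) times the solution at a_k. -/
theorem hasDerivAt_coef (hE : ∀ m, Continuous (E m)) (hF : ∀ m, Continuous (F m))
    (hdet : (1 - gram E F a).det ≠ 0) {f : ℝ → ℂ} (hf : Continuous f) (k : Fin 2) (m : ι) :
    HasDerivAt (fun t => coef E F f (Function.update a k t) m)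
      (sgn k * (1 - gram E F a)⁻¹.mulVec (fun l => F l (a k)) m * sol E F f a (a k)) (a k) := by
  have hc : ∀ m, HasDerivAt (fun t => coef E F f (Function.update a k t) m)
      (pderiv k (fun a => coef E F f a m) a) (a k) := fun m =>
    hasDerivAt_comp_update (differentiableAt_coef hE hF hdet hf m) k
  set c' : ι → ℂ := fun m => pderiv k (fun a => coef E F f a m) a with hc'
  have hup : Function.update a k (a k) = a := Function.update_eq_self k a
  -- The implicit equation needs an invertible matrix, an open condition, so it holds for nearby
  -- end-points.
  have hev : ∀ᶠ t in 𝓝 (a k), (1 - gram E F (Function.update a k t)).det ≠ 0 := by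
    have hcont : ContinuousAt (fun t => (1 - gram E F (Function.update a k t)).det) (a k) := by
      have hd : ContinuousAt (fun b => (1 - gram E F b).det) (Function.update a k (a k)) :=
        (differentiableAt_det fun i j => differentiable_one_sub_gram hE hF i j _).continuousAt
      exact ContinuousAt.comp (f := fun t => Function.update a k t) hd
        (hasDerivAt_update a k (a k)).continuousAt
    exact hcont.eventually_ne (by rw [hup]; exact hdet)
  have key : ∀ m, c' m = sgn k * (F m (a k) * sol E F f a (a k)) +
      (gram E F a).mulVec c' m := by
    intro m
    have h1 : HasDerivAt (fun t => moment F f (Function.update a k t) m +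
        ∑ l, gram E F (Function.update a k t) m l * coef E F f (Function.update a k t) l)
        (sgn k * (F m (a k) * f (a k)) + ∑ l, (sgn k * (F m (a k) * E l (a k)) *
          coef E F f (Function.update a k (a k)) l +
            gram E F (Function.update a k (a k)) m l * c' l)) (a k) :=
      (hasDerivAt_integral_update ((hF m).mul hf) a k).add
        (HasDerivAt.fun_sum fun l _ =>
          (hasDerivAt_integral_update ((hF m).mul (hE l)) a k).mul (hc l))
    have h2 := (hc m).unique (h1.congr_of_eventuallyEq (hev.mono fun t ht => coef_eq ht f m))
    rw [hup] at h2
    change c' m = _ at h2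
    rw [h2, Finset.sum_add_distrib, Matrix.mulVec, dotProduct, ← add_assoc]
    congr 1
    rw [sol, mul_add, mul_add, Finset.mul_sum, Finset.mul_sum]
    congr 1
    refine Finset.sum_congr rfl fun l _ => by ring
  have key2 : (1 - gram E F a).mulVec c' =
      (sgn k * sol E F f a (a k)) • fun m => F m (a k) := by
    ext m
    rw [Matrix.sub_mulVec, Matrix.one_mulVec, Pi.sub_apply, key m]
    simp only [Pi.smul_apply, smul_eq_mul]
    ring
  have key3 : c' = (1 - gram E F a)⁻¹.mulVec
      ((sgn k * sol E F f a (a k)) • fun m => F m (a k)) := by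
    rw [← key2, Matrix.mulVec_mulVec, Matrix.nonsing_inv_mul _ (isUnit_det_of_ne_zero hdet),
      Matrix.one_mulVec]
  refine (hc m).congr_deriv ?_
  change c' m = _
  rw [key3, Matrix.mulVec_smul, Pi.smul_apply, smul_eq_mul]
  ring

/-- The resolvent kernel. -/
theorem sol_kernel (hE : ∀ m, Continuous (E m)) (hF : ∀ m, Continuous (F m))
    (hK : ∀ x y, (K x y : ℂ) = ∑ m, E m x * F m y) (hdet : (1 - gram E F a).det ≠ 0) (x y : ℝ) :
    sol E F (fun x => (K x y : ℂ)) a x =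
      ∑ m, E m x * (1 - gram E F a)⁻¹.mulVec (fun l => F l y) m := by
  have h1 : moment F (fun x => (K x y : ℂ)) a = (gram E F a).mulVec fun l => F l y := by
    simp only [hK]
    exact moment_sum_mul hE hF _
  have h2 : (fun l => F l y) + coef E F (fun x => (K x y : ℂ)) a =
      (1 - gram E F a)⁻¹.mulVec fun l => F l y := by
    rw [coef, h1]
    have h3 : (fun l => F l y) = (1 - gram E F a)⁻¹.mulVec
        ((1 - gram E F a).mulVec fun l => F l y) := by
      rw [Matrix.mulVec_mulVec, Matrix.nonsing_inv_mul _ (isUnit_det_of_ne_zero hdet),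
        Matrix.one_mulVec]
    nth_rewrite 1 [h3]
    rw [← Matrix.mulVec_add, Matrix.sub_mulVec, Matrix.one_mulVec, sub_add_cancel]
  rw [← h2, sol, hK, ← Finset.sum_add_distrib]
  simp only [Pi.add_apply, mul_add]

/-- Once `sol_kernel` recognises ∑ E (1-G)⁻¹F as the resolvent kernel, this is the classical
variation of a resolvent under motion of an end-point. -/
theorem hasDerivAt_sol (hE : ∀ m, Continuous (E m)) (hF : ∀ m, Continuous (F m))
    (hK : ∀ x y, (K x y : ℂ) = ∑ m, E m x * F m y) (hdet : (1 - gram E F a).det ≠ 0)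
    {f : ℝ → ℂ} (hf : Continuous f) (k : Fin 2) (x : ℝ) :
    HasDerivAt (fun t => sol E F f (Function.update a k t) x)
      (sgn k * sol E F (fun x => (K x (a k) : ℂ)) a x * sol E F f a (a k)) (a k) := by
  have h := (HasDerivAt.fun_sum (u := Finset.univ) fun m _ =>
    (hasDerivAt_coef hE hF hdet hf k m).const_mul (E m x)).const_add (f x)
  refine h.congr_deriv ?_
  rw [sol_kernel hE hF hK hdet, Finset.mul_sum, Finset.sum_mul]
  exact Finset.sum_congr rfl fun m _ => by ring

theorem hasDerivAt_sol_space {E' : ι → ℝ → ℂ} (hE' : ∀ m x, HasDerivAt (E m) (E' m x) x)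
    {f : ℝ → ℂ} {f' : ℂ} {x : ℝ} (hf' : HasDerivAt f f' x) :
    HasDerivAt (sol E F f a) (f' + ∑ m, E' m x * coef E F f a m) x :=
  hf'.add (HasDerivAt.fun_sum fun m _ => (hE' m x).mul_const _)

/-- The end-point enters twice, through the interval and as the point of evaluation; the spatial
derivative and the variation of the resolvent add. -/
theorem hasDerivAt_sol_diag {E' : ι → ℝ → ℂ} (hE' : ∀ m x, HasDerivAt (E m) (E' m x) x)
    (hE : ∀ m, Continuous (E m)) (hF : ∀ m, Continuous (F m))
    (hK : ∀ x y, (K x y : ℂ) = ∑ m, E m x * F m y) (hdet : (1 - gram E F a).det ≠ 0)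
    {f : ℝ → ℂ} (hf : Continuous f) (k : Fin 2) {f' : ℂ} (hf' : HasDerivAt f f' (a k)) :
    HasDerivAt (fun t => sol E F f (Function.update a k t) (Function.update a k t k))
      (f' + ∑ m, E' m (a k) * coef E F f a m +
        sgn k * sol E F (fun x => (K x (a k) : ℂ)) a (a k) * sol E F f a (a k)) (a k) := by
  have hup : Function.update a k (a k) = a := Function.update_eq_self k a
  have h := hf'.add (HasDerivAt.fun_sum (u := Finset.univ) fun m _ =>
    (hE' m (a k)).mul (hasDerivAt_coef hE hF hdet hf k m))
  simp only [Function.update_self]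
  refine h.congr_deriv ?_
  rw [sol_kernel hE hF hK hdet, hup, add_assoc, Finset.mul_sum, Finset.sum_mul,
    ← Finset.sum_add_distrib]
  congr 1
  exact Finset.sum_congr rfl fun m _ => by ring

theorem differentiableAt_sol {E' : ι → ℝ → ℂ} (hE' : ∀ m x, HasDerivAt (E m) (E' m x) x)
    (hE : ∀ m, Continuous (E m)) (hF : ∀ m, Continuous (F m))
    (hdet : (1 - gram E F a).det ≠ 0)
    {f : ℝ → ℂ} (hf : Differentiable ℝ f) (j : Fin 2) :
    DifferentiableAt ℝ (fun a => sol E F f a (a j)) a := by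
  have hj : DifferentiableAt ℝ (fun a : Fin 2 → ℝ => a j) a := differentiableAt_apply j a
  refine ((hf (a j)).comp a hj).add (DifferentiableAt.fun_sum fun m _ => ?_)
  exact ((hE' m (a j)).differentiableAt.comp a hj).mul
    (differentiableAt_coef hE hF hdet hf.continuous m)

theorem integral_mul_sol (hE : ∀ m, Continuous (E m)) {f g : ℝ → ℂ} (hf : Continuous f)
    (hg : Continuous g) (a : Fin 2 → ℝ) : ∫ x in (a 0)..(a 1), g x * sol E F f a x =
      (∫ x in (a 0)..(a 1), g x * f x) + ∑ m, moment E g a m * coef E F f a m := by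
  simp only [sol, mul_add, Finset.mul_sum, ← mul_assoc]
  have h := intervalIntegral.integral_add (μ := MeasureTheory.volume)
    ((hg.mul hf).intervalIntegrable (a 0) (a 1))
    ((continuous_finsetSum Finset.univ fun m _ =>
      (hg.mul (hE m)).mul (continuous_const (y := coef E F f a m))).intervalIntegrable (a 0) (a 1))
  simp only [Pi.mul_apply] at h
  rw [h, intervalIntegral.integral_finsetSum]
  · simp only [intervalIntegral.integral_mul_const, moment, mul_comm (g _)]
  · intro m _
    exact ((hg.mul (hE m)).mul continuous_const).intervalIntegrable _ _

theorem differentiableAt_integral_mul_sol (hE : ∀ m, Continuous (E m)) (hF : ∀ m, Continuous (F m))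
    (hdet : (1 - gram E F a).det ≠ 0) {f g : ℝ → ℂ} (hf : Continuous f) (hg : Continuous g) :
    DifferentiableAt ℝ (fun a => ∫ x in (a 0)..(a 1), g x * sol E F f a x) a := by
  simp only [integral_mul_sol hE hf hg]
  exact (differentiable_integral_endpoints (hg.mul hf) a).add (DifferentiableAt.fun_sum fun m _ =>
    (differentiable_moment hE hg m a).mul (differentiableAt_coef hE hF hdet hf m))

theorem hasDerivAt_integral_mul_sol (hE : ∀ m, Continuous (E m)) (hF : ∀ m, Continuous (F m))
    (hK : ∀ x y, (K x y : ℂ) = ∑ m, E m x * F m y) (hsymm : ∀ x y, K x y = K y x)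
    (hdet : (1 - gram E F a).det ≠ 0) {f g : ℝ → ℂ} (hf : Continuous f) (hg : Continuous g)
    (k : Fin 2) :
    HasDerivAt (fun t => ∫ x in (Function.update a k t 0)..(Function.update a k t 1),
        g x * sol E F f (Function.update a k t) x)
      (sgn k * (sol E F g a (a k) * sol E F f a (a k))) (a k) := by
  have hup : Function.update a k (a k) = a := Function.update_eq_self k a
  simp only [integral_mul_sol hE hf hg]
  have h : HasDerivAt (fun t => (∫ x in (Function.update a k t 0)..(Function.update a k t 1),
      g x * f x) + ∑ m, moment E g (Function.update a k t) m * coef E F f (Function.update a k t) m)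
      (sgn k * (g (a k) * f (a k)) + ∑ m, (sgn k * (E m (a k) * g (a k)) *
        coef E F f (Function.update a k (a k)) m + moment E g (Function.update a k (a k)) m *
        (sgn k * (1 - gram E F a)⁻¹.mulVec (fun l => F l (a k)) m * sol E F f a (a k)))) (a k) :=
    (hasDerivAt_integral_update (hg.mul hf) a k).add
      (HasDerivAt.fun_sum fun m _ =>
        (hasDerivAt_integral_update ((hE m).mul hg) a k).mul (hasDerivAt_coef hE hF hdet hf k m))
  refine h.congr_deriv ?_
  rw [hup]
  have hKc : Continuous fun x => (K x (a k) : ℂ) := by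
    simp only [hK]; exact continuous_sum_mul hE _
  -- The derivative contains g(a_k) plus a pairing of g with the resolvent kernel; by symmetry of
  -- the resolvent this is the solution for g at a_k.
  have h1 : sol E F g a (a k) = g (a k) +
      ∑ m, moment E g a m * (1 - gram E F a)⁻¹.mulVec (fun l => F l (a k)) m := by
    have e1 := sol_sub_intOp hE hF hK (isUnit_det_of_ne_zero hdet) hg (a k)
    have e2 := integral_mul_sol_comm hE hF hK hsymm (isUnit_det_of_ne_zero hdet) hg hKc
    have e3 : intOp K a (sol E F g a) (a k) =
        ∫ x in (a 0)..(a 1), (K x (a k) : ℂ) * sol E F g a x := by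
      unfold intOp; simp only [hsymm (a k)]
    rw [sub_eq_iff_eq_add.mp e1, e3, ← e2]
    congr 1
    simp only [sol_kernel hE hF hK hdet, Finset.mul_sum, ← mul_assoc]
    rw [intervalIntegral.integral_finsetSum]
    · simp only [intervalIntegral.integral_mul_const, moment, mul_comm (g _)]
    · intro m _
      exact ((hg.mul (hE m)).mul continuous_const).intervalIntegrable _ _
  rw [h1]
  have h2 : sol E F f a (a k) = f (a k) + ∑ m, E m (a k) * coef E F f a m := rfl
  have e1 : ∑ m, sgn k * (E m (a k) * g (a k)) * coef E F f a m =
      sgn k * g (a k) * ∑ m, E m (a k) * coef E F f a m := by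
    rw [Finset.mul_sum]; exact Finset.sum_congr rfl fun m _ => by ring
  have e2 : ∑ m, moment E g a m * (sgn k * (1 - gram E F a)⁻¹.mulVec (fun l => F l (a k)) m *
      sol E F f a (a k)) = sgn k * sol E F f a (a k) *
        ∑ m, moment E g a m * (1 - gram E F a)⁻¹.mulVec (fun l => F l (a k)) m := by
    rw [Finset.mul_sum]; exact Finset.sum_congr rfl fun m _ => by ring
  rw [Finset.sum_add_distrib, e1, e2]
  linear_combination (-sgn k * g (a k)) * h2

/-- In Jacobi's formula the adjugate is det times the inverse, and the derivative of G is the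
rank-one matrix F(a_k) E(a_k); the contraction is the diagonal of the resolvent kernel. -/
theorem hasDerivAt_det_one_sub_gram (hE : ∀ m, Continuous (E m)) (hF : ∀ m, Continuous (F m))
    (hK : ∀ x y, (K x y : ℂ) = ∑ m, E m x * F m y) (hdet : (1 - gram E F a).det ≠ 0)
    (k : Fin 2) :
    HasDerivAt (fun t => (1 - gram E F (Function.update a k t)).det)
      (-sgn k * sol E F (fun x => (K x (a k) : ℂ)) a (a k) * (1 - gram E F a).det) (a k) := by
  have hup : Function.update a k (a k) = a := Function.update_eq_self k a
  have h := hasDerivAt_det (M := fun t => 1 - gram E F (Function.update a k t))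
    (M' := Matrix.of fun m l => -(sgn k * (F m (a k) * E l (a k)))) (t := a k) fun m l =>
      (hasDerivAt_integral_update ((hF m).mul (hE l)) a k).const_sub _
  refine h.congr_deriv ?_
  rw [hup, sol_kernel hE hF hK hdet, Finset.sum_comm, Finset.mul_sum, Finset.sum_mul]
  refine Finset.sum_congr rfl fun l _ => ?_
  simp only [Matrix.mulVec, dotProduct, Finset.mul_sum, Finset.sum_mul]
  refine Finset.sum_congr rfl fun m _ => ?_
  rw [Matrix.inv_def, Ring.inverse_eq_inv', Matrix.smul_apply, smul_eq_mul, Matrix.of_apply]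
  field_simp

end FiniteRank

/-! ### Positive definiteness of 1 - G and the matrix Neumann series -/

section PositiveDefinite

open scoped ComplexOrder

section Matrices

variable {ι : Type*} [Fintype ι] [DecidableEq ι]

theorem eigenvalues_lt_one {A : Matrix ι ι ℂ} (hA : A.IsHermitian) (h : (1 - A).PosDef) (i : ι) :
    hA.eigenvalues i < 1 := by
  set v : ι → ℂ := ⇑(hA.eigenvectorBasis i) with hv
  have hv0 : v ≠ 0 := fun h0 => (hA.eigenvectorBasis.orthonormal.ne_zero i) (by
    ext j; exact congrFun h0 j)
  have h1 := h.dotProduct_mulVec_pos hv0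
  have h2 : (1 - A).mulVec v = ((1 - hA.eigenvalues i : ℝ) : ℂ) • v := by
    rw [Matrix.sub_mulVec, Matrix.one_mulVec, hA.mulVec_eigenvectorBasis]
    ext j
    simp [sub_mul, hv]
  have h3 : 0 ≤ star v ⬝ᵥ v := dotProduct_star_self_nonneg v
  rw [h2, dotProduct_smul, smul_eq_mul] at h1
  by_contra hle
  push Not at hle
  have h4 : ((1 - hA.eigenvalues i : ℝ) : ℂ) ≤ 0 := by
    exact_mod_cast sub_nonpos.mpr hle
  exact absurd h1 (mul_nonpos_of_nonpos_of_nonneg h4 h3).not_gt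

/-- The spectrum lies in [0, 1); a unitary diagonalisation reduces the claim to scalar geometric
series. -/
theorem summable_pow_of_posSemidef {A : Matrix ι ι ℂ} (hA : A.PosSemidef) (h : (1 - A).PosDef) :
    Summable fun n => A ^ n := by
  have hH := hA.isHermitian
  set U : Matrix ι ι ℂ := (hH.eigenvectorUnitary : Matrix ι ι ℂ) with hU
  set d : ι → ℂ := RCLike.ofReal ∘ hH.eigenvalues with hd
  have hUU : star U * U = 1 := Unitary.coe_star_mul_self hH.eigenvectorUnitary
  have hUU' : U * star U = 1 := Unitary.coe_mul_star_self hH.eigenvectorUnitary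
  have hspec : A = U * Matrix.diagonal d * star U := by
    conv_lhs => rw [hH.spectral_theorem, Unitary.conjStarAlgAut_apply]
  have hpow : ∀ n, A ^ n = U * Matrix.diagonal (d ^ n) * star U := by
    intro n
    induction n with
    | zero => simp [hUU']
    | succ n ih =>
      have : (d ^ (n + 1)) = fun i => (d ^ n) i * d i := by ext i; simp [pow_succ]
      rw [pow_succ, ih, this, ← Matrix.diagonal_mul_diagonal]
      nth_rewrite 1 [hspec]
      calc U * Matrix.diagonal (d ^ n) * star U * (U * Matrix.diagonal d * star U)
          = U * Matrix.diagonal (d ^ n) * (star U * U) * Matrix.diagonal d * star U := by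
            simp only [mul_assoc]
        _ = _ := by rw [hUU, mul_one]; simp only [mul_assoc]
  simp only [hpow]
  have hsum : ∀ i, Summable fun n : ℕ => (d ^ n) i := by
    intro i
    simp only [Pi.pow_apply]
    refine summable_geometric_of_norm_lt_one ?_
    have h0 := hA.eigenvalues_nonneg i
    have h1 := eigenvalues_lt_one hH h i
    simp only [hd, Function.comp_apply, RCLike.norm_ofReal]
    rwa [abs_of_nonneg h0]
  have hdiag : Summable fun n : ℕ => Matrix.diagonal (d ^ n) := by
    refine Summable.matrix_diagonal ?_
    exact Pi.summable.mpr hsum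
  exact (hdiag.mul_left U).mul_right (star U)

/-- The Neumann series of a positive contraction. -/
theorem hasSum_pow_of_posSemidef {A : Matrix ι ι ℂ} (hA : A.PosSemidef) (h : (1 - A).PosDef) :
    HasSum (fun n => A ^ n) (1 - A)⁻¹ := by
  obtain ⟨S, hS⟩ := summable_pow_of_posSemidef hA h
  have h1 : HasSum (fun n => A ^ (n + 1)) (A * S) := by
    simp only [pow_succ']
    exact hS.mul_left A
  have h2 : HasSum (fun n => A ^ (n + 1)) (S - 1) := by
    have := (hasSum_nat_add_iff' 1).mpr hS
    simpa using this
  have h3 : (1 - A) * S = 1 := by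
    rw [sub_mul, one_mul, h1.unique h2]; abel
  rwa [Matrix.inv_eq_right_inv h3]

theorem gram_isHermitian {E F : ι → ℝ → ℂ} (hEF : ∀ m x, F m x = starRingEnd ℂ (E m x))
    (a : Fin 2 → ℝ) : (gram E F a).IsHermitian := by
  ext m l
  simp only [Matrix.conjTranspose_apply, gram, Matrix.of_apply, RCLike.star_def]
  rw [intervalIntegral.intervalIntegral_eq_integral_uIoc,
    intervalIntegral.intervalIntegral_eq_integral_uIoc, Complex.real_smul, map_mul,
    Complex.conj_ofReal, ← integral_conj, Complex.real_smul]
  simp only [hEF, map_mul, Complex.conj_conj, mul_comm]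

/-- Positivity questions about G become comparisons of L² norms on I. -/
theorem star_dotProduct_gram {E F : ι → ℝ → ℂ} (hE : ∀ m, Continuous (E m))
    (hEF : ∀ m x, F m x = starRingEnd ℂ (E m x)) (a : Fin 2 → ℝ) (c : ι → ℂ) :
    star c ⬝ᵥ (gram E F a).mulVec c =
      ((∫ x in (a 0)..(a 1), Complex.normSq (∑ m, E m x * c m) : ℝ) : ℂ) := by
  have hF : ∀ m, Continuous (F m) := fun m => by
    rw [funext (hEF m)]; exact Complex.continuous_conj.comp (hE m)
  rw [← moment_sum_mul hE hF, ← intervalIntegral.integral_ofReal]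
  simp only [dotProduct, moment, Pi.star_apply, ← intervalIntegral.integral_const_mul]
  rw [← intervalIntegral.integral_finsetSum]
  · refine intervalIntegral.integral_congr fun x _ => ?_
    simp only [Complex.normSq_eq_conj_mul_self, map_sum, map_mul, Finset.sum_mul, hEF]
    refine Finset.sum_congr rfl fun m _ => ?_
    rw [RCLike.star_def]; ring
  · intro m _
    exact (continuous_const.mul ((hF m).mul (continuous_sum_mul hE c))).intervalIntegrable _ _

theorem gram_posSemidef {E F : ι → ℝ → ℂ} (hE : ∀ m, Continuous (E m))
    (hEF : ∀ m x, F m x = starRingEnd ℂ (E m x)) {a : Fin 2 → ℝ} (ha : a 0 ≤ a 1) :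
    (gram E F a).PosSemidef := by
  refine Matrix.PosSemidef.of_dotProduct_mulVec_nonneg (gram_isHermitian hEF a) fun c => ?_
  rw [star_dotProduct_gram hE hEF]
  exact_mod_cast intervalIntegral.integral_nonneg ha fun x _ => Complex.normSq_nonneg _

end Matrices

/-- The exponentials that span the range of the conditioned kernel. -/
noncomputable def baseE (N : ℕ) (m : Fin N) : ℝ → ℂ := cwave N m

/-- The complex conjugates of `baseE`. -/
noncomputable def baseF (N : ℕ) (m : Fin N) (x : ℝ) : ℂ := cwave N m (-x)

theorem continuous_baseE (N : ℕ) (m : Fin N) : Continuous (baseE N m) := continuous_cwave N m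

theorem continuous_baseF (N : ℕ) (m : Fin N) : Continuous (baseF N m) :=
  (continuous_cwave N m).comp continuous_neg

theorem baseF_eq_conj (N : ℕ) (m : Fin N) (x : ℝ) :
    baseF N m x = starRingEnd ℂ (baseE N m x) := (conj_cwave N m x).symm

theorem condKernel_eq {N : ℕ} (hN : 1 ≤ N) (x y : ℝ) :
    (condKernel N x y : ℂ) = ∑ m, baseE N m x * baseF N m y := by
  rw [condKernel_eq_sum hN, Finset.sum_range]
  rfl

theorem integral_wave_mul (N m l : ℕ) (s : ℝ) :
    ∫ y in s..(s + 2 * Real.pi), wave N m (-y) * wave N l y =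
      if m = l then 2 * (Real.pi : ℂ) else 0 := by
  have h1 : ∀ y : ℝ, wave N m (-y) * wave N l y = Complex.exp (Complex.I * (l - m) * y) := by
    intro y; rw [wave, wave, ← Complex.exp_add]; push_cast; ring_nf
  simp only [h1]
  split_ifs with h
  · subst h; simp
  · have hc : Complex.I * ((l : ℂ) - m) ≠ 0 :=
      mul_ne_zero Complex.I_ne_zero (sub_ne_zero.mpr (by exact_mod_cast Ne.symm h))
    rw [integral_exp_mul_complex hc, div_eq_zero_iff]
    left
    rw [sub_eq_zero, Complex.exp_eq_exp_iff_exists_int]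
    exact ⟨(l : ℤ) - m, by push_cast; ring⟩

theorem gram_wave (N : ℕ) {a : Fin 2 → ℝ} (ha : a 1 = a 0 + 2 * Real.pi) :
    gram (fun m : Fin N => wave N m) (fun m x => wave N m (-x)) a =
      (2 * (Real.pi : ℂ)) • (1 : Matrix (Fin N) (Fin N) ℂ) := by
  ext m l
  simp only [gram, Matrix.of_apply, ha, integral_wave_mul, Matrix.smul_apply, Matrix.one_apply,
    smul_eq_mul, mul_ite, mul_one, mul_zero, Fin.val_inj]

theorem integral_normSq_wave (N : ℕ) (c : Fin N → ℂ) (s : ℝ) :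
    ∫ x in s..(s + 2 * Real.pi), Complex.normSq (∑ m : Fin N, wave N m x * c m) =
      2 * Real.pi * ∑ m, Complex.normSq (c m) := by
  have h := star_dotProduct_gram (E := fun m : Fin N => wave N m)
    (F := fun m x => wave N m (-x)) (fun m => continuous_wave N m)
    (fun m x => (conj_wave N m x).symm) ![s, s + 2 * Real.pi] c
  rw [gram_wave N (by simp), Matrix.smul_mulVec, Matrix.one_mulVec, dotProduct_smul,
    smul_eq_mul] at h
  have h2 : star c ⬝ᵥ c = ((∑ m, Complex.normSq (c m) : ℝ) : ℂ) := by
    simp [dotProduct, Complex.normSq_eq_conj_mul_self]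
  rw [h2] at h
  have h3 := h.symm
  simp only [Matrix.cons_val_zero, Matrix.cons_val_one] at h3
  exact_mod_cast h3

/-- Removing the mean is an orthogonal projection; the defect is N |mean|². -/
theorem sum_normSq_sub_mean_le {N : ℕ} (hN : 1 ≤ N) (c : Fin N → ℂ) :
    ∑ m, Complex.normSq (c m - (∑ l, c l) / N) ≤ ∑ m, Complex.normSq (c m) := by
  have hN' : (N : ℂ) ≠ 0 := by exact_mod_cast (by omega : N ≠ 0)
  set M := (∑ l, c l) / (N : ℂ) with hM
  have h1 : ∑ l, c l = N * M := by rw [hM]; field_simp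
  have h2 : ((∑ m, Complex.normSq (c m - M) : ℝ) : ℂ) =
      ((∑ m, Complex.normSq (c m) - N * Complex.normSq M : ℝ) : ℂ) := by
    push_cast
    simp only [Complex.normSq_eq_conj_mul_self, map_sub, sub_mul, mul_sub, Finset.sum_sub_distrib,
      ← Finset.mul_sum, ← Finset.sum_mul, h1, ← map_sum, Finset.sum_const, Finset.card_univ,
      Fintype.card_fin, nsmul_eq_mul, map_mul, Complex.conj_natCast]
    ring
  have h3 : ∑ m, Complex.normSq (c m - M) = ∑ m, Complex.normSq (c m) - N * Complex.normSq M := by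
    exact_mod_cast h2
  rw [h3]
  have := Complex.normSq_nonneg M
  have h4 : (0 : ℝ) ≤ N := Nat.cast_nonneg N
  nlinarith

/-- Centring is a symmetric matrix, so it may be moved from the exponentials to the coefficients,
where orthogonality applies. -/
theorem sum_baseE_mul {N : ℕ} (c : Fin N → ℂ) (x : ℝ) :
    ∑ m, baseE N m x * c m = (∑ m : Fin N, wave N m x * (c m - (∑ l, c l) / N)) /
      (Real.sqrt (2 * Real.pi) : ℂ) := by
  simp only [baseE, cwave, mul_sub, Finset.sum_sub_distrib, div_mul_eq_mul_div, ← Finset.sum_div,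
    sub_mul, ← Finset.sum_mul, ← Finset.mul_sum, waveMean, ← Fin.sum_univ_eq_sum_range]
  ring

theorem integral_normSq_baseE_le {N : ℕ} (hN : 1 ≤ N) (c : Fin N → ℂ) (s : ℝ) :
    ∫ x in s..(s + 2 * Real.pi), Complex.normSq (∑ m : Fin N, baseE N m x * c m) ≤
      ∑ m, Complex.normSq (c m) := by
  simp only [sum_baseE_mul, map_div₀, Complex.normSq_ofReal,
    Real.mul_self_sqrt (by positivity : (0 : ℝ) ≤ 2 * Real.pi)]
  rw [intervalIntegral.integral_div, integral_normSq_wave, mul_div_cancel_left₀ _ (by positivity)]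
  exact sum_normSq_sub_mean_le hN c

theorem analyticAt_wave (N m : ℕ) (x : ℝ) : AnalyticAt ℝ (wave N m) x := by
  have h1 : AnalyticAt ℝ (fun x : ℝ => Complex.I * (m - (N - 1) / 2) * (x : ℂ)) x :=
    analyticAt_const.mul (Complex.ofRealCLM.analyticAt x)
  exact (analyticAt_cexp.restrictScalars (𝕜 := ℝ)).comp h1

theorem analyticAt_cwave (N m : ℕ) (x : ℝ) : AnalyticAt ℝ (cwave N m) x := by
  unfold cwave waveMean
  simp only [div_eq_mul_inv]
  exact ((analyticAt_wave N m x).sub ((Finset.analyticAt_fun_sum _ fun l _ =>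
    analyticAt_wave N l x).mul analyticAt_const)).mul analyticAt_const

theorem integral_normSq_baseE_lt {N : ℕ} (hN : 1 ≤ N) {a : Fin 2 → ℝ}
    (ha' : a 1 - a 0 < 2 * Real.pi) {c : Fin N → ℂ} (hc : c ≠ 0) :
    ∫ x in (a 0)..(a 1), Complex.normSq (∑ m : Fin N, baseE N m x * c m) <
      ∑ m, Complex.normSq (c m) := by
  set g : ℝ → ℂ := fun x => ∑ m : Fin N, baseE N m x * c m with hg
  have hgc : Continuous fun x => Complex.normSq (g x) :=
    Complex.continuous_normSq.comp (continuous_sum_mul (continuous_baseE N) c)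
  have hle := integral_normSq_baseE_le hN c (a 0)
  change ∫ x in (a 0)..(a 0 + 2 * Real.pi), Complex.normSq (g x) ≤ _ at hle
  rw [← intervalIntegral.integral_add_adjacent_intervals (hgc.intervalIntegrable (a 0) (a 1))
    (hgc.intervalIntegrable (a 1) (a 0 + 2 * Real.pi))] at hle
  have hlt : a 1 < a 0 + 2 * Real.pi := by linarith
  -- Either g has mass on the rest of the period, making the bound strict, or it vanishes there and
  -- hence everywhere by analyticity. In the second case the left side is 0 while c ≠ 0.
  by_cases hz : ∃ x ∈ Set.Icc (a 1) (a 0 + 2 * Real.pi), 0 < Complex.normSq (g x)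
  · have := intervalIntegral.integral_pos hlt hgc.continuousOn
      (fun x _ => Complex.normSq_nonneg (g x)) hz
    linarith
  · push Not at hz
    have hg0 : g = 0 := by
      have han : AnalyticOnNhd ℝ g Set.univ := fun x _ =>
        Finset.analyticAt_fun_sum _ fun m _ => (analyticAt_cwave N m x).mul analyticAt_const
      have hev : g =ᶠ[𝓝 ((a 1 + (a 0 + 2 * Real.pi)) / 2)] 0 := by
        filter_upwards [Ioo_mem_nhds (show a 1 < (a 1 + (a 0 + 2 * Real.pi)) / 2 by linarith)
          (show (a 1 + (a 0 + 2 * Real.pi)) / 2 < a 0 + 2 * Real.pi by linarith)] with x hx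
        exact Complex.normSq_eq_zero.mp
          (le_antisymm (hz x ⟨hx.1.le, hx.2.le⟩) (Complex.normSq_nonneg _))
      ext x
      exact han.eqOn_zero_of_preconnected_of_eventuallyEq_zero isPreconnected_univ (Set.mem_univ _)
        hev (Set.mem_univ x)
    obtain ⟨m, hm⟩ := Function.ne_iff.mp hc
    have h0 : ∫ x in (a 0)..(a 1), Complex.normSq (g x) = 0 := by simp [hg0]
    rw [h0]
    exact Finset.sum_pos' (fun m _ => Complex.normSq_nonneg _)
      ⟨m, Finset.mem_univ _, Complex.normSq_pos.mpr hm⟩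

/-- The degenerate interval a = 0 is covered too, which the expansions at the origin need. -/
theorem posDef_one_sub_gram {N : ℕ} (hN : 1 ≤ N) {a : Fin 2 → ℝ}
    (ha' : a 1 - a 0 < 2 * Real.pi) : (1 - gram (baseE N) (baseF N) a).PosDef := by
  refine Matrix.PosDef.of_dotProduct_mulVec_pos
    (Matrix.isHermitian_one.sub (gram_isHermitian (baseF_eq_conj N) a)) fun c hc => ?_
  rw [Matrix.sub_mulVec, Matrix.one_mulVec, dotProduct_sub,
    star_dotProduct_gram (continuous_baseE N) (baseF_eq_conj N)]
  have h2 : star c ⬝ᵥ c = ((∑ m, Complex.normSq (c m) : ℝ) : ℂ) := by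
    simp [dotProduct, Complex.normSq_eq_conj_mul_self]
  rw [h2, ← Complex.ofReal_sub]
  exact_mod_cast sub_pos.mpr (integral_normSq_baseE_lt hN ha' hc)

end PositiveDefinite

/-! ### Expansion of det(1 - X) in principal minors -/

section Determinants

variable {ι : Type*} [Fintype ι] [DecidableEq ι]

/-- The principal minor of a matrix on a set of indices. -/
noncomputable def principalMinor (X : Matrix ι ι ℂ) (s : Finset ι) : ℂ :=
  (X.submatrix (Subtype.val : s → ι) Subtype.val).det

/-- Multilinearity in the rows: for each row choose X or the identity. -/
theorem det_one_add_eq_sum_principalMinor (X : Matrix ι ι ℂ) :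
    (1 + X).det = ∑ s : Finset ι, principalMinor X s := by
  have h := (Matrix.detRowAlternating (n := ι) (R := ℂ)).map_add_univ X.row (1 : Matrix ι ι ℂ).row
  rw [add_comm]
  refine h.trans (Finset.sum_congr rfl fun s _ => ?_)
  exact Matrix.det_piecewise_one_eq_submatrix_det X s

theorem principalMinor_neg (X : Matrix ι ι ℂ) (s : Finset ι) :
    principalMinor (-X) s = (-1) ^ s.card * principalMinor X s := by
  have := Matrix.det_neg (X.submatrix (Subtype.val : s → ι) Subtype.val)
  rw [Fintype.card_coe] at this
  exact this

theorem card_image_univ_eq (n : ℕ) (s : Finset ι) (hs : s.card = n) :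
    (Finset.univ.filter fun m : Fin n → ι => Finset.univ.image m = s).card = n.factorial := by
  have e : {m : Fin n → ι // Finset.univ.image m = s} ≃ (Fin n ≃ s) :=
    { toFun := fun m => Equiv.ofBijective
        (fun i => (⟨m.1 i, m.2.le (Finset.mem_image_of_mem _ (Finset.mem_univ i))⟩ : s))
        ((Fintype.bijective_iff_surjective_and_card _).mpr ⟨fun ⟨y, hy⟩ => by
          obtain ⟨i, -, hi⟩ := Finset.mem_image.mp (m.2.ge hy)
          exact ⟨i, Subtype.ext hi⟩, by simp [hs]⟩)
      invFun := fun e => ⟨fun i => e i, by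
        ext y
        simp only [Finset.mem_image, Finset.mem_univ, true_and]
        constructor
        · rintro ⟨i, rfl⟩; exact (e i).2
        · intro hy; exact ⟨e.symm ⟨y, hy⟩, by simp⟩⟩
      left_inv := fun m => by ext i; rfl
      right_inv := fun e => by ext i; rfl }
  rw [← Fintype.card_subtype, Fintype.card_congr e,
    Fintype.card_equiv (Fintype.equivOfCardEq (by simp [hs])), Fintype.card_fin]

theorem det_submatrix_self_eq (X : Matrix ι ι ℂ) {n : ℕ} (m : Fin n → ι) :
    (X.submatrix m m).det =
      if (Finset.univ.image m).card = n then principalMinor X (Finset.univ.image m) else 0 := by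
  split_ifs with h
  · have hinj : Function.Injective m := by
      have := Finset.card_image_iff.mp (h.trans (Fintype.card_fin n).symm)
      simpa using this
    let e : Fin n ≃ (Finset.univ.image m : Finset ι) := Equiv.ofBijective
      (fun i => ⟨m i, Finset.mem_image_of_mem _ (Finset.mem_univ i)⟩)
      ⟨fun i j hij => hinj (Subtype.ext_iff.mp hij), fun ⟨y, hy⟩ => by
        obtain ⟨i, -, hi⟩ := Finset.mem_image.mp hy
        exact ⟨i, Subtype.ext hi⟩⟩
    rw [principalMinor, ← Matrix.det_submatrix_equiv_self e]
    rfl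
  · have hinj : ¬ Function.Injective m := fun hi => h (by
      rw [Finset.card_image_of_injective _ hi]; simp)
    obtain ⟨i, j, hij, hne⟩ : ∃ i j, m i = m j ∧ i ≠ j := by
      simpa [Function.Injective] using hinj
    exact Matrix.det_zero_of_row_eq hne (by ext l; simp [hij])

/-- Index maps with a repetition contribute 0, and each n-element set arises from n! injective maps.
This cancels the n! of the Fredholm series. -/
theorem sum_det_submatrix (X : Matrix ι ι ℂ) (n : ℕ) :
    ∑ m : Fin n → ι, (X.submatrix m m).det =
      n.factorial * ∑ s : Finset ι, if s.card = n then principalMinor X s else 0 := by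
  simp only [det_submatrix_self_eq]
  rw [← Finset.sum_fiberwise (s := Finset.univ) (g := fun m : Fin n → ι => Finset.univ.image m),
    Finset.mul_sum]
  refine Finset.sum_congr rfl fun s _ => ?_
  rw [Finset.sum_congr rfl (g := fun _ => if s.card = n then principalMinor X s else 0)
    fun m hm => by rw [(Finset.mem_filter.mp hm).2], Finset.sum_const, nsmul_eq_mul]
  split_ifs with h
  · rw [card_image_univ_eq n s h]
  · simp

/-- The expansion of a determinant that underlies the Fredholm series. -/
theorem hasSum_det_one_sub (X : Matrix ι ι ℂ) :
    HasSum (fun n : ℕ => ((-1 : ℂ) ^ n / n.factorial) * ∑ m : Fin n → ι, (X.submatrix m m).det)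
      (1 - X).det := by
  have h1 : ∀ n : ℕ, ((-1 : ℂ) ^ n / n.factorial) * ∑ m : Fin n → ι, (X.submatrix m m).det =
      ∑ s : Finset ι, if s.card = n then principalMinor (-X) s else 0 := by
    intro n
    have hn : (n.factorial : ℂ) ≠ 0 := by exact_mod_cast n.factorial_ne_zero
    rw [sum_det_submatrix, ← mul_assoc, div_mul_cancel₀ _ hn, Finset.mul_sum]
    refine Finset.sum_congr rfl fun s _ => ?_
    split_ifs with h
    · rw [principalMinor_neg, h]
    · simp
  simp only [h1]
  rw [sub_eq_add_neg, det_one_add_eq_sum_principalMinor]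
  refine hasSum_sum fun s _ => ?_
  have := hasSum_ite_eq s.card (principalMinor (-X) s)
  simpa only [eq_comm] using this

/-- Minors of size 0 and 1 account for 1 plus the trace; every larger minor has at least two small
factors in each term. -/
theorem isBigO_det_one_add {α : Type*} {l : Filter α} {X : α → Matrix ι ι ℂ} {g : α → ℝ}
    (hX : ∀ i j, (fun x => X x i j) =O[l] g) (hg : g =O[l] fun _ => (1 : ℝ)) :
    (fun x => (1 + X x).det - (1 + (X x).trace)) =O[l] fun x => g x ^ 2 := by
  have h1 : ∀ x, (1 + X x).det - (1 + (X x).trace) = ∑ s : Finset ι,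
      (principalMinor (X x) s - ((if s = ∅ then 1 else 0) +
        ∑ i, if s = {i} then X x i i else 0)) := by
    intro x
    rw [det_one_add_eq_sum_principalMinor, Finset.sum_sub_distrib, Finset.sum_add_distrib,
      Finset.sum_comm]
    simp [Matrix.trace]
  simp only [h1]
  refine IsBigO.fun_sum fun s _ => ?_
  rcases Nat.lt_or_ge s.card 2 with hs | hs
  · have hz : ∀ x, principalMinor (X x) s - ((if s = ∅ then 1 else 0) +
        ∑ i, if s = {i} then X x i i else 0) = 0 := by
      intro x
      rcases Nat.lt_or_ge s.card 1 with h0 | h0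
      · have : s = ∅ := Finset.card_eq_zero.mp (by omega)
        subst this
        simp [principalMinor, eq_comm (a := (∅ : Finset ι))]
      · obtain ⟨i, rfl⟩ := Finset.card_eq_one.mp (by omega : s.card = 1)
        have hd : principalMinor (X x) {i} = X x i i := by
          unfold principalMinor
          rw [Matrix.det_eq_elem_of_card_eq_one (by simp) ⟨i, Finset.mem_singleton_self i⟩]
          rfl
        simp [hd]
    simp only [hz]
    exact isBigO_zero _ _
  · have h0 : ¬ s = ∅ := fun h => by simp [h] at hs
    have h1 : ∀ i, ¬ s = {i} := fun i h => by simp [h] at hs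
    simp only [h0, h1, if_false, Finset.sum_const_zero, add_zero, sub_zero]
    unfold principalMinor
    simp only [Matrix.det_apply']
    refine IsBigO.fun_sum fun σ _ => ?_
    refine IsBigO.const_mul_left ?_ _
    have h2 : (fun x => ∏ i, (X x).submatrix (Subtype.val : s → ι) Subtype.val (σ i) i) =O[l]
        fun x => g x ^ s.card := by
      have := IsBigO.finsetProd (s := (Finset.univ : Finset s))
        (f := fun i x => (X x).submatrix (Subtype.val : s → ι) Subtype.val (σ i) i)
        (g := fun _ => g) fun i _ => hX _ _
      simpa using this
    refine h2.trans ?_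
    have h3 : (fun x => g x ^ 2 * g x ^ (s.card - 2)) =O[l] fun x => g x ^ 2 * 1 ^ (s.card - 2) :=
      (isBigO_refl _ _).mul (hg.pow _)
    simp only [← pow_add, Nat.add_sub_cancel' hs, one_pow, mul_one] at h3
    exact h3

end Determinants

/-! ### The Fredholm series as a finite determinant -/

section Fredholm

open MeasureTheory

variable {ι : Type*} [Fintype ι] [DecidableEq ι] {E F : ι → ℝ → ℂ} {K : ℝ → ℝ → ℝ}

theorem det_kernel_eq (hK : ∀ x y, (K x y : ℂ) = ∑ m, E m x * F m y) {n : ℕ} (x : Fin n → ℝ) :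
    (((Matrix.of fun i j : Fin n => K (x i) (x j)).det : ℝ) : ℂ) =
      ∑ m : Fin n → ι, ∑ σ : Equiv.Perm (Fin n),
        ((Equiv.Perm.sign σ : ℤ) : ℂ) * ∏ i, (F (m i) (x i) * E (m (σ i)) (x i)) := by
  have h1 : (((Matrix.of fun i j : Fin n => K (x i) (x j)).det : ℝ) : ℂ) =
      (Matrix.of fun i j : Fin n => (K (x i) (x j) : ℂ)).det :=
    RingHom.map_det Complex.ofRealHom _
  -- Passing to the inverse permutation groups the factors by the variable x_i, so that the integral
  -- over the cube factorises.
  rw [h1, Matrix.det_apply', Finset.sum_comm, ← Equiv.sum_comp (Equiv.inv (Equiv.Perm (Fin n)))]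
  refine Finset.sum_congr rfl fun σ _ => ?_
  simp only [Matrix.of_apply, hK, Equiv.inv_apply, Equiv.Perm.sign_inv]
  rw [Finset.prod_univ_sum, Finset.mul_sum, Fintype.piFinset_univ]
  refine Finset.sum_congr rfl fun m _ => ?_
  congr 1
  rw [Finset.prod_mul_distrib, Finset.prod_mul_distrib, mul_comm,
    ← Equiv.prod_comp σ fun i => E (m i) (x (σ⁻¹ i))]
  simp

/-- The variables separate, and each one-dimensional integral is an entry of the Gram matrix. -/
theorem integral_det_kernel (hE : ∀ m, Continuous (E m)) (hF : ∀ m, Continuous (F m))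
    (hK : ∀ x y, (K x y : ℂ) = ∑ m, E m x * F m y) {a : Fin 2 → ℝ} (ha : a 0 ≤ a 1) (n : ℕ) :
    ((∫ x in Set.pi Set.univ (fun _ : Fin n => Set.Icc (a 0) (a 1)),
      (Matrix.of fun i j : Fin n => K (x i) (x j)).det : ℝ) : ℂ) =
      ∑ m : Fin n → ι, ((gram E F a).submatrix m m).det := by
  have hcont : ∀ (m : Fin n → ι) (σ : Equiv.Perm (Fin n)), Continuous fun x : Fin n → ℝ =>
      ((Equiv.Perm.sign σ : ℤ) : ℂ) * ∏ i, (F (m i) (x i) * E (m (σ i)) (x i)) := fun m σ =>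
    continuous_const.mul (continuous_finsetProd _ fun i _ => ((hF _).comp (continuous_apply i)).mul
      ((hE _).comp (continuous_apply i)))
  have hint : ∀ g : (Fin n → ℝ) → ℂ, Continuous g →
      Integrable g (volume.restrict (Set.pi Set.univ fun _ : Fin n => Set.Icc (a 0) (a 1))) :=
    fun g hg => hg.continuousOn.integrableOn_compact (isCompact_univ_pi fun _ => isCompact_Icc)
  rw [← integral_complex_ofReal]
  simp only [det_kernel_eq hK]
  rw [integral_finsetSum _ fun m _ => hint _ (continuous_finsetSum _ fun σ _ => hcont m σ)]
  refine Finset.sum_congr rfl fun m _ => ?_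
  rw [integral_finsetSum _ fun σ _ => hint _ (hcont m σ),
    ← Matrix.det_transpose, Matrix.det_apply']
  refine Finset.sum_congr rfl fun σ _ => ?_
  rw [integral_const_mul]
  congr 1
  rw [volume_pi, Measure.restrict_pi_pi,
    integral_fintype_prod_eq_prod fun i y => F (m i) y * E (m (σ i)) y]
  refine Finset.prod_congr rfl fun i _ => ?_
  rw [Matrix.transpose_apply, Matrix.submatrix_apply, gram, Matrix.of_apply,
    intervalIntegral.integral_of_le ha, integral_Icc_eq_integral_Ioc]

theorem fredholmDet_eq (hE : ∀ m, Continuous (E m)) (hF : ∀ m, Continuous (F m))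
    (hK : ∀ x y, (K x y : ℂ) = ∑ m, E m x * F m y) {a : Fin 2 → ℝ} (ha : a 0 ≤ a 1) :
    (fredholmDet K a : ℂ) = (1 - gram E F a).det := by
  rw [← (hasSum_det_one_sub (gram E F a)).tsum_eq, fredholmDet, Complex.ofReal_tsum]
  refine tsum_congr fun n => ?_
  rw [← integral_det_kernel hE hF hK ha]
  push_cast
  rfl

end Fredholm

/-! ### Commutators carried through the resolvent -/

/-- `g` is a continuous solution of `g - k_I g = f`. -/
structure IsIntSol (k : ℝ → ℝ → ℝ) (a : Fin 2 → ℝ) (f g : ℝ → ℂ) : Prop where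
  continuous : Continuous g
  eq : ∀ x, g x - intOp k a g x = f x

theorem IsIntSol.congr {k : ℝ → ℝ → ℝ} {a : Fin 2 → ℝ} {f g f' g' : ℝ → ℂ}
    (h : IsIntSol k a f g) (hf : ∀ x, f x = f' x) (hg : ∀ x, g x = g' x) : IsIntSol k a f' g' := by
  obtain rfl := funext hf
  obtain rfl := funext hg
  exact h

theorem IsIntSol.const_mul {k : ℝ → ℝ → ℝ} {a : Fin 2 → ℝ} {f g : ℝ → ℂ} (h : IsIntSol k a f g)
    (c : ℂ) : IsIntSol k a (fun x => c * f x) (fun x => c * g x) := by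
  refine ⟨continuous_const.mul h.continuous, fun x => ?_⟩
  rw [← h.eq x, mul_sub]
  congr 1
  unfold intOp
  rw [← intervalIntegral.integral_const_mul]
  simp only [mul_left_comm]

theorem continuous_cexp_I : Continuous fun x : ℝ => Complex.exp (Complex.I * x) := by fun_prop

theorem continuous_condKernel {N : ℕ} (hN : 1 ≤ N) (x : ℝ) :
    Continuous fun y => (condKernel N x y : ℂ) := by
  simp only [condKernel_eq hN]
  exact continuous_finsetSum _ fun m _ => continuous_const.mul (continuous_baseF N m)

theorem continuous_condKernel_left {N : ℕ} (hN : 1 ≤ N) (y : ℝ) :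
    Continuous fun x => (condKernel N x y : ℂ) := by
  simp only [condKernel_symm hN _ y]
  exact continuous_condKernel hN y

variable {N : ℕ} {a : Fin 2 → ℝ}

theorem IsIntSol.add (hN : 1 ≤ N) {f g f' g' : ℝ → ℂ} (h : IsIntSol (condKernel N) a f g)
    (h' : IsIntSol (condKernel N) a f' g') :
    IsIntSol (condKernel N) a (fun x => f x + f' x) (fun x => g x + g' x) := by
  refine ⟨h.continuous.add h'.continuous, fun x => ?_⟩
  rw [← h.eq x, ← h'.eq x]
  unfold intOp
  have h1 := intervalIntegral.integral_add (μ := MeasureTheory.volume)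
    (((continuous_condKernel hN x).mul h.continuous).intervalIntegrable (a 0) (a 1))
    (((continuous_condKernel hN x).mul h'.continuous).intervalIntegrable (a 0) (a 1))
  simp only [Pi.mul_apply, ← mul_add] at h1
  rw [h1]
  ring

theorem IsIntSol.sub (hN : 1 ≤ N) {f g f' g' : ℝ → ℂ} (h : IsIntSol (condKernel N) a f g)
    (h' : IsIntSol (condKernel N) a f' g') :
    IsIntSol (condKernel N) a (fun x => f x - f' x) (fun x => g x - g' x) :=
  (h.add hN (h'.const_mul (-1))).congr (fun x => by ring) (fun x => by ring)

theorem condKernel_commutator (hN : 1 ≤ N) (x y : ℝ) :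
    (Complex.exp (Complex.I * x) - Complex.exp (Complex.I * y)) * (condKernel N x y : ℂ) =
      cwave N N x * cwave N 0 y - cwave N 0 x * cwave N N y := by
  rw [condKernel_eq_sum hN, sum_cwave_commutator hN]

/-- Moving e^{ix} past the operator costs the commutator, whose rank is at most two: multiples of φ̃
and ψ̃ with pairings of g as coefficients. -/
theorem IsIntSol.cexp_mul (hN : 1 ≤ N) {f g : ℝ → ℂ} (h : IsIntSol (condKernel N) a f g) :
    IsIntSol (condKernel N) a
      (fun x => Complex.exp (Complex.I * x) * f x +
        ((∫ y in (a 0)..(a 1), cwave N 0 y * g y) * cwave N N x -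
          (∫ y in (a 0)..(a 1), cwave N N y * g y) * cwave N 0 x))
      (fun x => Complex.exp (Complex.I * x) * g x) := by
  refine ⟨continuous_cexp_I.mul h.continuous, fun x => ?_⟩
  rw [← h.eq x]
  unfold intOp
  have hK := continuous_condKernel hN x
  have hg := h.continuous
  have h1 := intervalIntegral.integral_sub (μ := MeasureTheory.volume)
    ((continuous_const (y := Complex.exp (Complex.I * x)) |>.mul
      (hK.mul hg)).intervalIntegrable (a 0) (a 1))
    ((hK.mul (continuous_cexp_I.mul hg)).intervalIntegrable (a 0) (a 1))
  have h2 := intervalIntegral.integral_sub (μ := MeasureTheory.volume)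
    ((((continuous_cwave N 0).mul hg).mul
      (continuous_const (y := cwave N N x))).intervalIntegrable (a 0) (a 1))
    ((((continuous_cwave N N).mul hg).mul
      (continuous_const (y := cwave N 0 x))).intervalIntegrable (a 0) (a 1))
  simp only [Pi.mul_apply, intervalIntegral.integral_const_mul,
    intervalIntegral.integral_mul_const] at h1 h2
  have h3 : ∫ y in (a 0)..(a 1), (Complex.exp (Complex.I * x) * ((condKernel N x y : ℂ) * g y) -
      (condKernel N x y : ℂ) * (Complex.exp (Complex.I * y) * g y)) =
      ∫ y in (a 0)..(a 1), (cwave N 0 y * g y * cwave N N x - cwave N N y * g y * cwave N 0 x) := by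
    refine intervalIntegral.integral_congr fun y _ => ?_
    have := condKernel_commutator hN x y
    linear_combination g y * this
  rw [h1, h2] at h3
  linear_combination h3

theorem isIntSol_sol (hN : 1 ≤ N) (hdet : (1 - gram (baseE N) (baseF N) a).det ≠ 0) {f : ℝ → ℂ}
    (hf : Continuous f) : IsIntSol (condKernel N) a f (sol (baseE N) (baseF N) f a) :=
  ⟨continuous_sol (continuous_baseE N) hf, sol_sub_intOp (continuous_baseE N) (continuous_baseF N)
    (condKernel_eq hN) (isUnit_det_of_ne_zero hdet) hf⟩

/-- Identities between resolvents are proved below by checking that both sides have the same source.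
-/
theorem IsIntSol.unique (hN : 1 ≤ N) (hdet : (1 - gram (baseE N) (baseF N) a).det ≠ 0)
    {f g g' : ℝ → ℂ} (hf : Continuous f) (h : IsIntSol (condKernel N) a f g)
    (h' : IsIntSol (condKernel N) a f g') (x : ℝ) : g x = g' x := by
  rw [eq_sol (continuous_baseE N) (continuous_baseF N) (condKernel_eq hN)
    (isUnit_det_of_ne_zero hdet) hf h.continuous h.eq x,
    eq_sol (continuous_baseE N) (continuous_baseF N) (condKernel_eq hN)
    (isUnit_det_of_ne_zero hdet) hf h'.continuous h'.eq x]

/-- The resolvent applied to the `m`-th centred exponential. -/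
noncomputable def resWave (N m : ℕ) (a : Fin 2 → ℝ) : ℝ → ℂ :=
  sol (baseE N) (baseF N) (cwave N m) a

/-- The resolvent kernel. -/
noncomputable def resKernel (N : ℕ) (a : Fin 2 → ℝ) (y x : ℝ) : ℂ :=
  sol (baseE N) (baseF N) (fun x => (condKernel N x y : ℂ)) a x

/-- The bilinear pairing of the centred exponentials through the resolvent. -/
noncomputable def pairing (N m l : ℕ) (a : Fin 2 → ℝ) : ℂ :=
  ∫ x in (a 0)..(a 1), cwave N m x * resWave N l a x

theorem pairing_comm (hN : 1 ≤ N) (hdet : (1 - gram (baseE N) (baseF N) a).det ≠ 0) (m l : ℕ) :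
    pairing N m l a = pairing N l m a :=
  integral_mul_sol_comm (continuous_baseE N) (continuous_baseF N) (condKernel_eq hN)
    (condKernel_symm hN) (isUnit_det_of_ne_zero hdet) (continuous_cwave N m) (continuous_cwave N l)

theorem isIntSol_resWave (hN : 1 ≤ N) (hdet : (1 - gram (baseE N) (baseF N) a).det ≠ 0) (m : ℕ) :
    IsIntSol (condKernel N) a (cwave N m) (resWave N m a) :=
  isIntSol_sol hN hdet (continuous_cwave N m)

theorem isIntSol_resKernel (hN : 1 ≤ N) (hdet : (1 - gram (baseE N) (baseF N) a).det ≠ 0) (y : ℝ) :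
    IsIntSol (condKernel N) a (fun x => (condKernel N x y : ℂ)) (resKernel N a y) :=
  isIntSol_sol hN hdet (continuous_condKernel_left hN y)

/-- The inverse acts as the identity plus integration against the resolvent kernel; symmetry lets
the kernel be paired in its first variable. -/
theorem resWave_eq_add_integral (hN : 1 ≤ N) (hdet : (1 - gram (baseE N) (baseF N) a).det ≠ 0)
    (m : ℕ) (y : ℝ) : resWave N m a y =
      cwave N m y + ∫ x in (a 0)..(a 1), cwave N m x * resKernel N a y x := by
  have e1 := (isIntSol_resWave hN hdet m).eq y
  have e2 := integral_mul_sol_comm (continuous_baseE N) (continuous_baseF N) (condKernel_eq hN)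
    (condKernel_symm hN) (isUnit_det_of_ne_zero hdet) (continuous_cwave N m)
    (continuous_condKernel_left hN y)
  have e3 : intOp (condKernel N) a (resWave N m a) y =
      ∫ x in (a 0)..(a 1), (condKernel N x y : ℂ) * resWave N m a x := by
    unfold intOp; simp only [condKernel_symm hN y]
  rw [sub_eq_iff_eq_add.mp e1, e3]
  exact congrArg _ e2.symm

/-- The integrable form of the resolvent kernel. -/
theorem resKernel_commutator (hN : 1 ≤ N) (hdet : (1 - gram (baseE N) (baseF N) a).det ≠ 0)
    (x y : ℝ) : (Complex.exp (Complex.I * x) - Complex.exp (Complex.I * y)) * resKernel N a y x =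
      resWave N N a x * resWave N 0 a y - resWave N 0 a x * resWave N N a y := by
  have h1 := (((isIntSol_resKernel hN hdet y).cexp_mul hN).sub hN
    ((isIntSol_resKernel hN hdet y).const_mul (Complex.exp (Complex.I * y)))).congr
    (f' := fun x => resWave N 0 a y * cwave N N x - resWave N N a y * cwave N 0 x)
    (g' := fun x => (Complex.exp (Complex.I * x) - Complex.exp (Complex.I * y)) * resKernel N a y x)
    (fun x => by
      rw [resWave_eq_add_integral hN hdet, resWave_eq_add_integral hN hdet]
      linear_combination condKernel_commutator hN x y)
    (fun x => by ring)
  have h2 := ((isIntSol_resWave hN hdet N).const_mul (resWave N 0 a y)).sub hN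
    ((isIntSol_resWave hN hdet 0).const_mul (resWave N N a y))
  have hc : Continuous fun x => resWave N 0 a y * cwave N N x - resWave N N a y * cwave N 0 x :=
    (continuous_const.mul (continuous_cwave N N)).sub (continuous_const.mul (continuous_cwave N 0))
  rw [IsIntSol.unique hN hdet hc h1 h2 x]
  ring

/-- The spatial derivative of `resWave`. -/
noncomputable def dresWave (N m : ℕ) (a : Fin 2 → ℝ) (x : ℝ) : ℂ :=
  dcwave N m x + ∑ l : Fin N, dcwave N l x * coef (baseE N) (baseF N) (cwave N m) a l

theorem hasDerivAt_resWave (N m : ℕ) (a : Fin 2 → ℝ) (x : ℝ) :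
    HasDerivAt (resWave N m a) (dresWave N m a x) x :=
  hasDerivAt_sol_space (E' := fun l : Fin N => dcwave N l) (fun l x => hasDerivAt_cwave N l x)
    (hasDerivAt_cwave N m x)

theorem continuous_dresWave (N m : ℕ) (a : Fin 2 → ℝ) : Continuous (dresWave N m a) :=
  (continuous_dcwave N m).add (continuous_finsetSum _ fun l _ =>
    (continuous_dcwave N l).mul continuous_const)

theorem hasDerivAt_condKernel_right (hN : 1 ≤ N) (x y : ℝ) :
    HasDerivAt (fun y => (condKernel N x y : ℂ))
      (-∑ m ∈ Finset.range N, cwave N m x * dcwave N m (-y)) y := by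
  simp only [condKernel_eq_sum hN]
  have h := HasDerivAt.fun_sum (u := Finset.range N) fun m _ =>
    (((hasDerivAt_cwave N m (-y)).scomp y (hasDerivAt_neg y)).const_mul (cwave N m x))
  refine h.congr_deriv ?_
  rw [← Finset.sum_neg_distrib]
  exact Finset.sum_congr rfl fun m _ => by simp

/-- The operator `i (1 - e^{ix}) d/dx` applied to the resolvent of a centred exponential. -/
theorem isIntSol_mul_dresWave (hN : 1 ≤ N) (hdet : (1 - gram (baseE N) (baseF N) a).det ≠ 0)
    (m : ℕ) : IsIntSol (condKernel N) a
      (fun x => Complex.I * (1 - Complex.exp (Complex.I * x)) * dcwave N m x +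
        (N - 1) / 2 * pairing N 0 m a * cwave N N x + (N + 1) / 2 * pairing N N m a * cwave N 0 x -
        (Complex.I * (1 - ex a 1) * resWave N m a (a 1) * (condKernel N x (a 1) : ℂ) -
          Complex.I * (1 - ex a 0) * resWave N m a (a 0) * (condKernel N x (a 0) : ℂ)))
      (fun x => Complex.I * (1 - Complex.exp (Complex.I * x)) * dresWave N m a x) := by
  have hd : Continuous fun x : ℝ => Complex.I * (1 - Complex.exp (Complex.I * x)) :=
    continuous_const.mul (continuous_const.sub continuous_cexp_I)
  have hQ : Continuous (resWave N m a) := (isIntSol_resWave hN hdet m).continuous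
  refine ⟨hd.mul (continuous_dresWave N m a), fun x => ?_⟩
  have hK := continuous_condKernel hN x
  have hdK : Continuous fun y => ∑ m ∈ Finset.range N, cwave N m x * dcwave N m (-y) :=
    continuous_finsetSum _ fun l _ => continuous_const.mul
      ((continuous_dcwave N l).comp continuous_neg)
  have hdK' : Continuous fun y => ∑ m ∈ Finset.range N, dcwave N m x * cwave N m (-y) :=
    continuous_finsetSum _ fun l _ => continuous_const.mul
      ((continuous_cwave N l).comp continuous_neg)
  have hu : ∀ y : ℝ, HasDerivAt
      (fun y : ℝ => (condKernel N x y : ℂ) * (Complex.I * (1 - Complex.exp (Complex.I * y))))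
      (-(∑ m ∈ Finset.range N, cwave N m x * dcwave N m (-y)) *
        (Complex.I * (1 - Complex.exp (Complex.I * y))) +
        (condKernel N x y : ℂ) * Complex.exp (Complex.I * y)) y := by
    intro y
    have h1 := (hasDerivAt_condKernel_right hN x y).mul
      (((hasDerivAt_cexp_I y).const_sub 1).const_mul Complex.I)
    refine h1.congr_deriv ?_
    linear_combination (-(condKernel N x y : ℂ) * Complex.exp (Complex.I * y)) * Complex.I_mul_I
  have hu' : Continuous fun y : ℝ => -(∑ m ∈ Finset.range N, cwave N m x * dcwave N m (-y)) *
        (Complex.I * (1 - Complex.exp (Complex.I * y))) +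
        (condKernel N x y : ℂ) * Complex.exp (Complex.I * y) :=
    (hdK.neg.mul hd).add (hK.mul continuous_cexp_I)
  -- Integration by parts moves the derivative from the solution to the kernel; its boundary terms
  -- are the contributions of a_1 and a_2.
  have hibp := intervalIntegral.integral_mul_deriv_eq_deriv_mul (a := a 0) (b := a 1)
    (fun y _ => hu y) (fun y _ => hasDerivAt_resWave N m a y)
    (hu'.intervalIntegrable _ _) ((continuous_dresWave N m a).intervalIntegrable _ _)
  have hint : intOp (condKernel N) a
      (fun x => Complex.I * (1 - Complex.exp (Complex.I * x)) * dresWave N m a x) x =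
      ∫ y in (a 0)..(a 1), (condKernel N x y : ℂ) *
        (Complex.I * (1 - Complex.exp (Complex.I * y))) * dresWave N m a y := by
    unfold intOp
    simp only [mul_assoc]
  have hmom : ∀ l : Fin N, coef (baseE N) (baseF N) (cwave N m) a l =
      ∫ y in (a 0)..(a 1), cwave N l (-y) * resWave N m a y := fun l =>
    (congrFun (moment_sol (continuous_baseE N) (continuous_baseF N) (isUnit_det_of_ne_zero hdet)
      (continuous_cwave N m)) l).symm
  -- The coefficients are moments of the solution, so this part of the spatial derivative is the
  -- integral of ∂_x K̃ against it.
  have hsum : ∑ l : Fin N, dcwave N l x * coef (baseE N) (baseF N) (cwave N m) a l =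
      ∫ y in (a 0)..(a 1), (∑ m ∈ Finset.range N, dcwave N m x * cwave N m (-y)) *
        resWave N m a y := by
    simp only [hmom, Finset.sum_mul, mul_assoc]
    rw [intervalIntegral.integral_finsetSum, Finset.sum_range]
    · simp only [intervalIntegral.integral_const_mul]
    · intro l _
      exact (continuous_const.mul (((continuous_cwave N l).comp continuous_neg).mul
        hQ)).intervalIntegrable _ _
  have h1 := intervalIntegral.integral_add (μ := MeasureTheory.volume)
    ((continuous_const (y := Complex.I * (1 - Complex.exp (Complex.I * x))) |>.mul
      (hdK'.mul hQ)).intervalIntegrable (a 0) (a 1))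
    ((hu'.mul hQ).intervalIntegrable (a 0) (a 1))
  have h2 := intervalIntegral.integral_add (μ := MeasureTheory.volume)
    (((continuous_const (y := ((N : ℂ) - 1) / 2 * cwave N N x)).mul
      ((continuous_cwave N 0).mul hQ)).intervalIntegrable (a 0) (a 1))
    (((continuous_const (y := ((N : ℂ) + 1) / 2 * cwave N 0 x)).mul
      ((continuous_cwave N N).mul hQ)).intervalIntegrable (a 0) (a 1))
  -- All terms under the integral combine to the commutator with D, leaving the pairings with ψ̃ and
  -- φ̃.
  have h3 : ∀ y : ℝ, Complex.I * (1 - Complex.exp (Complex.I * x)) *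
      ((∑ m ∈ Finset.range N, dcwave N m x * cwave N m (-y)) * resWave N m a y) +
      (-(∑ m ∈ Finset.range N, cwave N m x * dcwave N m (-y)) *
        (Complex.I * (1 - Complex.exp (Complex.I * y))) +
        (condKernel N x y : ℂ) * Complex.exp (Complex.I * y)) * resWave N m a y =
      ((N : ℂ) - 1) / 2 * cwave N N x * (cwave N 0 y * resWave N m a y) +
      ((N : ℂ) + 1) / 2 * cwave N 0 x * (cwave N N y * resWave N m a y) := by
    intro y
    rw [condKernel_eq_sum hN]
    linear_combination resWave N m a y * sum_cwave_diff_commutator hN x y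
  simp only [Pi.mul_apply, h3, intervalIntegral.integral_const_mul] at h1 h2
  rw [h2] at h1
  rw [hint, hibp, dresWave, hsum]
  unfold pairing
  unfold ex
  linear_combination -h1

theorem continuous_sourceTerm (hN : 1 ≤ N) {f : ℝ → ℂ} (hf : Continuous f) (c₁ c₂ c₃ c₄ : ℂ) :
    Continuous fun x => f x + c₁ * cwave N N x + c₂ * cwave N 0 x -
      (c₃ * (condKernel N x (a 1) : ℂ) - c₄ * (condKernel N x (a 0) : ℂ)) :=
  ((hf.add (continuous_const.mul (continuous_cwave N N))).add
    (continuous_const.mul (continuous_cwave N 0))).sub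
    ((continuous_const.mul (continuous_condKernel_left hN _)).sub
      (continuous_const.mul (continuous_condKernel_left hN _)))

/-- The spatial differential equation of the resolvent of `φ̃`. -/
theorem mul_dresWave_last (hN : 1 ≤ N) (hdet : (1 - gram (baseE N) (baseF N) a).det ≠ 0) (x : ℝ) :
    Complex.I * (1 - Complex.exp (Complex.I * x)) * dresWave N N a x =
      -(((N : ℂ) + 1) / 2 * (1 - Complex.exp (Complex.I * x)) + pairing N 0 N a - 1 / N) *
          resWave N N a x +
        ((N : ℂ) + 1) * (pairing N N N a - 1 / N) * resWave N 0 a x -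
        (Complex.I * (1 - ex a 1) * resWave N N a (a 1) * resKernel N a (a 1) x -
          Complex.I * (1 - ex a 0) * resWave N N a (a 0) * resKernel N a (a 0) x) := by
  have hQ := isIntSol_resWave hN hdet N
  have hP := isIntSol_resWave hN hdet 0
  have hE := hQ.cexp_mul hN
  have h1 := isIntSol_mul_dresWave hN hdet N
  -- The term (1 - e^{ix}) times the solution needs the source of e^{ix} times the solution,
  -- supplied by `cexp_mul`; its rank-two part adjusts the coefficients of the pairings.
  have h2 := ((((hQ.const_mul (-(((N : ℂ) + 1) / 2) - pairing N 0 N a + 1 / N)).add hN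
    (hE.const_mul (((N : ℂ) + 1) / 2))).add hN
    (hP.const_mul (((N : ℂ) + 1) * (pairing N N N a - 1 / N)))).sub hN
    (((isIntSol_resKernel hN hdet (a 1)).const_mul
      (Complex.I * (1 - ex a 1) * resWave N N a (a 1))).sub hN
    ((isIntSol_resKernel hN hdet (a 0)).const_mul
      (Complex.I * (1 - ex a 0) * resWave N N a (a 0)))))
  have hc := continuous_sourceTerm (a := a) hN (f := fun x : ℝ =>
    Complex.I * (1 - Complex.exp (Complex.I * x)) * dcwave N N x)
    ((continuous_const.mul (continuous_const.sub continuous_cexp_I)).mul (continuous_dcwave N N))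
    (((N : ℂ) - 1) / 2 * pairing N 0 N a) (((N : ℂ) + 1) / 2 * pairing N N N a)
    (Complex.I * (1 - ex a 1) * resWave N N a (a 1))
    (Complex.I * (1 - ex a 0) * resWave N N a (a 0))
  rw [IsIntSol.unique hN hdet hc h1 (h2.congr (fun x => ?_) fun x => rfl) x]
  · ring
  · change _ * cwave N N x + _ * (_ + (pairing N 0 N a * _ - pairing N N N a * _)) + _ - _ = _
    rw [mul_dcwave_last hN]
    ring

/-- The spatial differential equation of the resolvent of `ψ̃`. -/
theorem mul_dresWave_zero (hN : 1 ≤ N) (hdet : (1 - gram (baseE N) (baseF N) a).det ≠ 0) (x : ℝ) :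
    Complex.I * (1 - Complex.exp (Complex.I * x)) * dresWave N 0 a x =
      (((N : ℂ) - 1) / 2 * (1 - Complex.exp (Complex.I * x)) + pairing N 0 N a - 1 / N) *
          resWave N 0 a x +
        ((N : ℂ) - 1) * (pairing N 0 0 a - 1 / N) * resWave N N a x -
        (Complex.I * (1 - ex a 1) * resWave N 0 a (a 1) * resKernel N a (a 1) x -
          Complex.I * (1 - ex a 0) * resWave N 0 a (a 0) * resKernel N a (a 0) x) := by
  have hQ := isIntSol_resWave hN hdet N
  have hP := isIntSol_resWave hN hdet 0
  have hE := hP.cexp_mul hN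
  have h1 := isIntSol_mul_dresWave hN hdet 0
  have h2 := ((((hP.const_mul (((N : ℂ) - 1) / 2 + pairing N 0 N a - 1 / N)).add hN
    (hE.const_mul (-(((N : ℂ) - 1) / 2)))).add hN
    (hQ.const_mul (((N : ℂ) - 1) * (pairing N 0 0 a - 1 / N)))).sub hN
    (((isIntSol_resKernel hN hdet (a 1)).const_mul
      (Complex.I * (1 - ex a 1) * resWave N 0 a (a 1))).sub hN
    ((isIntSol_resKernel hN hdet (a 0)).const_mul
      (Complex.I * (1 - ex a 0) * resWave N 0 a (a 0)))))
  have hc := continuous_sourceTerm (a := a) hN (f := fun x : ℝ =>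
    Complex.I * (1 - Complex.exp (Complex.I * x)) * dcwave N 0 x)
    ((continuous_const.mul (continuous_const.sub continuous_cexp_I)).mul (continuous_dcwave N 0))
    (((N : ℂ) - 1) / 2 * pairing N 0 0 a) (((N : ℂ) + 1) / 2 * pairing N N 0 a)
    (Complex.I * (1 - ex a 1) * resWave N 0 a (a 1))
    (Complex.I * (1 - ex a 0) * resWave N 0 a (a 0))
  rw [IsIntSol.unique hN hdet hc h1 (h2.congr (fun x => ?_) fun x => rfl) x]
  · ring
  · change _ * cwave N 0 x + _ * (_ + (pairing N 0 0 a * _ - pairing N N 0 a * _)) + _ - _ = _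
    rw [mul_dcwave_zero hN, pairing_comm hN hdet N 0]
    ring

/-- The diagonal of the resolvent kernel. -/
theorem resKernel_diag (hN : 1 ≤ N) (hdet : (1 - gram (baseE N) (baseF N) a).det ≠ 0) (y : ℝ) :
    Complex.I * Complex.exp (Complex.I * y) * resKernel N a y y =
      dresWave N N a y * resWave N 0 a y - dresWave N 0 a y * resWave N N a y := by
  have hR : DifferentiableAt ℝ (resKernel N a y) y := by
    have h1 : DifferentiableAt ℝ (fun x => (condKernel N x y : ℂ)) y := by
      simp only [condKernel_symm hN _ y]
      exact (hasDerivAt_condKernel_right hN y y).differentiableAt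
    exact (hasDerivAt_sol_space (E' := fun l : Fin N => dcwave N l)
      (fun l x => hasDerivAt_cwave N l x) h1.hasDerivAt).differentiableAt
  -- `resKernel_commutator` is differentiated in x at x = y. The factor e^{ix} - e^{iy} vanishes
  -- there, so the derivative of the resolvent kernel drops out.
  have h1 := ((hasDerivAt_cexp_I y).sub_const (Complex.exp (Complex.I * y))).mul hR.hasDerivAt
  have h2 := ((hasDerivAt_resWave N N a y).mul_const (resWave N 0 a y)).sub
    ((hasDerivAt_resWave N 0 a y).mul_const (resWave N N a y))
  have h3 := h1.unique (h2.congr_of_eventuallyEq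
    (Eventually.of_forall fun x => resKernel_commutator hN hdet x y))
  rw [sub_self, zero_mul, add_zero] at h3
  exact h3

/-! ### Return to the original unknowns and their partial derivatives -/

theorem isOpen_endpoints : IsOpen endpoints := by
  have h0 : Continuous fun a : Fin 2 → ℝ => a 0 := continuous_apply 0
  have h1 : Continuous fun a : Fin 2 → ℝ => a 1 := continuous_apply 1
  exact (isOpen_lt h0 continuous_const).inter
    ((isOpen_lt continuous_const h1).inter (isOpen_lt (h1.sub h0) continuous_const))

theorem endpoints_le {a : Fin 2 → ℝ} (ha : a ∈ endpoints) : a 0 ≤ a 1 :=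
  (ha.1.trans ha.2.1).le

theorem det_ne_zero_of_lt {N : ℕ} (hN : 1 ≤ N) {a : Fin 2 → ℝ} (ha : a 1 - a 0 < 2 * Real.pi) :
    (1 - gram (baseE N) (baseF N) a).det ≠ 0 := by
  open scoped ComplexOrder in
  exact (posDef_one_sub_gram hN ha).det_pos.ne'

theorem det_ne_zero {N : ℕ} (hN : 1 ≤ N) {a : Fin 2 → ℝ} (ha : a ∈ endpoints) :
    (1 - gram (baseE N) (baseF N) a).det ≠ 0 := det_ne_zero_of_lt hN ha.2.2

theorem janossy_eq_det {N : ℕ} (hN : 1 ≤ N) {a : Fin 2 → ℝ} (ha : a ∈ endpoints) :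
    (janossy N a : ℂ) = (1 - gram (baseE N) (baseF N) a).det :=
  fredholmDet_eq (continuous_baseE N) (continuous_baseF N) (condKernel_eq hN) (endpoints_le ha)

theorem janossy_pos {N : ℕ} (hN : 1 ≤ N) {a : Fin 2 → ℝ} (ha : a ∈ endpoints) :
    0 < janossy N a := by
  open scoped ComplexOrder in
  have h := (posDef_one_sub_gram hN ha.2.2).det_pos
  rw [← janossy_eq_det hN ha] at h
  exact_mod_cast h

theorem hasSum_neumann {N : ℕ} (hN : 1 ≤ N) {a : Fin 2 → ℝ} (ha : a ∈ endpoints) {f : ℝ → ℂ}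
    (hf : Continuous f) (x : ℝ) :
    HasSum (fun n => (intOp (condKernel N) a)^[n] f x) (sol (baseE N) (baseF N) f a x) :=
  hasSum_iterate_intOp (continuous_baseE N) (continuous_baseF N) (condKernel_eq hN)
    (hasSum_pow_of_posSemidef
      (gram_posSemidef (continuous_baseE N) (baseF_eq_conj N) (endpoints_le ha))
      (posDef_one_sub_gram hN ha.2.2)) hf x

theorem resolvent_eq_sol {N : ℕ} (hN : 1 ≤ N) {a : Fin 2 → ℝ} (ha : a ∈ endpoints) {f : ℝ → ℂ}
    (hf : Continuous f) : resolvent (condKernel N) a f = sol (baseE N) (baseF N) f a :=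
  funext fun x => (hasSum_neumann hN ha hf x).tsum_eq

section Identification

variable {N : ℕ} (hN : 1 ≤ N) {a : Fin 2 → ℝ} (ha : a ∈ endpoints)
include hN ha

theorem qVar_eq (j : Fin 2) : qVar N j a = resWave N N a (a j) := by
  rw [qVar, phi_eq hN, resolvent_eq_sol hN ha (continuous_cwave N N), resWave]

theorem pVar_eq (j : Fin 2) : pVar N j a = resWave N 0 a (a j) := by
  rw [pVar, psi_eq hN, resolvent_eq_sol hN ha (continuous_cwave N 0), resWave]

theorem uVar_eq : uVar N a = pairing N N N a := by
  rw [uVar, phi_eq hN, resolvent_eq_sol hN ha (continuous_cwave N N)]; rfl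

theorem wVar_eq : wVar N a = pairing N 0 0 a := by
  rw [wVar, psi_eq hN, resolvent_eq_sol hN ha (continuous_cwave N 0)]; rfl

theorem vVar_eq : vVar N a = pairing N 0 N a := by
  rw [vVar, psi_eq hN, phi_eq hN, resolvent_eq_sol hN ha (continuous_cwave N N)]; rfl

theorem RVar_eq (j k : Fin 2) : RVar N j k a = resKernel N a (a k) (a j) := by
  rw [RVar, resolvent_eq_sol hN ha (continuous_condKernel_left hN _), resKernel]

/-- Positivity permits the complex logarithm of det(1 - G), which is differentiated by the chain
rule on the slit plane. -/
theorem logJanossy_eq :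
    logJanossy N a = Complex.log (1 - gram (baseE N) (baseF N) a).det := by
  rw [logJanossy, Complex.ofReal_log (janossy_pos hN ha).le, janossy_eq_det hN ha]

theorem det_mem_slitPlane : (1 - gram (baseE N) (baseF N) a).det ∈ Complex.slitPlane := by
  rw [← janossy_eq_det hN ha]
  exact Complex.ofReal_mem_slitPlane.mpr (janossy_pos hN ha)

end Identification

theorem eventually_update_mem {a : Fin 2 → ℝ} (ha : a ∈ endpoints) (k : Fin 2) :
    ∀ᶠ t in 𝓝 (a k), Function.update a k t ∈ endpoints := by
  have h : ContinuousAt (fun t => Function.update a k t) (a k) :=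
    (hasDerivAt_update a k (a k)).continuousAt
  refine h.eventually_mem (isOpen_endpoints.mem_nhds ?_)
  rwa [Function.update_eq_self]

/-- The set of end-points is open, so agreement on it suffices for partial derivatives. -/
theorem pderiv_eq_of_hasDerivAt {f g : (Fin 2 → ℝ) → ℂ} {a : Fin 2 → ℝ} (ha : a ∈ endpoints)
    (h : ∀ b ∈ endpoints, f b = g b) {k : Fin 2} {g' : ℂ}
    (hg : HasDerivAt (fun t => g (Function.update a k t)) g' (a k)) : pderiv k f a = g' :=
  (hg.congr_of_eventuallyEq ((eventually_update_mem ha k).mono fun _ ht => h _ ht)).deriv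

theorem differentiable_cwave (N m : ℕ) : Differentiable ℝ (cwave N m) := fun x =>
  (hasDerivAt_cwave N m x).differentiableAt

section Derivatives

variable {N : ℕ} (hN : 1 ≤ N) {a : Fin 2 → ℝ} (hdet : (1 - gram (baseE N) (baseF N) a).det ≠ 0)
include hN hdet

theorem hasDerivAt_resWave_self (m : ℕ) (j : Fin 2) :
    HasDerivAt (fun t => resWave N m (Function.update a j t) (Function.update a j t j))
      (dresWave N m a (a j) + sgn j * resKernel N a (a j) (a j) * resWave N m a (a j)) (a j) :=
  hasDerivAt_sol_diag (E' := fun l : Fin N => dcwave N l) (fun l x => hasDerivAt_cwave N l x)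
    (continuous_baseE N) (continuous_baseF N) (condKernel_eq hN) hdet (continuous_cwave N m) j
    (hasDerivAt_cwave N m (a j))

theorem hasDerivAt_resWave_other (m : ℕ) {j k : Fin 2} (hjk : j ≠ k) :
    HasDerivAt (fun t => resWave N m (Function.update a k t) (Function.update a k t j))
      (sgn k * resKernel N a (a k) (a j) * resWave N m a (a k)) (a k) := by
  simp only [Function.update_of_ne hjk]
  exact hasDerivAt_sol (continuous_baseE N) (continuous_baseF N) (condKernel_eq hN) hdet
    (continuous_cwave N m) k (a j)

theorem hasDerivAt_pairing (m l : ℕ) (k : Fin 2) :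
    HasDerivAt (fun t => pairing N m l (Function.update a k t))
      (sgn k * (resWave N m a (a k) * resWave N l a (a k))) (a k) :=
  hasDerivAt_integral_mul_sol (continuous_baseE N) (continuous_baseF N) (condKernel_eq hN)
    (condKernel_symm hN) hdet (continuous_cwave N l) (continuous_cwave N m) k

theorem differentiableAt_resWave (m : ℕ) (j : Fin 2) :
    DifferentiableAt ℝ (fun a => resWave N m a (a j)) a :=
  differentiableAt_sol (E' := fun l : Fin N => dcwave N l) (fun l x => hasDerivAt_cwave N l x)
    (continuous_baseE N) (continuous_baseF N) hdet (differentiable_cwave N m) j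

theorem differentiableAt_pairing (m l : ℕ) : DifferentiableAt ℝ (pairing N m l) a :=
  differentiableAt_integral_mul_sol (continuous_baseE N) (continuous_baseF N) hdet
    (continuous_cwave N l) (continuous_cwave N m)

/-- The variation of the resolvent contributes ±R_{jj} q_j, which cancels the boundary term at a_j;
only the boundary term at the other end-point survives. -/
theorem resWave_q_self (j k : Fin 2) (hjk : j ≠ k) :
    Complex.I * (1 - ex a j) *
      (dresWave N N a (a j) + sgn j * resKernel N a (a j) (a j) * resWave N N a (a j)) =
      -(((N : ℂ) + 1) / 2 * (1 - ex a j) + pairing N 0 N a - 1 / (N : ℂ)) * resWave N N a (a j)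
        + ((N : ℂ) + 1) * (pairing N N N a - 1 / (N : ℂ)) * resWave N 0 a (a j)
        - sgn k * Complex.I * (1 - ex a k) * resKernel N a (a k) (a j) * resWave N N a (a k) := by
  have h := mul_dresWave_last hN hdet (a j)
  rw [mul_add]
  change Complex.I * (1 - ex a j) * _ = -(_ * (1 - ex a j) + _ - _) * _ + _ - _ at h
  rw [h]
  fin_cases j <;> fin_cases k <;> simp [sgn] at hjk ⊢ <;> ring

theorem resWave_p_self (j k : Fin 2) (hjk : j ≠ k) :
    Complex.I * (1 - ex a j) *
      (dresWave N 0 a (a j) + sgn j * resKernel N a (a j) (a j) * resWave N 0 a (a j)) =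
      (((N : ℂ) - 1) / 2 * (1 - ex a j) + pairing N 0 N a - 1 / (N : ℂ)) * resWave N 0 a (a j)
        + ((N : ℂ) - 1) * (pairing N 0 0 a - 1 / (N : ℂ)) * resWave N N a (a j)
        - sgn k * Complex.I * (1 - ex a k) * resKernel N a (a k) (a j) * resWave N 0 a (a k) := by
  have h := mul_dresWave_zero hN hdet (a j)
  rw [mul_add]
  change Complex.I * (1 - ex a j) * _ = (_ * (1 - ex a j) + _ - _) * _ + _ - _ at h
  rw [h]
  fin_cases j <;> fin_cases k <;> simp [sgn] at hjk ⊢ <;> ring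

end Derivatives

/-- Because the end-points straddle 0 and are less than 2π apart, each satisfies 0 < |a_j| < 2π. -/
theorem ex_ne_one {a : Fin 2 → ℝ} (ha : a ∈ endpoints) (j : Fin 2) : 1 - ex a j ≠ 0 := by
  intro h
  have h1 : Complex.exp (Complex.I * (a j : ℂ)) = 1 := (sub_eq_zero.mp h).symm
  obtain ⟨n, hn⟩ := Complex.exp_eq_one_iff.mp h1
  have h2 : a j = n * (2 * Real.pi) := by
    have : (a j : ℂ) = n * (2 * Real.pi) := by
      apply mul_left_cancel₀ Complex.I_ne_zero
      rw [hn]; ring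
    exact_mod_cast this
  obtain ⟨h3, h4, h5⟩ := ha
  have hpi := Real.pi_pos
  have h6 : a j ≠ 0 := by fin_cases j <;> [exact h3.ne; exact h4.ne']
  have h7 : |a j| < 2 * Real.pi := by
    rw [abs_lt]; fin_cases j <;> simp <;> constructor <;> linarith
  rw [h2, abs_mul, abs_of_pos (by positivity : 0 < 2 * Real.pi)] at h7
  have h8 : |(n : ℝ)| < 1 := by
    by_contra hc
    push Not at hc
    nlinarith
  have h9 : n = 0 := by
    rw [← Int.cast_abs] at h8
    exact Int.abs_lt_one_iff.mp (by exact_mod_cast h8)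
  rw [h9] at h2
  simp at h2
  exact h6 h2

theorem ex_sub_ex_ne_zero {a : Fin 2 → ℝ} (ha : a ∈ endpoints) {j k : Fin 2} (hjk : j ≠ k) :
    ex a j - ex a k ≠ 0 := by
  have key : ex a 0 - ex a 1 ≠ 0 := by
    intro h
    have h1 : Complex.exp (Complex.I * (a 1 : ℂ)) = Complex.exp (Complex.I * (a 0 : ℂ)) :=
      (sub_eq_zero.mp h).symm
    obtain ⟨n, hn⟩ := Complex.exp_eq_exp_iff_exists_int.mp h1
    have h2 : a 1 - a 0 = n * (2 * Real.pi) := by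
      have : (a 1 : ℂ) - a 0 = n * (2 * Real.pi) := by
        apply mul_left_cancel₀ Complex.I_ne_zero
        linear_combination hn
      exact_mod_cast this
    obtain ⟨h3, h4, h5⟩ := ha
    have hpi := Real.pi_pos
    have h6 : (0 : ℝ) < n := by
      by_contra hc
      push Not at hc
      nlinarith
    have h7 : (n : ℝ) < 1 := by
      by_contra hc
      push Not at hc
      nlinarith
    have h8 : 0 < n := by exact_mod_cast h6
    have h9 : n < 1 := by exact_mod_cast h7
    omega
  fin_cases j <;> fin_cases k <;> simp at hjk
  · exact key
  · intro h
    exact key (by rw [← neg_eq_zero, neg_sub]; exact h)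

theorem hasDerivAt_log_det {N : ℕ} (hN : 1 ≤ N) {a : Fin 2 → ℝ} (ha : a ∈ endpoints) (k : Fin 2) :
    HasDerivAt (fun t => Complex.log (1 - gram (baseE N) (baseF N) (Function.update a k t)).det)
      (-sgn k * resKernel N a (a k) (a k)) (a k) := by
  have hdet := det_ne_zero hN ha
  have h := hasDerivAt_det_one_sub_gram (continuous_baseE N) (continuous_baseF N)
    (condKernel_eq hN) hdet k
  have hup : Function.update a k (a k) = a := Function.update_eq_self k a
  have h2 := h.clog_real (by rw [hup]; exact det_mem_slitPlane hN ha)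
  refine h2.congr_deriv ?_
  rw [hup, mul_div_assoc, div_self hdet, mul_one]
  rfl

/-! ### Taylor expansion of the centred exponentials at 0 -/

section Taylor

theorem isBigO_pow_of_le {α : Type*} {l : Filter α} {r : α → ℝ} (hr : Tendsto r l (𝓝 0))
    {m n : ℕ} (h : n ≤ m) : (fun x => r x ^ m) =O[l] fun x => r x ^ n := by
  have h3 : (fun x => r x ^ n * r x ^ (m - n)) =O[l] fun x => r x ^ n * 1 ^ (m - n) :=
    (isBigO_refl _ _).mul ((hr.isBigO_one ℝ).pow _)
  simpa only [← pow_add, Nat.add_sub_cancel' h, one_pow, mul_one] using h3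

theorem isBigO_cexp_sub (c : ℂ) :
    (fun x : ℝ => Complex.exp (Complex.I * c * x) -
      (1 + Complex.I * c * x - c ^ 2 / 2 * x ^ 2 - Complex.I * c ^ 3 / 6 * x ^ 3)) =O[𝓝 0]
      fun x : ℝ => x ^ 4 := by
  have h1 : (fun z : ℂ => Complex.exp z - ∑ m ∈ Finset.range 4, z ^ m / m.factorial) =O[𝓝 0]
      fun z : ℂ => z ^ 4 := by
    -- The constant is that of `Complex.exp_bound` for n = 4, namely 5 / (4! · 4).
    refine IsBigO.of_bound (5 / 96) ?_
    filter_upwards [Metric.ball_mem_nhds (0 : ℂ) one_pos] with z hz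
    have := Complex.exp_bound (x := z) (by simpa using (mem_ball_zero_iff.mp hz).le)
      (n := 4) (by norm_num)
    refine this.trans (le_of_eq ?_)
    rw [norm_pow]
    norm_num [Nat.factorial]
    ring
  have h2 : Tendsto (fun x : ℝ => Complex.I * c * x) (𝓝 0) (𝓝 0) := by
    have : Continuous fun x : ℝ => Complex.I * c * x := by fun_prop
    simpa using this.tendsto 0
  have h3 := h1.comp_tendsto h2
  refine (h3.congr_left fun x => ?_).trans ?_
  · simp only [Function.comp_apply, Finset.sum_range_succ, Finset.sum_range_zero, Nat.factorial]
    push_cast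
    linear_combination (c ^ 2 * x ^ 2 / 2 + Complex.I * c ^ 3 * x ^ 3 / 6) * Complex.I_mul_I * (-1)
  · refine IsBigO.of_bound (‖c‖ ^ 4) (Eventually.of_forall fun x => ?_)
    simp [mul_pow]

/-- At the centre s = (n-1)/2 the odd sums vanish and the quadratic one is n(n²-1)/12; this gives
the expansion of the mean and the trace of G. -/
theorem sum_range_sub_pow (n : ℕ) (s : ℂ) :
    ∑ m ∈ Finset.range n, ((m : ℂ) - s) = n * (n - 1) / 2 - n * s ∧
    ∑ m ∈ Finset.range n, ((m : ℂ) - s) ^ 2 =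
      n * (n - 1) * (2 * n - 1) / 6 - n * (n - 1) * s + n * s ^ 2 ∧
    ∑ m ∈ Finset.range n, ((m : ℂ) - s) ^ 3 =
      n ^ 2 * (n - 1) ^ 2 / 4 - n * (n - 1) * (2 * n - 1) / 2 * s +
        3 * (n * (n - 1) / 2) * s ^ 2 - n * s ^ 3 := by
  induction n with
  | zero => simp
  | succ n ih =>
    obtain ⟨h1, h2, h3⟩ := ih
    refine ⟨?_, ?_, ?_⟩ <;> rw [Finset.sum_range_succ]
    · rw [h1]; push_cast; ring
    · rw [h2]; push_cast; ring
    · rw [h3]; push_cast; ring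

theorem isBigO_waveMean_sub {N : ℕ} (hN : 1 ≤ N) :
    (fun x : ℝ => waveMean N x - (1 - ((N : ℂ) ^ 2 - 1) / 24 * x ^ 2)) =O[𝓝 0]
      fun x : ℝ => x ^ 4 := by
  have hN' : (N : ℂ) ≠ 0 := by exact_mod_cast (by omega : N ≠ 0)
  have h := (IsBigO.fun_sum (s := Finset.range N) fun m _ =>
    isBigO_cexp_sub ((m : ℂ) - (N - 1) / 2)).const_mul_left (N : ℂ)⁻¹
  refine h.congr_left fun x => ?_
  obtain ⟨h1, h2, h3⟩ := sum_range_sub_pow N (((N : ℂ) - 1) / 2)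
  have e : ∀ m : ℂ, (1 + Complex.I * m * x - m ^ 2 / 2 * x ^ 2 - Complex.I * m ^ 3 / 6 * x ^ 3) =
      1 + (Complex.I * x) * m - (x ^ 2 / 2) * m ^ 2 - (Complex.I * x ^ 3 / 6) * m ^ 3 :=
    fun m => by ring
  simp only [e, Finset.sum_sub_distrib, Finset.sum_add_distrib, ← Finset.mul_sum, h1, h2, h3,
    Finset.sum_const, Finset.card_range, nsmul_eq_mul, waveMean]
  change _ * (∑ m ∈ Finset.range N, wave N m x - _) = _
  field_simp
  ring

/-- The Taylor expansion of the centred exponentials at the origin. -/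
theorem isBigO_cwave_sub {N : ℕ} (hN : 1 ≤ N) (m : ℕ) :
    (fun x : ℝ => cwave N m x - (Complex.I * (m - (N - 1) / 2) * x +
      (((N : ℂ) ^ 2 - 1) / 24 - (m - (N - 1) / 2) ^ 2 / 2) * x ^ 2 -
      Complex.I * (m - (N - 1) / 2) ^ 3 / 6 * x ^ 3) / (Real.sqrt (2 * Real.pi) : ℂ)) =O[𝓝 0]
      fun x : ℝ => x ^ 4 := by
  have h := ((isBigO_cexp_sub ((m : ℂ) - (N - 1) / 2)).sub
    (isBigO_waveMean_sub hN)).const_mul_left (Real.sqrt (2 * Real.pi) : ℂ)⁻¹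
  refine h.congr_left fun x => ?_
  rw [cwave, wave]
  ring

theorem isBigO_pow_pow_zero {m n : ℕ} (h : n ≤ m) (c : ℂ) :
    (fun x : ℝ => c * (x : ℂ) ^ m) =O[𝓝 0] fun x : ℝ => x ^ n := by
  refine IsBigO.const_mul_left ?_ c
  have h1 : (fun x : ℝ => (x : ℂ) ^ m) =O[𝓝 0] fun x : ℝ => x ^ m :=
    IsBigO.of_bound 1 (Eventually.of_forall fun x => by simp)
  exact h1.trans (isBigO_pow_of_le tendsto_id h)

/-- The first order expansion of the centred exponentials at the origin. -/
theorem isBigO_cwave_sub_linear {N : ℕ} (hN : 1 ≤ N) (m : ℕ) :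
    (fun x : ℝ => cwave N m x - Complex.I * (m - (N - 1) / 2) / (Real.sqrt (2 * Real.pi) : ℂ) * x)
      =O[𝓝 0] fun x : ℝ => x ^ 2 := by
  have h1 := (isBigO_cwave_sub hN m).trans
    (isBigO_pow_of_le tendsto_id (show 2 ≤ 4 by norm_num))
  have h2 := isBigO_pow_pow_zero (le_refl 2)
    ((((N : ℂ) ^ 2 - 1) / 24 - (m - (N - 1) / 2) ^ 2 / 2) / (Real.sqrt (2 * Real.pi) : ℂ))
  have h3 := isBigO_pow_pow_zero (show 2 ≤ 3 by norm_num)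
    (-Complex.I * (m - (N - 1) / 2) ^ 3 / 6 / (Real.sqrt (2 * Real.pi) : ℂ))
  refine ((h1.add h2).add h3).congr_left fun x => ?_
  ring

/-- Centring removes the constant term. This vanishing at 0 is what makes the resolvent corrections
small. -/
theorem isBigO_cwave {N : ℕ} (hN : 1 ≤ N) (m : ℕ) :
    cwave N m =O[𝓝 0] fun x : ℝ => x ^ 1 := by
  have h1 := (isBigO_cwave_sub_linear hN m).trans
    (isBigO_pow_of_le tendsto_id (show 1 ≤ 2 by norm_num))
  have h2 := isBigO_pow_pow_zero (le_refl 1)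
    (Complex.I * (m - (N - 1) / 2) / (Real.sqrt (2 * Real.pi) : ℂ))
  refine (h1.add h2).congr_left fun x => ?_
  rw [pow_one, sub_add_cancel]

theorem isBigO_mul_sub {f g : ℝ → ℂ} {α β : ℂ} (hf : (fun x : ℝ => f x - α * x) =O[𝓝 0]
    fun x : ℝ => x ^ 2) (hg : (fun x : ℝ => g x - β * x) =O[𝓝 0] fun x : ℝ => x ^ 2) :
    (fun x : ℝ => f x * g x - α * β * ((x ^ 2 : ℝ) : ℂ)) =O[𝓝 0] fun x : ℝ => x ^ 3 := by
  have hx : ∀ γ : ℂ, (fun x : ℝ => γ * (x : ℂ)) =O[𝓝 0] fun x : ℝ => x ^ 1 := fun γ => by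
    simpa using isBigO_pow_pow_zero (le_refl 1) γ
  have hg1 : g =O[𝓝 0] fun x : ℝ => x ^ 1 :=
    ((hg.trans (isBigO_pow_of_le tendsto_id (show 1 ≤ 2 by norm_num))).add (hx β)).congr_left
      fun x => by ring
  have h1 := (hf.mul hg1).add ((hg.mul (hx α)).congr_right fun x => rfl)
  refine (h1.congr_left fun x => ?_).congr_right fun x => ?_
  · push_cast; ring
  · ring

end Taylor

/-! ### Expansions of the unknowns for small intervals -/

section SmallIntervals

theorem tendsto_norm_zero_endpoints : Tendsto (fun a : Fin 2 → ℝ => ‖a‖) (𝓝 0) (𝓝 0) :=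
  tendsto_norm_zero

theorem isBigO_comp_apply {f : ℝ → ℂ} {n : ℕ} (hf : f =O[𝓝 0] fun x : ℝ => x ^ n) (j : Fin 2) :
    (fun a : Fin 2 → ℝ => f (a j)) =O[𝓝 0] fun a => ‖a‖ ^ n := by
  have h1 : Tendsto (fun a : Fin 2 → ℝ => a j) (𝓝 0) (𝓝 0) := (continuous_apply j).tendsto 0
  refine (hf.comp_tendsto h1).trans (IsBigO.of_bound 1 (Eventually.of_forall fun a => ?_))
  simp only [Function.comp_apply, norm_pow, norm_norm, one_mul]
  exact pow_le_pow_left₀ (norm_nonneg _) (norm_le_pi_norm a j) n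

theorem isBigO_integral {g : ℝ → ℂ} {n : ℕ} (hg : g =O[𝓝 0] fun x : ℝ => x ^ n) :
    (fun a : Fin 2 → ℝ => ∫ x in (a 0)..(a 1), g x) =O[𝓝 0] fun a => ‖a‖ ^ (n + 1) := by
  obtain ⟨C, hC⟩ := hg.bound
  obtain ⟨δ, hδ, hball⟩ := Metric.eventually_nhds_iff.mp hC
  refine IsBigO.of_bound (max C 0 * 2) ?_
  filter_upwards [Metric.ball_mem_nhds (0 : Fin 2 → ℝ) hδ] with a ha
  rw [mem_ball_zero_iff] at ha
  have h0 := norm_le_pi_norm a 0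
  have h1 := norm_le_pi_norm a 1
  have hb : ∀ x ∈ Set.uIoc (a 0) (a 1), ‖g x‖ ≤ max C 0 * ‖a‖ ^ n := by
    intro x hx
    have hxa : |x| ≤ ‖a‖ := by
      rw [Real.norm_eq_abs, abs_le] at h0 h1
      rcases Set.mem_uIoc.mp hx with h | h <;> exact abs_le.mpr ⟨by linarith, by linarith⟩
    have := hball (y := x) (by simpa using hxa.trans_lt ha)
    rw [norm_pow, Real.norm_eq_abs] at this
    exact this.trans (mul_le_mul (le_max_left _ _) (pow_le_pow_left₀ (abs_nonneg _) hxa n)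
      (by positivity) (le_max_right _ _))
  refine (intervalIntegral.norm_integral_le_of_norm_le_const hb).trans ?_
  have h2 : |a 1 - a 0| ≤ 2 * ‖a‖ := by
    have := abs_sub (a 1) (a 0)
    rw [Real.norm_eq_abs] at h0 h1
    linarith
  rw [norm_pow, norm_norm, pow_succ]
  have h3 : 0 ≤ max C 0 * ‖a‖ ^ n := by positivity
  nlinarith

theorem isBigO_integral_sub_cube {g : ℝ → ℂ} (hgc : Continuous g) {γ : ℂ}
    (hg : (fun x : ℝ => g x - γ * ((x ^ 2 : ℝ) : ℂ)) =O[𝓝 0] fun x : ℝ => x ^ 3) :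
    (fun a : Fin 2 → ℝ => (∫ x in (a 0)..(a 1), g x) - γ * (((a 1) ^ 3 - (a 0) ^ 3) / 3 : ℝ))
      =O[𝓝 0] fun a => ‖a‖ ^ 4 := by
  refine (isBigO_integral hg).congr_left fun a => ?_
  have hc : Continuous fun x : ℝ => γ * ((x ^ 2 : ℝ) : ℂ) := by fun_prop
  rw [intervalIntegral.integral_sub (hgc.intervalIntegrable _ _) (hc.intervalIntegrable _ _),
    intervalIntegral.integral_const_mul, intervalIntegral.integral_ofReal, integral_pow]
  norm_num

variable {N : ℕ} (hN : 1 ≤ N)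
include hN

theorem isBigO_baseE (m : Fin N) : baseE N m =O[𝓝 0] fun x : ℝ => x ^ 1 := isBigO_cwave hN m

theorem isBigO_baseF (m : Fin N) : baseF N m =O[𝓝 0] fun x : ℝ => x ^ 1 := by
  have h : Tendsto (fun x : ℝ => -x) (𝓝 0) (𝓝 0) := by simpa using continuous_neg.tendsto (0 : ℝ)
  refine ((isBigO_cwave hN m).comp_tendsto h).trans
    (IsBigO.of_bound 1 (Eventually.of_forall fun x => by simp))

theorem isBigO_integral_mul {f g : ℝ → ℂ} (hf : f =O[𝓝 0] fun x : ℝ => x ^ 1)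
    (hg : g =O[𝓝 0] fun x : ℝ => x ^ 1) :
    (fun a : Fin 2 → ℝ => ∫ x in (a 0)..(a 1), f x * g x) =O[𝓝 0] fun a => ‖a‖ ^ 3 :=
  isBigO_integral (n := 2) ((hf.mul hg).congr_right fun x => by ring)

/-- A moment integrates a product of two functions vanishing at 0, hence has order three; the
inverse matrix stays bounded because 1 - G is invertible at the origin. -/
theorem isBigO_coef (n : ℕ) (m : Fin N) :
    (fun a => coef (baseE N) (baseF N) (cwave N n) a m) =O[𝓝 0] fun a => ‖a‖ ^ 3 := by
  have hdet : (1 - gram (baseE N) (baseF N) 0).det ≠ 0 :=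
    det_ne_zero_of_lt hN (by simp [Real.pi_pos])
  simp only [coef, Matrix.mulVec, dotProduct]
  refine IsBigO.fun_sum fun l _ => ?_
  have h1 : (fun a => (1 - gram (baseE N) (baseF N) a)⁻¹ m l) =O[𝓝 0] fun _ => (1 : ℝ) :=
    ((differentiableAt_inv (fun i j => differentiable_one_sub_gram (continuous_baseE N)
      (continuous_baseF N) i j _) hdet m l).continuousAt).isBigO_one ℝ
  have h2 : (fun a => moment (baseF N) (cwave N n) a l) =O[𝓝 0] fun a => ‖a‖ ^ 3 :=
    isBigO_integral_mul hN (isBigO_baseF hN l) (isBigO_cwave hN n)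
  simpa using h1.mul h2

/-- The correction is a coefficient of order three times a centred exponential at a_j, itself of
order one. So q_j and p_j share the cubic expansions of φ̃ and ψ̃. -/
theorem isBigO_resWave_sub (n : ℕ) (j : Fin 2) :
    (fun a : Fin 2 → ℝ => resWave N n a (a j) - cwave N n (a j)) =O[𝓝 0] fun a => ‖a‖ ^ 4 := by
  simp only [resWave, sol, add_sub_cancel_left]
  refine IsBigO.fun_sum fun m _ => ?_
  exact ((isBigO_comp_apply (isBigO_baseE hN m) j).mul (isBigO_coef hN n m)).congr_right
    fun a => by ring

theorem isBigO_pairing_sub (m l : ℕ) :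
    (fun a : Fin 2 → ℝ => pairing N m l a - ∫ x in (a 0)..(a 1), cwave N m x * cwave N l x)
      =O[𝓝 0] fun a => ‖a‖ ^ 4 := by
  have h : ∀ a : Fin 2 → ℝ, pairing N m l a - ∫ x in (a 0)..(a 1), cwave N m x * cwave N l x =
      ∑ i, moment (baseE N) (cwave N m) a i * coef (baseE N) (baseF N) (cwave N l) a i := by
    intro a
    rw [pairing, resWave, integral_mul_sol (continuous_baseE N) (continuous_cwave N l)
      (continuous_cwave N m), add_sub_cancel_left]
  simp only [h]
  refine IsBigO.fun_sum fun i _ => ?_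
  have h2 : (fun a => moment (baseE N) (cwave N m) a i) =O[𝓝 0] fun a => ‖a‖ ^ 3 :=
    isBigO_integral_mul hN (isBigO_baseE hN i) (isBigO_cwave hN m)
  refine ((h2.mul (isBigO_coef hN l i)).congr_right fun a => (pow_add _ 3 3).symm).trans ?_
  exact isBigO_pow_of_le tendsto_norm_zero_endpoints (by norm_num)

theorem isBigO_resWave_taylor (n : ℕ) (j : Fin 2) :
    (fun a : Fin 2 → ℝ => resWave N n a (a j) - (Complex.I * (n - (N - 1) / 2) * (a j) +
      (((N : ℂ) ^ 2 - 1) / 24 - (n - (N - 1) / 2) ^ 2 / 2) * (a j) ^ 2 -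
      Complex.I * (n - (N - 1) / 2) ^ 3 / 6 * (a j) ^ 3) / (Real.sqrt (2 * Real.pi) : ℂ))
      =O[𝓝 0] fun a => ‖a‖ ^ 4 :=
  ((isBigO_resWave_sub hN n j).add (isBigO_comp_apply (isBigO_cwave_sub hN n) j)).congr_left
    fun a => by ring

theorem isBigO_pairing_cube (m l : ℕ) :
    (fun a : Fin 2 → ℝ => pairing N m l a + ((m : ℂ) - (N - 1) / 2) * (l - (N - 1) / 2) /
      (2 * Real.pi) * (((a 1) ^ 3 - (a 0) ^ 3) / 3 : ℝ)) =O[𝓝 0] fun a => ‖a‖ ^ 4 := by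
  have h1 := isBigO_integral_sub_cube ((continuous_cwave N m).mul (continuous_cwave N l))
    (isBigO_mul_sub (isBigO_cwave_sub_linear hN m) (isBigO_cwave_sub_linear hN l))
  refine ((isBigO_pairing_sub hN m l).add h1).congr_left fun a => ?_
  have e : Complex.I * (m - (N - 1) / 2) / (Real.sqrt (2 * Real.pi) : ℂ) *
      (Complex.I * (l - (N - 1) / 2) / (Real.sqrt (2 * Real.pi) : ℂ)) =
      -(((m : ℂ) - (N - 1) / 2) * (l - (N - 1) / 2) / (2 * Real.pi)) := by
    rw [div_mul_div_comm, sqrt_two_pi_sq, ← neg_div]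
    congr 1
    linear_combination ((m : ℂ) - (N - 1) / 2) * (l - (N - 1) / 2) * Complex.I_mul_I
  rw [e]
  simp only [Pi.mul_apply]
  ring

theorem isBigO_trace_gram :
    (fun a : Fin 2 → ℝ => (gram (baseE N) (baseF N) a).trace -
      (N : ℂ) * ((N : ℂ) ^ 2 - 1) / (24 * Real.pi) * (((a 1) ^ 3 - (a 0) ^ 3) / 3 : ℝ))
      =O[𝓝 0] fun a => ‖a‖ ^ 4 := by
  have hpi : (Real.pi : ℂ) ≠ 0 := by exact_mod_cast Real.pi_ne_zero
  set b : ℕ → ℂ := fun m => Complex.I * (m - (N - 1) / 2) / (Real.sqrt (2 * Real.pi) : ℂ) with hb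
  have hneg : Tendsto (fun x : ℝ => -x) (𝓝 0) (𝓝 0) := by
    simpa using continuous_neg.tendsto (0 : ℝ)
  -- The conjugate factor is evaluated at -x, so its linear coefficient is -b m; the product is a
  -- nonnegative real number.
  have h1 : ∀ m : Fin N, (fun a : Fin 2 → ℝ => gram (baseE N) (baseF N) a m m -
      -b m * b m * (((a 1) ^ 3 - (a 0) ^ 3) / 3 : ℝ)) =O[𝓝 0] fun a => ‖a‖ ^ 4 := by
    intro m
    refine isBigO_integral_sub_cube ((continuous_baseF N m).mul (continuous_baseE N m))
      (isBigO_mul_sub ?_ (isBigO_cwave_sub_linear hN m))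
    refine (((isBigO_cwave_sub_linear hN m).comp_tendsto hneg).congr_left fun x => ?_).congr_right
      fun x => by simp
    simp only [Function.comp_apply, baseF, hb]
    push_cast; ring
  refine (IsBigO.fun_sum (s := Finset.univ) fun m _ => h1 m).congr_left fun a => ?_
  have hbm : ∀ m : ℕ, -b m * b m = ((m : ℂ) - (N - 1) / 2) ^ 2 / (2 * Real.pi) := by
    intro m
    rw [neg_mul, hb, div_mul_div_comm, sqrt_two_pi_sq, ← neg_div]
    congr 1
    linear_combination (-((m : ℂ) - (N - 1) / 2) ^ 2) * Complex.I_mul_I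
  rw [Finset.sum_sub_distrib, ← Finset.sum_mul, Matrix.trace]
  congr 2
  rw [Fin.sum_univ_eq_sum_range (fun m => -b m * b m) N, Finset.sum_congr rfl fun m _ => hbm m,
    ← Finset.sum_div, (sum_range_sub_pow N (((N : ℂ) - 1) / 2)).2.1]
  field_simp
  ring

/-- Since G = O(‖a‖³), det(1 - G) = 1 - tr G + O(‖a‖⁶), and log adds only a further O(‖a‖⁶). -/
theorem isBigO_log_det :
    (fun a : Fin 2 → ℝ => Complex.log (1 - gram (baseE N) (baseF N) a).det +
      (N : ℂ) * ((N : ℂ) ^ 2 - 1) / (24 * Real.pi) * (((a 1) ^ 3 - (a 0) ^ 3) / 3 : ℝ))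
      =O[𝓝 0] fun a => ‖a‖ ^ 4 := by
  have hle : (fun a : Fin 2 → ℝ => ‖a‖ ^ 6) =O[𝓝 0] fun a => ‖a‖ ^ 4 :=
    isBigO_pow_of_le tendsto_norm_zero_endpoints (by norm_num)
  have h3 : Tendsto (fun a : Fin 2 → ℝ => ‖a‖ ^ 3) (𝓝 0) (𝓝 0) := by
    simpa using tendsto_norm_zero_endpoints.pow 3
  have hX : ∀ i j, (fun a => (-gram (baseE N) (baseF N) a) i j) =O[𝓝 0] fun a => ‖a‖ ^ 3 :=
    fun i j => (isBigO_integral_mul hN (isBigO_baseF hN i) (isBigO_baseE hN j)).neg_left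
  have hdet := isBigO_det_one_add hX (h3.isBigO_one ℝ)
  have htr : (fun a => (-gram (baseE N) (baseF N) a).trace) =O[𝓝 0] fun a => ‖a‖ ^ 3 :=
    IsBigO.fun_sum fun i _ => hX i i
  have hdet' : (fun a => (1 - gram (baseE N) (baseF N) a).det - 1 +
      (gram (baseE N) (baseF N) a).trace) =O[𝓝 0] fun a => ‖a‖ ^ 6 := by
    refine (hdet.congr_left fun a => ?_).congr_right fun a => by ring
    rw [Matrix.trace_neg, ← sub_eq_add_neg]; ring
  have hz : (fun a => (1 - gram (baseE N) (baseF N) a).det - 1) =O[𝓝 0] fun a => ‖a‖ ^ 3 := by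
    refine ((hdet'.trans (isBigO_pow_of_le tendsto_norm_zero_endpoints
      (show 3 ≤ 6 by norm_num))).add htr).congr_left fun a => ?_
    rw [Matrix.trace_neg]; ring
  have hz0 : Tendsto (fun a => (1 - gram (baseE N) (baseF N) a).det - 1) (𝓝 0) (𝓝 0) :=
    hz.trans_tendsto h3
  have hlog := (Complex.log_sub_self_isBigO.comp_tendsto hz0).trans
    (((hz.pow 2).congr_right fun a => by ring : _ =O[𝓝 0] fun a : Fin 2 → ℝ => ‖a‖ ^ 6))
  refine (((hlog.trans hle).add (hdet'.trans hle)).sub (isBigO_trace_gram hN)).congr_left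
    fun a => ?_
  simp only [Function.comp_apply, add_sub_cancel]
  ring

end SmallIntervals

/-! ### The constructed functions solve the system -/

theorem IsOrderFour.of_isBigO {f g : (Fin 2 → ℝ) → ℂ} (hg : g =O[𝓝 0] fun a => ‖a‖ ^ 4)
    (h : ∀ a ∈ endpoints, f a = g a) : IsOrderFour f :=
  (hg.mono nhdsWithin_le_nhds).congr' (eventually_nhdsWithin_of_forall fun a ha => (h a ha).symm)
    EventuallyEq.rfl

theorem pderiv_qVar_self {N : ℕ} (hN : 1 ≤ N) {a : Fin 2 → ℝ} (ha : a ∈ endpoints) (j : Fin 2) :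
    pderiv j (qVar N j) a =
      dresWave N N a (a j) + sgn j * resKernel N a (a j) (a j) * resWave N N a (a j) :=
  pderiv_eq_of_hasDerivAt (g := fun a => resWave N N a (a j)) ha (fun _ hb => qVar_eq hN hb j)
    (hasDerivAt_resWave_self hN (det_ne_zero hN ha) N j)

theorem pderiv_pVar_self {N : ℕ} (hN : 1 ≤ N) {a : Fin 2 → ℝ} (ha : a ∈ endpoints) (j : Fin 2) :
    pderiv j (pVar N j) a =
      dresWave N 0 a (a j) + sgn j * resKernel N a (a j) (a j) * resWave N 0 a (a j) :=
  pderiv_eq_of_hasDerivAt (g := fun a => resWave N 0 a (a j)) ha (fun _ hb => pVar_eq hN hb j)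
    (hasDerivAt_resWave_self hN (det_ne_zero hN ha) 0 j)

/-- The quantities built from the conditioned kernel solve the Tracy–Widom system. -/
theorem isTWSolution_vars {N : ℕ} (hN : 1 ≤ N) :
    IsTWSolution N (qVar N) (pVar N) (uVar N) (wVar N) (vVar N) (RVar N) (logJanossy N) where
  diff_q j a ha := ((differentiableAt_resWave hN (det_ne_zero hN ha) N j).differentiableWithinAt
    (s := endpoints)).congr (fun b hb => qVar_eq hN hb j) (qVar_eq hN ha j)
  diff_p j a ha := ((differentiableAt_resWave hN (det_ne_zero hN ha) 0 j).differentiableWithinAt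
    (s := endpoints)).congr (fun b hb => pVar_eq hN hb j) (pVar_eq hN ha j)
  diff_u a ha := ((differentiableAt_pairing hN (det_ne_zero hN ha) N N).differentiableWithinAt
    (s := endpoints)).congr (fun b hb => uVar_eq hN hb) (uVar_eq hN ha)
  diff_w a ha := ((differentiableAt_pairing hN (det_ne_zero hN ha) 0 0).differentiableWithinAt
    (s := endpoints)).congr (fun b hb => wVar_eq hN hb) (wVar_eq hN ha)
  diff_v a ha := ((differentiableAt_pairing hN (det_ne_zero hN ha) 0 N).differentiableWithinAt
    (s := endpoints)).congr (fun b hb => vVar_eq hN hb) (vVar_eq hN ha)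
  diff_L a ha := by
    have h1 : DifferentiableAt ℝ (fun a => (1 - gram (baseE N) (baseF N) a).det) a :=
      differentiableAt_det fun i j =>
        differentiable_one_sub_gram (continuous_baseE N) (continuous_baseF N) i j a
    have h2 := ((Complex.differentiableAt_log (det_mem_slitPlane hN ha)).restrictScalars ℝ).comp a h1
    exact (h2.differentiableWithinAt (s := endpoints)).congr
      (fun b hb => logJanossy_eq hN hb) (logJanossy_eq hN ha)
  R_off a ha j k hjk := by
    rw [qVar_eq hN ha, qVar_eq hN ha, pVar_eq hN ha, pVar_eq hN ha, RVar_eq hN ha,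
      eq_div_iff (ex_sub_ex_ne_zero ha hjk), mul_comm]
    exact resKernel_commutator hN (det_ne_zero hN ha) (a j) (a k)
  R_diag a ha j := by
    rw [pderiv_qVar_self hN ha, pderiv_pVar_self hN ha, qVar_eq hN ha, pVar_eq hN ha,
      RVar_eq hN ha]
    -- The terms ±R_{jj} q_j and ±R_{jj} p_j of the two derivatives cancel in p ∂q - q ∂p, leaving
    -- the spatial derivatives of `resKernel_diag`.
    have h := resKernel_diag hN (det_ne_zero hN ha) (a j)
    have e : Complex.exp (-(Complex.I * (a j : ℂ))) * Complex.exp (Complex.I * (a j : ℂ)) = 1 := by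
      rw [← Complex.exp_add]; simp
    linear_combination (-Complex.I * Complex.exp (-(Complex.I * (a j : ℂ)))) * h +
      (-resKernel N a (a j) (a j)) * e + (resKernel N a (a j) (a j) *
        Complex.exp (-(Complex.I * (a j : ℂ))) * Complex.exp (Complex.I * (a j : ℂ))) *
        Complex.I_mul_I
  q_self a ha j k hjk := by
    rw [pderiv_qVar_self hN ha, qVar_eq hN ha, qVar_eq hN ha, pVar_eq hN ha, RVar_eq hN ha,
      uVar_eq hN ha, vVar_eq hN ha]
    exact resWave_q_self hN (det_ne_zero hN ha) j k hjk
  p_self a ha j k hjk := by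
    rw [pderiv_pVar_self hN ha, pVar_eq hN ha, pVar_eq hN ha, qVar_eq hN ha, RVar_eq hN ha,
      wVar_eq hN ha, vVar_eq hN ha]
    exact resWave_p_self hN (det_ne_zero hN ha) j k hjk
  q_other a ha j k hjk := by
    rw [qVar_eq hN ha, RVar_eq hN ha]
    exact pderiv_eq_of_hasDerivAt (g := fun a => resWave N N a (a j)) ha
      (fun _ hb => qVar_eq hN hb j) (hasDerivAt_resWave_other hN (det_ne_zero hN ha) N hjk)
  p_other a ha j k hjk := by
    rw [pVar_eq hN ha, RVar_eq hN ha]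
    exact pderiv_eq_of_hasDerivAt (g := fun a => resWave N 0 a (a j)) ha
      (fun _ hb => pVar_eq hN hb j) (hasDerivAt_resWave_other hN (det_ne_zero hN ha) 0 hjk)
  u_eq a ha j := by
    rw [qVar_eq hN ha, sq]
    exact pderiv_eq_of_hasDerivAt ha (fun _ hb => uVar_eq hN hb)
      (hasDerivAt_pairing hN (det_ne_zero hN ha) N N j)
  w_eq a ha j := by
    rw [pVar_eq hN ha, sq]
    exact pderiv_eq_of_hasDerivAt ha (fun _ hb => wVar_eq hN hb)
      (hasDerivAt_pairing hN (det_ne_zero hN ha) 0 0 j)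
  v_eq a ha j := by
    rw [qVar_eq hN ha, pVar_eq hN ha, mul_comm (resWave N N a _)]
    exact pderiv_eq_of_hasDerivAt ha (fun _ hb => vVar_eq hN hb)
      (hasDerivAt_pairing hN (det_ne_zero hN ha) 0 N j)
  L_eq a ha j := by
    rw [RVar_eq hN ha]
    exact pderiv_eq_of_hasDerivAt (g := fun a => Complex.log (1 - gram (baseE N) (baseF N) a).det)
      ha (fun _ hb => logJanossy_eq hN hb) (hasDerivAt_log_det hN ha j)
  bc_q j := IsOrderFour.of_isBigO (isBigO_resWave_taylor hN N j) fun a ha => by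
    have hs := sqrt_two_pi_ne_zero
    rw [qVar_eq hN ha]
    push_cast
    congr 1
    field_simp
    ring
  bc_p j := IsOrderFour.of_isBigO (isBigO_resWave_taylor hN 0 j) fun a ha => by
    have hs := sqrt_two_pi_ne_zero
    rw [pVar_eq hN ha]
    push_cast
    congr 1
    field_simp
    ring
  bc_u := IsOrderFour.of_isBigO (isBigO_pairing_cube hN N N) fun a ha => by
    have hpi : (Real.pi : ℂ) ≠ 0 := by exact_mod_cast Real.pi_ne_zero
    rw [uVar_eq hN ha]
    push_cast
    field_simp
    ring
  bc_w := IsOrderFour.of_isBigO (isBigO_pairing_cube hN 0 0) fun a ha => by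
    have hpi : (Real.pi : ℂ) ≠ 0 := by exact_mod_cast Real.pi_ne_zero
    rw [wVar_eq hN ha]
    push_cast
    field_simp
    ring
  bc_v := IsOrderFour.of_isBigO (isBigO_pairing_cube hN 0 N) fun a ha => by
    have hpi : (Real.pi : ℂ) ≠ 0 := by exact_mod_cast Real.pi_ne_zero
    rw [vVar_eq hN ha]
    push_cast
    field_simp
    ring
  bc_L := IsOrderFour.of_isBigO (isBigO_log_det hN) fun a ha => by
    have hpi : (Real.pi : ℂ) ≠ 0 := by exact_mod_cast Real.pi_ne_zero
    rw [logJanossy_eq hN ha]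
    push_cast
    field_simp
    ring

/-! ### Uniqueness at a regular singular point -/

section SingularODE

/-- Uniqueness at the regular singular point of `t f' = A f` with `‖A‖ ≤ 3 + C t`, among the
functions that vanish to fourth order. -/
theorem eq_zero_of_singular_ode {X : Type*} [NormedAddCommGroup X] [NormedSpace ℝ X] {f f' : ℝ → X}
    {C D : ℝ} (hd : ∀ t ∈ Set.Ioc (0 : ℝ) 1, HasDerivAt f (f' t) t)
    (hb : ∀ t ∈ Set.Ioc (0 : ℝ) 1, t * ‖f' t‖ ≤ (3 + C * t) * ‖f t‖)
    (h4 : ∀ t ∈ Set.Ioc (0 : ℝ) 1, ‖f t‖ ≤ D * t ^ 4) : f 1 = 0 := by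
  have hD : 0 ≤ D := by simpa using (norm_nonneg _).trans (h4 1 (by simp))
  -- Comparison on [s, 1] with B(t) = (D+1) s t³ e^{(C+1)(t-s)}. It dominates ‖f‖ at t = s because
  -- ‖f(s)‖ ≤ D s⁴, and satisfies t B' = (3 + (C+1)t) B, strictly above the growth allowed to ‖f‖.
  -- The spare factor s, the excess of order four over exponent three, sends the bound at t = 1 to
  -- 0.
  have key : ∀ s ∈ Set.Ioo (0 : ℝ) 1, ‖f 1‖ ≤ (D + 1) * s * Real.exp ((C + 1) * (1 - s)) := by
    intro s hs
    have hsub : ∀ t ∈ Set.Icc s 1, t ∈ Set.Ioc (0 : ℝ) 1 := fun t ht => ⟨hs.1.trans_le ht.1, ht.2⟩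
    have hB : ∀ t : ℝ, HasDerivAt
        (fun t : ℝ => (D + 1) * s * t ^ 3 * Real.exp ((C + 1) * (t - s)))
        ((D + 1) * s * (3 * t ^ 2) * Real.exp ((C + 1) * (t - s)) +
          (D + 1) * s * t ^ 3 * (Real.exp ((C + 1) * (t - s)) * (C + 1))) t := by
      intro t
      have h1 := (hasDerivAt_pow 3 t).const_mul ((D + 1) * s)
      have h2 := (((hasDerivAt_id t).sub_const s).const_mul (C + 1)).exp
      have h3 := h1.mul h2
      refine h3.congr_deriv ?_
      simp
    have h := image_norm_le_of_norm_deriv_right_lt_deriv_boundary (f := f) (f' := f') (a := s)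
      (b := 1) (fun t ht => (hd t (hsub t ht)).continuousAt.continuousWithinAt)
      (fun t ht => (hd t (hsub t ⟨ht.1, ht.2.le⟩)).hasDerivWithinAt)
      (B := fun t : ℝ => (D + 1) * s * t ^ 3 * Real.exp ((C + 1) * (t - s)))
      (by
        have h5 := h4 s (hsub s ⟨le_rfl, hs.2.le⟩)
        simp only [sub_self, mul_zero, Real.exp_zero, mul_one]
        have : 0 ≤ s ^ 4 := by have := hs.1; positivity
        nlinarith) hB (by
        intro t ht hft
        have ht' := hsub t ⟨ht.1, ht.2.le⟩
        have h6 := hb t ht'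
        have ht0 := ht'.1
        rw [hft] at h6
        have hs0 := hs.1
        have hpos : 0 < (D + 1) * s * t ^ 3 * Real.exp ((C + 1) * (t - s)) := by positivity
        refine lt_of_mul_lt_mul_left (a := t) ?_ ht0.le
        refine h6.trans_lt ?_
        have : t * ((D + 1) * s * (3 * t ^ 2) * Real.exp ((C + 1) * (t - s)) +
          (D + 1) * s * t ^ 3 * (Real.exp ((C + 1) * (t - s)) * (C + 1))) =
          (3 + C * t + t) * ((D + 1) * s * t ^ 3 * Real.exp ((C + 1) * (t - s))) := by ring
        rw [this]
        exact mul_lt_mul_of_pos_right (by linarith) hpos)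
    have h7 := h (Set.right_mem_Icc.mpr hs.2.le)
    simpa using h7
  have hlim : Tendsto (fun s : ℝ => (D + 1) * s * Real.exp ((C + 1) * (1 - s))) (𝓝[>] 0) (𝓝 0) := by
    have hc : Continuous fun s : ℝ => (D + 1) * s * Real.exp ((C + 1) * (1 - s)) := by fun_prop
    have := hc.tendsto 0
    simp only [mul_zero, zero_mul] at this
    exact this.mono_left nhdsWithin_le_nhds
  have hle : ‖f 1‖ ≤ 0 := ge_of_tendsto hlim (by
    filter_upwards [Ioo_mem_nhdsGT (zero_lt_one' ℝ)] with s hs using key s hs)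
  exact norm_le_zero_iff.mp hle

/-- Near 0 the asymptotic bound applies; on the remaining compact interval f is bounded and t^k is
bounded below. -/
theorem exists_bound_Ioc {f : ℝ → ℂ} {k : ℕ} (hc : ContinuousOn f (Set.Ioc 0 1))
    (hO : f =O[𝓝[>] 0] fun t : ℝ => t ^ k) :
    ∃ M : ℝ, 0 ≤ M ∧ ∀ t ∈ Set.Ioc (0 : ℝ) 1, ‖f t‖ ≤ M * t ^ k := by
  obtain ⟨C, hC⟩ := hO.bound
  obtain ⟨s, hs, hsC⟩ := (mem_nhdsGT_iff_exists_Ioo_subset).mp hC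
  have hs0 : (0 : ℝ) < s := hs
  set r := min (s / 2) 1 with hr
  have hr0 : 0 < r := by positivity
  have hrs : r < s := (min_le_left _ _).trans_lt (by linarith)
  have hr1 : r ≤ 1 := min_le_right _ _
  obtain ⟨B, hB⟩ := isCompact_Icc.exists_bound_of_continuousOn
    (hc.mono fun t (ht : t ∈ Set.Icc r 1) => ⟨hr0.trans_le ht.1, ht.2⟩)
  refine ⟨max C 0 + max B 0 / r ^ k, by positivity, fun t ht => ?_⟩
  have htk : 0 ≤ t ^ k := by have := ht.1; positivity
  rcases lt_or_ge t r with h | h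
  · have h1 : ‖f t‖ ≤ C * ‖t ^ k‖ := hsC ⟨ht.1, h.trans hrs⟩
    rw [Real.norm_of_nonneg htk] at h1
    refine h1.trans (mul_le_mul_of_nonneg_right ?_ htk)
    have : 0 ≤ max B 0 / r ^ k := by positivity
    linarith [le_max_left C 0]
  · have h1 := hB t ⟨h, ht.2⟩
    have h2 : 1 ≤ t ^ k / r ^ k := by
      rw [le_div_iff₀ (by positivity), one_mul]
      exact pow_le_pow_left₀ hr0.le h k
    have h3 : max B 0 ≤ max B 0 / r ^ k * t ^ k := by
      rw [div_mul_eq_mul_div, mul_div_assoc]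
      exact le_mul_of_one_le_right (le_max_right _ _) h2
    have h4 : 0 ≤ max C 0 * t ^ k := mul_nonneg (le_max_right _ _) htk
    rw [add_mul]
    linarith [le_max_left B 0]

theorem isBigO_div_of_hasDerivAt {g : ℝ → ℂ} {c : ℂ} (hg : HasDerivAt g c 0) (hc : c ≠ 0)
    (h0 : g 0 = 0) : (fun t : ℝ => (t : ℂ) / g t) =O[𝓝 0] fun _ => (1 : ℝ) := by
  have h1 : (fun t : ℝ => g t - t * c) =o[𝓝 0] fun t : ℝ => t := by
    have := hg.isLittleO
    simpa [h0] using this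
  have h2 : (fun t : ℝ => g t - t * c) =o[𝓝 0] fun t : ℝ => (t : ℂ) * c :=
    h1.trans_isBigO (IsBigO.of_bound ‖c‖⁻¹ (Eventually.of_forall fun t => by
      rw [norm_mul, Complex.norm_real, mul_comm ‖t‖, ← mul_assoc,
        inv_mul_cancel₀ (norm_ne_zero_iff.mpr hc), one_mul]))
  have h3 : (fun t : ℝ => (t : ℂ) * c) =O[𝓝 0] g := by
    have := h2.right_isBigO_add
    simpa using this
  obtain ⟨C, hC⟩ := h3.bound
  refine IsBigO.of_bound (max C 0 / ‖c‖) ?_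
  filter_upwards [hC] with t ht
  have hc' : 0 < ‖c‖ := norm_pos_iff.mpr hc
  rw [norm_mul] at ht
  rw [norm_div, norm_one, mul_one]
  -- Where g vanishes the quotient is 0 by the convention for division by zero.
  rcases eq_or_ne (g t) 0 with hz | hz
  · rw [hz, norm_zero, div_zero]; positivity
  · rw [div_le_div_iff₀ (norm_pos_iff.mpr hz) hc']
    exact ht.trans (mul_le_mul_of_nonneg_right (le_max_left _ _) (norm_nonneg _))

end SingularODE

/-! ### Restriction to rays through the origin -/

section Ray

theorem smul_mem_endpoints {a : Fin 2 → ℝ} (ha : a ∈ endpoints) {t : ℝ}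
    (ht : t ∈ Set.Ioc (0 : ℝ) 1) : t • a ∈ endpoints := by
  obtain ⟨h0, h1, h2⟩ := ha
  refine ⟨mul_neg_of_pos_of_neg ht.1 h0, mul_pos ht.1 h1, ?_⟩
  simp only [Pi.smul_apply, smul_eq_mul]
  have := ht.1
  have := ht.2
  nlinarith

theorem hasDerivAt_ray {f : (Fin 2 → ℝ) → ℂ} (hf : DifferentiableOn ℝ f endpoints)
    {a : Fin 2 → ℝ} (ha : a ∈ endpoints) {t : ℝ} (ht : t ∈ Set.Ioc (0 : ℝ) 1) :
    HasDerivAt (fun t : ℝ => f (t • a))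
      ((a 0 : ℂ) * pderiv 0 f (t • a) + (a 1 : ℂ) * pderiv 1 f (t • a)) t := by
  have hmem := smul_mem_endpoints ha ht
  have hd : DifferentiableAt ℝ f (t • a) := hf.differentiableAt (isOpen_endpoints.mem_nhds hmem)
  have h1 : HasDerivAt (fun t : ℝ => t • a) a t := by
    simpa using (hasDerivAt_id t).smul_const a
  refine (hd.hasFDerivAt.comp_hasDerivAt t h1).congr_deriv ?_
  rw [pderiv_eq_fderiv hd, pderiv_eq_fderiv hd]
  have h2 : a = a 0 • Pi.single (0 : Fin 2) (1 : ℝ) + a 1 • Pi.single (1 : Fin 2) (1 : ℝ) := by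
    ext j; fin_cases j <;> simp
  generalize fderiv ℝ f (t • a) = φ
  conv_lhs => rw [h2, map_add, map_smul, map_smul]
  simp

theorem tendsto_ray {a : Fin 2 → ℝ} (ha : a ∈ endpoints) :
    Tendsto (fun t : ℝ => t • a) (𝓝[>] 0) (𝓝[endpoints] 0) := by
  refine tendsto_nhdsWithin_iff.mpr ⟨?_, ?_⟩
  · have hc : Continuous fun t : ℝ => t • a := by fun_prop
    have := hc.tendsto 0
    rw [zero_smul] at this
    exact this.mono_left nhdsWithin_le_nhds
  · filter_upwards [Ioc_mem_nhdsGT (zero_lt_one' ℝ)] with t ht using smul_mem_endpoints ha ht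

theorem IsOrderFour.ray {f : (Fin 2 → ℝ) → ℂ} (hf : IsOrderFour f) {a : Fin 2 → ℝ}
    (ha : a ∈ endpoints) : (fun t : ℝ => f (t • a)) =O[𝓝[>] 0] fun t : ℝ => t ^ 4 := by
  refine (hf.comp_tendsto (tendsto_ray ha)).trans
    (IsBigO.of_bound (‖a‖ ^ 4) (Eventually.of_forall fun t => ?_))
  simp only [Function.comp_apply, norm_pow, norm_norm, norm_smul, norm_mul, mul_pow]
  rw [mul_comm]

theorem IsOrderFour.exists_bound_ray {f : (Fin 2 → ℝ) → ℂ} (hf : IsOrderFour f)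
    (hd : DifferentiableOn ℝ f endpoints) {a : Fin 2 → ℝ} (ha : a ∈ endpoints) :
    ∃ M : ℝ, 0 ≤ M ∧ ∀ t ∈ Set.Ioc (0 : ℝ) 1, ‖f (t • a)‖ ≤ M * t ^ 4 :=
  exists_bound_Ioc (f := fun t => f (t • a)) (fun _ ht =>
    (hasDerivAt_ray hd ha ht).continuousAt.continuousWithinAt) (hf.ray ha)

/-- Only linear smallness of the expansions is needed to control the nonlinear terms; full fourth
order is used only for differences of solutions. -/
theorem IsOrderFour.exists_bound_ray_linear {f g : (Fin 2 → ℝ) → ℂ}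
    (hf : IsOrderFour fun a => f a - g a)
    (hd : DifferentiableOn ℝ f endpoints) {a : Fin 2 → ℝ} (ha : a ∈ endpoints) {c₁ c₂ c₃ : ℂ}
    (hg : ∀ t : ℝ, g (t • a) = c₁ * (t : ℂ) ^ 1 + c₂ * (t : ℂ) ^ 2 + c₃ * (t : ℂ) ^ 3) :
    ∃ M : ℝ, 0 ≤ M ∧ ∀ t ∈ Set.Ioc (0 : ℝ) 1, ‖f (t • a)‖ ≤ M * t := by
  have h1 : (fun t : ℝ => f (t • a) - g (t • a)) =O[𝓝[>] 0] fun t : ℝ => t ^ 1 :=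
    (hf.ray ha).trans ((isBigO_pow_of_le tendsto_id (show 1 ≤ 4 by norm_num)).mono
      nhdsWithin_le_nhds)
  have h2 : (fun t : ℝ => g (t • a)) =O[𝓝[>] 0] fun t : ℝ => t ^ 1 := by
    simp only [hg]
    exact (((isBigO_pow_pow_zero le_rfl c₁).add (isBigO_pow_pow_zero (by norm_num) c₂)).add
      (isBigO_pow_pow_zero (by norm_num) c₃)).mono nhdsWithin_le_nhds
  have h3 := exists_bound_Ioc (f := fun t => f (t • a)) (k := 1) (fun _ ht =>
    (hasDerivAt_ray hd ha ht).continuousAt.continuousWithinAt)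
    ((h1.add h2).congr_left fun t => by ring)
  simpa using h3

end Ray

/-! ### Coefficients of the system along a ray -/

section Geometry

/-- The factor `t a_j / (i (1 - e^{i t a_j}))`, which tends to `1` as `t → 0`. -/
noncomputable def rayFactor (a : Fin 2 → ℝ) (j : Fin 2) (t : ℝ) : ℂ :=
  t * a j / (Complex.I * (1 - ex (t • a) j))

/-- The coefficient of `(q_j p_k - p_j q_k) q_k` in the equation of `q_j` along a ray. -/
noncomputable def rayCoupling (a : Fin 2 → ℝ) (j k : Fin 2) (t : ℝ) : ℂ :=
  sgn k * (t * a k - rayFactor a j t * (Complex.I * (1 - ex (t • a) k))) /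
    (ex (t • a) j - ex (t • a) k)

/-- Phrasing bounds as valid for all large M lets finitely many of them share one constant. -/
theorem exists_bound_eventually {f : ℝ → ℝ}
    (h : ∃ M : ℝ, 0 ≤ M ∧ ∀ t ∈ Set.Ioc (0 : ℝ) 1, f t ≤ M * t) :
    ∀ᶠ M : ℝ in atTop, ∀ t ∈ Set.Ioc (0 : ℝ) 1, f t ≤ M * t := by
  obtain ⟨M, -, hM⟩ := h
  filter_upwards [eventually_ge_atTop M] with M' hM' t ht
  exact (hM t ht).trans (mul_le_mul_of_nonneg_right hM' ht.1.le)

theorem hasDerivAt_ex_ray (a : Fin 2 → ℝ) (j : Fin 2) (t : ℝ) :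
    HasDerivAt (fun t : ℝ => ex (t • a) j) (Complex.I * a j * ex (t • a) j) t := by
  have h1 : HasDerivAt (fun t : ℝ => ((t * a j : ℝ) : ℂ)) ((1 * a j : ℝ) : ℂ) t :=
    ((hasDerivAt_id t).mul_const (a j)).ofReal_comp
  have h2 := (h1.const_mul Complex.I).cexp
  refine h2.congr_deriv ?_
  simp [ex]
  ring

theorem continuous_ex_ray (a : Fin 2 → ℝ) (j : Fin 2) : Continuous fun t : ℝ => ex (t • a) j :=
  continuous_iff_continuousAt.mpr fun t => (hasDerivAt_ex_ray a j t).continuousAt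

theorem ex_zero_ray (a : Fin 2 → ℝ) (j : Fin 2) : ex ((0 : ℝ) • a) j = 1 := by simp [ex]

variable {a : Fin 2 → ℝ} (ha : a ∈ endpoints)
include ha

theorem apply_ne_zero_of_mem_endpoints (j : Fin 2) : a j ≠ 0 := by
  fin_cases j
  · exact ha.1.ne
  · exact ha.2.1.ne'

theorem apply_ne_apply_of_mem_endpoints {j k : Fin 2} (hjk : j ≠ k) : a j ≠ a k := by
  have h := ha.1.trans ha.2.1
  fin_cases j <;> fin_cases k <;> first | exact absurd rfl hjk | exact h.ne | exact h.ne'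

theorem continuousOn_rayFactor (j : Fin 2) : ContinuousOn (rayFactor a j) (Set.Ioc 0 1) := by
  have hc := (continuous_ex_ray a j).continuousOn (s := Set.Ioc 0 1)
  refine ContinuousOn.div (by fun_prop) (by fun_prop) fun t ht => ?_
  exact mul_ne_zero Complex.I_ne_zero (ex_ne_one (smul_mem_endpoints ha ht) j)

theorem isBigO_div_ex (j : Fin 2) :
    (fun t : ℝ => (t : ℂ) / (Complex.I * (1 - ex (t • a) j))) =O[𝓝 0] fun _ => (1 : ℝ) := by
  have h := ((hasDerivAt_ex_ray a j 0).const_sub 1).const_mul Complex.I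
  rw [ex_zero_ray] at h
  refine isBigO_div_of_hasDerivAt h ?_ (by rw [ex_zero_ray]; simp)
  have := apply_ne_zero_of_mem_endpoints ha j
  simp [this]

theorem isBigO_rayFactor_sub_one (j : Fin 2) :
    (fun t : ℝ => rayFactor a j t - 1) =O[𝓝[>] 0] fun t : ℝ => t ^ 1 := by
  have h1 := ((isBigO_cexp_sub (a j)).trans
    (isBigO_pow_of_le tendsto_id (show 2 ≤ 4 by norm_num))).const_mul_left Complex.I
  have h2 := isBigO_pow_pow_zero le_rfl (-(Complex.I * (a j : ℂ) ^ 2 / 2) : ℂ) (m := 2)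
  have h3 := isBigO_pow_pow_zero (show 2 ≤ 3 by norm_num) ((a j : ℂ) ^ 3 / 6)
  have h4 : (fun t : ℝ => t * a j - Complex.I * (1 - ex (t • a) j)) =O[𝓝 0]
      fun t : ℝ => t ^ 2 := by
    refine ((h1.add h2).add h3).congr_left fun t => ?_
    have : Complex.I * (a j : ℂ) * t = Complex.I * ((t * a j : ℝ) : ℂ) := by push_cast; ring
    simp only [ex, Pi.smul_apply, smul_eq_mul, this]
    push_cast
    linear_combination ((a j : ℂ) ^ 3 * t ^ 3 / 6 - a j * t : ℂ) * Complex.I_sq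
  have h5 : (fun t : ℝ => ((t⁻¹ : ℝ) : ℂ)) =O[𝓝 0] fun t : ℝ => t⁻¹ :=
    IsBigO.of_bound 1 (Eventually.of_forall fun t => by simp)
  have h6 := ((h4.mul h5).mul (isBigO_div_ex ha j)).mono (nhdsWithin_le_nhds (s := Set.Ioi 0))
  refine h6.congr' ?_ ?_
  · filter_upwards [Ioc_mem_nhdsGT (zero_lt_one' ℝ)] with t ht
    have ht0 : (t : ℂ) ≠ 0 := by exact_mod_cast ht.1.ne'
    have hI := Complex.I_ne_zero
    have := ex_ne_one (smul_mem_endpoints ha ht) j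
    simp only [rayFactor]
    push_cast
    field_simp
  · filter_upwards [self_mem_nhdsWithin] with t ht
    have ht0 : t ≠ 0 := (show 0 < t from ht).ne'
    field_simp

theorem eventually_rayFactor_le (j : Fin 2) : ∀ᶠ M : ℝ in atTop, ∀ t ∈ Set.Ioc (0 : ℝ) 1,
    ‖rayFactor a j t - 1‖ ≤ M * t := by
  refine exists_bound_eventually ?_
  simpa using exists_bound_Ioc ((continuousOn_rayFactor ha j).sub continuousOn_const)
    (isBigO_rayFactor_sub_one ha j)

/-- The numerator is bounded and the denominator has a simple zero at t = 0 because a_j ≠ a_k. A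
simple pole is harmless, since the coupling multiplies a cubic expression in O(t) quantities. -/
theorem eventually_rayCoupling_le {j k : Fin 2} (hjk : j ≠ k) :
    ∀ᶠ M : ℝ in atTop, ∀ t ∈ Set.Ioc (0 : ℝ) 1, t * ‖rayCoupling a j k t‖ ≤ M := by
  have hcj := continuous_ex_ray a j
  have hck := continuous_ex_ray a k
  have h1 : (fun t : ℝ => (t : ℂ) / (ex (t • a) j - ex (t • a) k)) =O[𝓝[>] 0]
      fun _ => (1 : ℝ) := by
    have h := (hasDerivAt_ex_ray a j 0).sub (hasDerivAt_ex_ray a k 0)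
    rw [ex_zero_ray, ex_zero_ray] at h
    refine (isBigO_div_of_hasDerivAt h ?_ 
      (show ex ((0 : ℝ) • a) j - ex ((0 : ℝ) • a) k = 0 by
        rw [ex_zero_ray, ex_zero_ray, sub_self])).mono nhdsWithin_le_nhds
    have := apply_ne_apply_of_mem_endpoints ha hjk
    rw [mul_one, mul_one, ← mul_sub]
    exact mul_ne_zero Complex.I_ne_zero (sub_ne_zero.mpr (by exact_mod_cast this))
  have h2 : rayFactor a j =O[𝓝[>] 0] fun _ => (1 : ℝ) := by
    have h := ((isBigO_div_ex ha j).const_mul_left (a j : ℂ)).mono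
      (nhdsWithin_le_nhds (s := Set.Ioi 0))
    refine h.congr_left fun t => ?_
    rw [rayFactor]; ring
  have h3 : (fun t : ℝ => Complex.I * (1 - ex (t • a) k)) =O[𝓝[>] 0] fun _ => (1 : ℝ) := by
    have hc : Continuous fun t : ℝ => Complex.I * (1 - ex (t • a) k) := by fun_prop
    exact ((hc.tendsto 0).isBigO_one ℝ).mono nhdsWithin_le_nhds
  have h4 : (fun t : ℝ => (t * a k : ℂ)) =O[𝓝[>] 0] fun _ => (1 : ℝ) := by
    have hc : Continuous fun t : ℝ => (t * a k : ℂ) := by fun_prop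
    exact ((hc.tendsto 0).isBigO_one ℝ).mono nhdsWithin_le_nhds
  have h5 : (fun t : ℝ => sgn k * (t * a k - rayFactor a j t * (Complex.I * (1 - ex (t • a) k))))
      =O[𝓝[>] 0] fun _ => (1 : ℝ) :=
    (h4.sub ((h2.mul h3).congr_right fun _ => mul_one 1)).const_mul_left (sgn k)
  have h6 : (fun t : ℝ => (t : ℂ) * rayCoupling a j k t) =O[𝓝[>] 0] fun t : ℝ => t ^ 0 := by
    refine (h5.mul h1).congr (fun t => ?_) fun t => by simp
    rw [rayCoupling]; ring
  have hf := continuousOn_rayFactor ha j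
  have hoj := hcj.continuousOn (s := Set.Ioc 0 1)
  have hok := hck.continuousOn (s := Set.Ioc 0 1)
  obtain ⟨M, -, hM⟩ := exists_bound_Ioc (f := fun t : ℝ => (t : ℂ) * rayCoupling a j k t) (k := 0)
    (by
      refine ContinuousOn.mul (by fun_prop) (ContinuousOn.div (by fun_prop) (by fun_prop) ?_)
      exact fun t ht => ex_sub_ex_ne_zero (smul_mem_endpoints ha ht) hjk) h6
  filter_upwards [eventually_ge_atTop M] with M' hM' t ht
  have := hM t ht
  rw [pow_zero, mul_one, norm_mul, Complex.norm_real, Real.norm_of_nonneg ht.1.le] at this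
  exact this.trans hM'

end Geometry

/-! ### Lipschitz estimate for the field along a ray -/

section Difference

theorem norm_mul_sub_mul_le {x y x' y' : ℂ} {m δ : ℝ} (hx : ‖x'‖ ≤ m) (hy : ‖y‖ ≤ m)
    (hdx : ‖x - x'‖ ≤ δ) (hdy : ‖y - y'‖ ≤ δ) : ‖x * y - x' * y'‖ ≤ 2 * m * δ := by
  have h : x * y - x' * y' = (x - x') * y + x' * (y - y') := by ring
  have hδ := (norm_nonneg _).trans hdx
  have hm := (norm_nonneg _).trans hx
  rw [h]
  refine (norm_add_le _ _).trans ?_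
  rw [norm_mul, norm_mul]
  have h1 := mul_le_mul hdx hy (norm_nonneg _) hδ
  have h2 := mul_le_mul hx hdy (norm_nonneg _) hm
  linarith

theorem norm_mul_mul_sub_le {x y z x' y' z' : ℂ} {m δ : ℝ} (hx : ‖x'‖ ≤ m) (hy : ‖y‖ ≤ m)
    (hy' : ‖y'‖ ≤ m) (hz : ‖z‖ ≤ m)
    (hdx : ‖x - x'‖ ≤ δ) (hdy : ‖y - y'‖ ≤ δ) (hdz : ‖z - z'‖ ≤ δ) :
    ‖x * y * z - x' * y' * z'‖ ≤ 3 * m ^ 2 * δ := by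
  have h : x * y * z - x' * y' * z' = (x * y - x' * y') * z + x' * y' * (z - z') := by ring
  have hδ := (norm_nonneg _).trans hdx
  have hm := (norm_nonneg _).trans hx
  rw [h]
  refine (norm_add_le _ _).trans ?_
  rw [norm_mul, norm_mul, norm_mul]
  have h1 := mul_le_mul (norm_mul_sub_mul_le hx hy hdx hdy) hz (norm_nonneg _) (by positivity)
  have h2 := mul_le_mul (mul_le_mul hx hy' (norm_nonneg _) hm) hdz (norm_nonneg _) (by positivity)
  linarith

/-- The right-hand side of the equations of `q_j` and `p_j` along a ray. -/
noncomputable def rayField (c h e b₁ b₂ b₃ b₄ x y xk yk s v : ℂ) : ℂ :=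
  c * x + h * (b₁ * x + b₂ * y + b₃ * (v * x) + b₄ * (s * y)) + e * ((x * yk - y * xk) * xk)

/-- Only the constant linear part b₁, b₂ contributes without a factor t; it accounts for the 3.
Every other contribution gains t from the size of a coefficient or of the solutions. -/
theorem norm_rayField_sub_le {c h e b₁ b₂ b₃ b₄ x y xk yk s v x' y' xk' yk' s' v' : ℂ}
    {M t δ : ℝ} (ht : t ∈ Set.Ioc (0 : ℝ) 1) (hc : ‖c‖ ≤ M * t) (hh : ‖h - 1‖ ≤ M * t)
    (he : t * ‖e‖ ≤ M) (hb : ‖b₁‖ + ‖b₂‖ ≤ 3) (hb₃ : ‖b₃‖ ≤ M) (hb₄ : ‖b₄‖ ≤ M)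
    (hx : ‖x‖ ≤ M * t) (hy : ‖y‖ ≤ M * t) (hxk : ‖xk‖ ≤ M * t) (hyk : ‖yk‖ ≤ M * t)
    (hx' : ‖x'‖ ≤ M * t) (hy' : ‖y'‖ ≤ M * t) (hxk' : ‖xk'‖ ≤ M * t) (hyk' : ‖yk'‖ ≤ M * t)
    (hs' : ‖s'‖ ≤ M * t) (hv' : ‖v'‖ ≤ M * t)
    (hdx : ‖x - x'‖ ≤ δ) (hdy : ‖y - y'‖ ≤ δ) (hdxk : ‖xk - xk'‖ ≤ δ) (hdyk : ‖yk - yk'‖ ≤ δ)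
    (hds : ‖s - s'‖ ≤ δ) (hdv : ‖v - v'‖ ≤ δ) :
    ‖rayField c h e b₁ b₂ b₃ b₄ x y xk yk s v - rayField c h e b₁ b₂ b₃ b₄ x' y' xk' yk' s' v'‖ ≤
      (3 + (4 * M + (1 + M) * (4 * M ^ 2) + 6 * M ^ 3) * t) * δ := by
  have hδ := (norm_nonneg _).trans hdx
  have hm := (norm_nonneg _).trans hx
  have hM : 0 ≤ M := by have := norm_nonneg b₃; linarith
  have ht0 := ht.1
  have ht1 := ht.2
  have hlin : ‖b₁ * (x - x') + b₂ * (y - y')‖ ≤ 3 * δ := by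
    refine (norm_add_le _ _).trans ?_
    rw [norm_mul, norm_mul]
    have h1 := mul_le_mul_of_nonneg_left hdx (norm_nonneg b₁)
    have h2 := mul_le_mul_of_nonneg_left hdy (norm_nonneg b₂)
    nlinarith
  have hh1 : ‖h‖ ≤ 1 + M := by
    have h1 : h = (h - 1) + 1 := by ring
    rw [h1]
    refine (norm_add_le _ _).trans ?_
    rw [norm_one]
    nlinarith
  have hquad : ‖b₃ * (v * x - v' * x') + b₄ * (s * y - s' * y')‖ ≤ 4 * M ^ 2 * t * δ := by
    refine (norm_add_le _ _).trans ?_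
    rw [norm_mul, norm_mul]
    have h1 := mul_le_mul hb₃ (norm_mul_sub_mul_le hv' hx hdv hdx) (norm_nonneg _) hM
    have h2 := mul_le_mul hb₄ (norm_mul_sub_mul_le hs' hy hds hdy) (norm_nonneg _) hM
    linarith
  have hcub : ‖(x * yk * xk - x' * yk' * xk') - (y * xk * xk - y' * xk' * xk')‖ ≤
      6 * (M * t) ^ 2 * δ := by
    refine (norm_sub_le _ _).trans ?_
    have h1 := norm_mul_mul_sub_le hx' hyk hyk' hxk hdx hdyk hdxk
    have h2 := norm_mul_mul_sub_le hy' hxk hxk' hxk hdy hdxk hdxk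
    linarith
  have hsplit : rayField c h e b₁ b₂ b₃ b₄ x y xk yk s v -
      rayField c h e b₁ b₂ b₃ b₄ x' y' xk' yk' s' v' =
      (b₁ * (x - x') + b₂ * (y - y')) + (c * (x - x') +
        ((h - 1) * (b₁ * (x - x') + b₂ * (y - y')) +
        (h * (b₃ * (v * x - v' * x') + b₄ * (s * y - s' * y')) +
        e * ((x * yk * xk - x' * yk' * xk') - (y * xk * xk - y' * xk' * xk'))))) := by
    simp only [rayField]
    ring
  have h1 : ‖c * (x - x')‖ ≤ M * t * δ := by
    rw [norm_mul]; exact mul_le_mul hc hdx (norm_nonneg _) hm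
  have h2 : ‖(h - 1) * (b₁ * (x - x') + b₂ * (y - y'))‖ ≤ M * t * (3 * δ) := by
    rw [norm_mul]; exact mul_le_mul hh hlin (norm_nonneg _) hm
  have h3 : ‖h * (b₃ * (v * x - v' * x') + b₄ * (s * y - s' * y'))‖ ≤
      (1 + M) * (4 * M ^ 2 * t * δ) := by
    rw [norm_mul]; exact mul_le_mul hh1 hquad (norm_nonneg _) (by positivity)
  have h4 : ‖e * ((x * yk * xk - x' * yk' * xk') - (y * xk * xk - y' * xk' * xk'))‖ ≤
      M * (6 * M ^ 2 * t * δ) := by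
    rw [norm_mul]
    have h5 := mul_le_mul_of_nonneg_left hcub (norm_nonneg e)
    have h6 : ‖e‖ * (6 * (M * t) ^ 2 * δ) = t * ‖e‖ * (6 * M ^ 2 * t * δ) := by ring
    rw [h6] at h5
    exact h5.trans (mul_le_mul_of_nonneg_right he (by positivity))
  rw [hsplit]
  refine (norm_add_le_of_le hlin (norm_add_le_of_le h1 (norm_add_le_of_le h2
    (norm_add_le_of_le h3 h4)))).trans (le_of_eq ?_)
  ring

end Difference

/-! ### Uniqueness of the solution of the system -/

section Uniqueness

/-- The derivative of `t ↦ f (t a)`. -/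
noncomputable def rayDeriv (a : Fin 2 → ℝ) (f : (Fin 2 → ℝ) → ℂ) (t : ℝ) : ℂ :=
  a 0 * pderiv 0 f (t • a) + a 1 * pderiv 1 f (t • a)

theorem rayDeriv_eq (a : Fin 2 → ℝ) (f : (Fin 2 → ℝ) → ℂ) (t : ℝ) {j k : Fin 2} (hjk : j ≠ k) :
    rayDeriv a f t = a j * pderiv j f (t • a) + a k * pderiv k f (t • a) := by
  rw [rayDeriv]
  fin_cases j <;> fin_cases k <;> first | exact absurd rfl hjk | rfl | exact add_comm _ _

theorem IsOrderFour.sub_of_sub {f f' g : (Fin 2 → ℝ) → ℂ} (h : IsOrderFour fun a => f a - g a)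
    (h' : IsOrderFour fun a => f' a - g a) : IsOrderFour fun a => f a - f' a :=
  (IsBigO.sub h h').congr_left fun a => by ring

theorem IsOrderFour.eventually_bound_ray {f f' g : (Fin 2 → ℝ) → ℂ}
    (h : IsOrderFour fun a => f a - g a) (h' : IsOrderFour fun a => f' a - g a)
    (hd : DifferentiableOn ℝ f endpoints) (hd' : DifferentiableOn ℝ f' endpoints)
    {a : Fin 2 → ℝ} (ha : a ∈ endpoints) :
    ∀ᶠ D : ℝ in atTop, ∀ t ∈ Set.Ioc (0 : ℝ) 1, ‖f (t • a) - f' (t • a)‖ ≤ D * t ^ 4 := by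
  obtain ⟨M, -, hM⟩ := (h.sub_of_sub h').exists_bound_ray (hd.sub hd') ha
  filter_upwards [eventually_ge_atTop M] with D hD t ht
  exact (hM t ht).trans (mul_le_mul_of_nonneg_right hD (pow_nonneg ht.1.le 4))

variable {N : ℕ} {q p : Fin 2 → (Fin 2 → ℝ) → ℂ} {u w v : (Fin 2 → ℝ) → ℂ}
  {R : Fin 2 → Fin 2 → (Fin 2 → ℝ) → ℂ} {L : (Fin 2 → ℝ) → ℂ}
  {q' p' : Fin 2 → (Fin 2 → ℝ) → ℂ} {u' w' v' : (Fin 2 → ℝ) → ℂ}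
  {R' : Fin 2 → Fin 2 → (Fin 2 → ℝ) → ℂ} {L' : (Fin 2 → ℝ) → ℂ}

theorem IsTWSolution.eventually_bound (h : IsTWSolution N q p u w v R L) {a : Fin 2 → ℝ}
    (ha : a ∈ endpoints) : ∀ᶠ M : ℝ in atTop,
      (∀ j, ∀ t ∈ Set.Ioc (0 : ℝ) 1, ‖q j (t • a)‖ ≤ M * t) ∧
      (∀ j, ∀ t ∈ Set.Ioc (0 : ℝ) 1, ‖p j (t • a)‖ ≤ M * t) ∧
      (∀ t ∈ Set.Ioc (0 : ℝ) 1, ‖u (t • a)‖ ≤ M * t) ∧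
      (∀ t ∈ Set.Ioc (0 : ℝ) 1, ‖w (t • a)‖ ≤ M * t) ∧
      (∀ t ∈ Set.Ioc (0 : ℝ) 1, ‖v (t • a)‖ ≤ M * t) := by
  have hcube : ∀ c t : ℝ, ((c * ((t • a) 0 ^ 3 - (t • a) 1 ^ 3) : ℝ) : ℂ) =
      0 * (t : ℂ) ^ 1 + 0 * (t : ℂ) ^ 2 + (c * (a 0 ^ 3 - a 1 ^ 3) : ℂ) * (t : ℂ) ^ 3 := by
    intro c t
    simp only [Pi.smul_apply, smul_eq_mul]
    push_cast
    ring
  refine (eventually_all.mpr fun j => ?_).and ((eventually_all.mpr fun j => ?_).and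
    (Eventually.and ?_ (Eventually.and ?_ ?_)))
  · refine exists_bound_eventually ((h.bc_q j).exists_bound_ray_linear (h.diff_q j) ha
      (c₁ := Complex.I * ((N + 1) / (2 * Real.sqrt (2 * Real.pi)) * a j : ℝ))
      (c₂ := -((N + 1) * (N + 2) / (12 * Real.sqrt (2 * Real.pi)) * a j ^ 2 : ℝ))
      (c₃ := -(Complex.I * ((N + 1) ^ 3 / (48 * Real.sqrt (2 * Real.pi)) * a j ^ 3 : ℝ)))
      fun t => ?_)
    simp only [Pi.smul_apply, smul_eq_mul]
    push_cast
    ring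
  · refine exists_bound_eventually ((h.bc_p j).exists_bound_ray_linear (h.diff_p j) ha
      (c₁ := -Complex.I * ((N - 1) / (2 * Real.sqrt (2 * Real.pi)) * a j : ℝ))
      (c₂ := -((N - 1) * (N - 2) / (12 * Real.sqrt (2 * Real.pi)) * a j ^ 2 : ℝ))
      (c₃ := Complex.I * ((N - 1) ^ 3 / (48 * Real.sqrt (2 * Real.pi)) * a j ^ 3 : ℝ))
      fun t => ?_)
    simp only [Pi.smul_apply, smul_eq_mul]
    push_cast
    ring
  · exact exists_bound_eventually (h.bc_u.exists_bound_ray_linear h.diff_u ha (hcube _))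
  · exact exists_bound_eventually (h.bc_w.exists_bound_ray_linear h.diff_w ha (hcube _))
  · exact exists_bound_eventually (h.bc_v.exists_bound_ray_linear h.diff_v ha (hcube _))

theorem rayFactor_mul {a : Fin 2 → ℝ} (ha : a ∈ endpoints) (j : Fin 2) {t : ℝ}
    (ht : t ∈ Set.Ioc (0 : ℝ) 1) :
    rayFactor a j t * (Complex.I * (1 - ex (t • a) j)) = t * a j :=
  div_mul_cancel₀ _ (mul_ne_zero Complex.I_ne_zero (ex_ne_one (smul_mem_endpoints ha ht) j))

theorem rayCoupling_mul {a : Fin 2 → ℝ} (ha : a ∈ endpoints) {j k : Fin 2} (hjk : j ≠ k) {t : ℝ}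
    (ht : t ∈ Set.Ioc (0 : ℝ) 1) :
    rayCoupling a j k t * (ex (t • a) j - ex (t • a) k) =
      sgn k * (t * a k - rayFactor a j t * (Complex.I * (1 - ex (t • a) k))) :=
  div_mul_cancel₀ _ (ex_sub_ex_ne_zero (smul_mem_endpoints ha ht) hjk)

/-- The factor `rayFactor` replaces i(1 - e^{ita_j}) by t a_j, and t a_k times the other derivative
is added. The two contributions of R_{jk} merge, and its quotient form removes R from the system. -/
theorem IsTWSolution.rayDeriv_q (h : IsTWSolution N q p u w v R L) {a : Fin 2 → ℝ}
    (ha : a ∈ endpoints) {j k : Fin 2} (hjk : j ≠ k) {t : ℝ} (ht : t ∈ Set.Ioc (0 : ℝ) 1) :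
    t * rayDeriv a (q j) t =
      rayField (((N : ℂ) + 1) / 2 * Complex.I * (t * a j)) (rayFactor a j t) (rayCoupling a j k t)
        (1 / N) (-((N + 1) / N)) (-1) (N + 1) (q j (t • a)) (p j (t • a)) (q k (t • a))
        (p k (t • a)) (u (t • a)) (v (t • a)) := by
  have hm := smul_mem_endpoints ha ht
  have hR := h.R_off _ hm j k hjk
  rw [eq_div_iff (ex_sub_ex_ne_zero hm hjk)] at hR
  have hself := h.q_self _ hm j k hjk
  have hother := h.q_other _ hm j k hjk
  have hF := rayFactor_mul ha j ht
  have hC := rayCoupling_mul ha hjk ht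
  rw [rayDeriv_eq a _ t hjk, rayField]
  linear_combination rayFactor a j t * hself
    - (pderiv j (q j) (t • a) - ((N : ℂ) + 1) / 2 * Complex.I * q j (t • a)) * hF
    + t * a k * hother - R j k (t • a) * q k (t • a) * hC
    + rayCoupling a j k t * q k (t • a) * hR
    - ((N : ℂ) + 1) / 2 * rayFactor a j t * (1 - ex (t • a) j) * q j (t • a) * Complex.I_sq

theorem IsTWSolution.rayDeriv_p (h : IsTWSolution N q p u w v R L) {a : Fin 2 → ℝ}
    (ha : a ∈ endpoints) {j k : Fin 2} (hjk : j ≠ k) {t : ℝ} (ht : t ∈ Set.Ioc (0 : ℝ) 1) :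
    t * rayDeriv a (p j) t =
      rayField (-(((N : ℂ) - 1) / 2 * Complex.I * (t * a j))) (rayFactor a j t)
        -- With p and q exchanged the antisymmetric factor q_j p_k - p_j q_k changes sign, hence the
        -- minus on the coupling.
        (-rayCoupling a j k t) (-(1 / N)) (-((N - 1) / N)) 1 (N - 1) (p j (t • a)) (q j (t • a))
        (p k (t • a)) (q k (t • a)) (w (t • a)) (v (t • a)) := by
  have hm := smul_mem_endpoints ha ht
  have hR := h.R_off _ hm j k hjk
  rw [eq_div_iff (ex_sub_ex_ne_zero hm hjk)] at hR
  have hself := h.p_self _ hm j k hjk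
  have hother := h.p_other _ hm j k hjk
  have hF := rayFactor_mul ha j ht
  have hC := rayCoupling_mul ha hjk ht
  rw [rayDeriv_eq a _ t hjk, rayField]
  linear_combination rayFactor a j t * hself
    - (pderiv j (p j) (t • a) + ((N : ℂ) - 1) / 2 * Complex.I * p j (t • a)) * hF
    + t * a k * hother - R j k (t • a) * p k (t • a) * hC
    + rayCoupling a j k t * p k (t • a) * hR
    + ((N : ℂ) - 1) / 2 * rayFactor a j t * (1 - ex (t • a) j) * p j (t • a) * Complex.I_sq

theorem norm_sgn (j : Fin 2) : ‖sgn j‖ = 1 := by simp [sgn]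

/-- The equations of u, w, v have no singular part; the generous constant matches
`norm_rayField_sub_le`, so one bound serves all components in the sup norm. -/
theorem norm_ray_sum_sub_le {a : Fin 2 → ℝ} {x y x' y' : Fin 2 → ℂ} {M t δ : ℝ}
    (ht : t ∈ Set.Ioc (0 : ℝ) 1) (ha : ∀ j, ‖a j‖ ≤ M) (hx : ∀ j, ‖x' j‖ ≤ M * t)
    (hy : ∀ j, ‖y j‖ ≤ M * t) (hdx : ∀ j, ‖x j - x' j‖ ≤ δ) (hdy : ∀ j, ‖y j - y' j‖ ≤ δ) :
    ‖t * (a 0 * (sgn 0 * (x 0 * y 0)) + a 1 * (sgn 1 * (x 1 * y 1))) -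
      t * (a 0 * (sgn 0 * (x' 0 * y' 0)) + a 1 * (sgn 1 * (x' 1 * y' 1)))‖ ≤
      (3 + (4 * M + (1 + M) * (4 * M ^ 2) + 6 * M ^ 3) * t) * δ := by
  have hδ := (norm_nonneg _).trans (hdx 0)
  have hM := (norm_nonneg _).trans (ha 0)
  have ht0 := ht.1
  have hterm : ∀ j, ‖(a j : ℂ) * (sgn j * (x j * y j - x' j * y' j))‖ ≤
      M * (2 * (M * t) * δ) := fun j => by
    rw [norm_mul, norm_mul, norm_sgn, one_mul, Complex.norm_real]
    exact mul_le_mul (ha j) (norm_mul_sub_mul_le (hx j) (hy j) (hdx j) (hdy j))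
      (norm_nonneg _) hM
  have hsplit : t * (a 0 * (sgn 0 * (x 0 * y 0)) + a 1 * (sgn 1 * (x 1 * y 1))) -
      t * (a 0 * (sgn 0 * (x' 0 * y' 0)) + a 1 * (sgn 1 * (x' 1 * y' 1))) =
      (t : ℂ) * (a 0 * (sgn 0 * (x 0 * y 0 - x' 0 * y' 0)) +
        a 1 * (sgn 1 * (x 1 * y 1 - x' 1 * y' 1))) := by ring
  rw [hsplit, norm_mul, Complex.norm_real, Real.norm_of_nonneg ht0.le]
  have h1 := (mul_le_of_le_one_left (norm_nonneg _) ht.2).trans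
    (norm_add_le_of_le (hterm 0) (hterm 1))
  have h2 : 0 ≤ (3 + 4 * M * t + 4 * M ^ 3 * t + 6 * M ^ 3 * t) * δ := by positivity
  linarith

theorem norm_mul_I_mul_le {z : ℂ} {x b M t : ℝ} (ht : 0 ≤ t) (hz : ‖z‖ ≤ b) (hM : ‖x‖ * b ≤ M) :
    ‖z / 2 * Complex.I * (t * x)‖ ≤ M * t := by
  rw [norm_mul, norm_mul, norm_mul, norm_div, Complex.norm_I, Complex.norm_real,
    Complex.norm_real, Real.norm_of_nonneg ht, Complex.norm_two]
  have h1 : ‖z‖ * (t * ‖x‖) ≤ b * (t * ‖x‖) := mul_le_mul_of_nonneg_right hz (by positivity)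
  have h2 : ‖x‖ * b * t ≤ M * t := mul_le_mul_of_nonneg_right hM ht
  have h3 : 0 ≤ ‖z‖ * (t * ‖x‖) := by positivity
  linarith

/-- The differentiated unknowns along the ray through `a`. -/
def rayState (q p : Fin 2 → (Fin 2 → ℝ) → ℂ) (u w v : (Fin 2 → ℝ) → ℂ) (a : Fin 2 → ℝ) (t : ℝ) :
    (Fin 2 → ℂ) × (Fin 2 → ℂ) × ℂ × ℂ × ℂ :=
  (fun j => q j (t • a), fun j => p j (t • a), u (t • a), w (t • a), v (t • a))

/-- The derivative of `rayState`. -/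
noncomputable def raySlope (q p : Fin 2 → (Fin 2 → ℝ) → ℂ) (u w v : (Fin 2 → ℝ) → ℂ)
    (a : Fin 2 → ℝ) (t : ℝ) : (Fin 2 → ℂ) × (Fin 2 → ℂ) × ℂ × ℂ × ℂ :=
  (fun j => rayDeriv a (q j) t, fun j => rayDeriv a (p j) t, rayDeriv a u t, rayDeriv a w t,
    rayDeriv a v t)

theorem IsTWSolution.hasDerivAt_rayState (h : IsTWSolution N q p u w v R L) {a : Fin 2 → ℝ}
    (ha : a ∈ endpoints) {t : ℝ} (ht : t ∈ Set.Ioc (0 : ℝ) 1) :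
    HasDerivAt (rayState q p u w v a) (raySlope q p u w v a t) t :=
  (hasDerivAt_pi.mpr fun j => hasDerivAt_ray (h.diff_q j) ha ht).prodMk
    ((hasDerivAt_pi.mpr fun j => hasDerivAt_ray (h.diff_p j) ha ht).prodMk
      ((hasDerivAt_ray h.diff_u ha ht).prodMk
        ((hasDerivAt_ray h.diff_w ha ht).prodMk (hasDerivAt_ray h.diff_v ha ht))))

theorem norm_rayState_le_iff {Z : (Fin 2 → ℂ) × (Fin 2 → ℂ) × ℂ × ℂ × ℂ} {r : ℝ} (hr : 0 ≤ r) :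
    ‖Z‖ ≤ r ↔ (∀ j, ‖Z.1 j‖ ≤ r) ∧ (∀ j, ‖Z.2.1 j‖ ≤ r) ∧ ‖Z.2.2.1‖ ≤ r ∧ ‖Z.2.2.2.1‖ ≤ r ∧
      ‖Z.2.2.2.2‖ ≤ r := by
  simp only [norm_prod_le_iff, pi_norm_le_iff_of_nonneg hr]

theorem IsTWSolution.eventually_norm_raySlope_sub_le (hN : 1 ≤ N)
    (h : IsTWSolution N q p u w v R L) (h' : IsTWSolution N q' p' u' w' v' R' L')
    {a : Fin 2 → ℝ} (ha : a ∈ endpoints) : ∀ᶠ M : ℝ in atTop, ∀ t ∈ Set.Ioc (0 : ℝ) 1,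
      t * ‖raySlope q p u w v a t - raySlope q' p' u' w' v' a t‖ ≤
        (3 + (4 * M + (1 + M) * (4 * M ^ 2) + 6 * M ^ 3) * t) *
          ‖rayState q p u w v a t - rayState q' p' u' w' v' a t‖ := by
  filter_upwards [h.eventually_bound ha, h'.eventually_bound ha,
    eventually_all.mpr fun j => eventually_rayFactor_le ha j,
    eventually_rayCoupling_le ha (zero_ne_one (α := Fin 2)),
    eventually_rayCoupling_le ha (one_ne_zero (α := Fin 2)),
    eventually_all.mpr fun j => eventually_ge_atTop ‖a j‖,
    eventually_all.mpr fun j => eventually_ge_atTop (‖a j‖ * (N + 1)),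
    eventually_ge_atTop ((N : ℝ) + 1)]
    with M ⟨hq, hp, hu, hw, hv⟩ ⟨hq', hp', hu', hw', hv'⟩ hF hC01 hC10 haM hcM hNM t ht
  set δ := ‖rayState q p u w v a t - rayState q' p' u' w' v' a t‖ with hδ
  obtain ⟨hdq, hdp, hdu, hdw, hdv⟩ := (norm_rayState_le_iff (norm_nonneg _)).mp (le_of_eq hδ.symm)
  have hN0 : (1 : ℝ) ≤ N := by exact_mod_cast hN
  have ht0 := ht.1
  have hM : 0 ≤ M := by linarith
  have hm := smul_mem_endpoints ha ht
  have hC : ∀ j k : Fin 2, j ≠ k → t * ‖rayCoupling a j k t‖ ≤ M := fun j k hjk => by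
    fin_cases j <;> fin_cases k <;>
      first | exact absurd rfl hjk | exact hC01 t ht | exact hC10 t ht
  have hN1 : ‖(N : ℂ) + 1‖ = N + 1 := by
    rw [← Nat.cast_add_one, Complex.norm_natCast]; push_cast; rfl
  have hN2 : ‖(N : ℂ) - 1‖ = N - 1 := by
    rw [← Nat.cast_pred (by omega), Complex.norm_natCast, Nat.cast_pred (by omega)]
  have hninv : 1 / (N : ℝ) ≤ 1 := by rw [div_le_one (by linarith)]; exact hN0
  rw [← Real.norm_of_nonneg ht0.le, ← norm_smul, Real.norm_of_nonneg ht0.le,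
    norm_rayState_le_iff (by positivity)]
  simp only [raySlope, Prod.smul_fst, Prod.smul_snd, Prod.fst_sub, Prod.snd_sub, Pi.smul_apply,
    Pi.sub_apply, Complex.real_smul, mul_sub]
  refine ⟨fun j => ?_, fun j => ?_, ?_, ?_, ?_⟩
  · obtain ⟨k, hkj⟩ := exists_ne j
    rw [h.rayDeriv_q ha hkj.symm ht, h'.rayDeriv_q ha hkj.symm ht]
    refine norm_rayField_sub_le ht ?_ (hF j t ht) (hC j k hkj.symm) ?_ ?_ ?_ (hq j t ht)
      (hp j t ht) (hq k t ht) (hp k t ht) (hq' j t ht) (hp' j t ht) (hq' k t ht) (hp' k t ht)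
      (hu' t ht) (hv' t ht) (hdq j) (hdp j) (hdq k) (hdp k) hdu hdv
    · exact norm_mul_I_mul_le ht0.le hN1.le (hcM j)
    -- Here 1/N + (N+1)/N = 1 + 2/N ≤ 3, with equality at N = 1: this is the origin of the constant
    -- 3.
    · rw [norm_neg, norm_div, norm_div, hN1, norm_one, Complex.norm_natCast, add_div,
        div_self (by linarith)]
      linarith
    · rw [norm_neg, norm_one]; linarith
    · rw [hN1]; exact hNM
  · obtain ⟨k, hkj⟩ := exists_ne j
    rw [h.rayDeriv_p ha hkj.symm ht, h'.rayDeriv_p ha hkj.symm ht]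
    refine norm_rayField_sub_le ht ?_ (hF j t ht) (by rw [norm_neg]; exact hC j k hkj.symm) ?_ ?_ ?_
      (hp j t ht) (hq j t ht) (hp k t ht) (hq k t ht) (hp' j t ht) (hq' j t ht) (hp' k t ht)
      (hq' k t ht) (hw' t ht) (hv' t ht) (hdp j) (hdq j) (hdp k) (hdq k) hdw hdv
    · rw [norm_neg]
      exact norm_mul_I_mul_le ht0.le (hN2.le.trans (by linarith)) (hcM j)
    · rw [norm_neg, norm_neg, norm_div, norm_div, hN2, norm_one, Complex.norm_natCast, sub_div,
        div_self (by linarith)]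
      linarith
    · rw [norm_one]; linarith
    · rw [hN2]; linarith
  · simp only [rayDeriv, h.u_eq _ hm, h'.u_eq _ hm, sq (q _ _), sq (q' _ _)]
    exact norm_ray_sum_sub_le (x := fun j => q j (t • a)) (y := fun j => q j (t • a))
      (x' := fun j => q' j (t • a)) (y' := fun j => q' j (t • a)) ht haM (fun j => hq' j t ht)
      (fun j => hq j t ht) hdq hdq
  · simp only [rayDeriv, h.w_eq _ hm, h'.w_eq _ hm, sq (p _ _), sq (p' _ _)]
    exact norm_ray_sum_sub_le (x := fun j => p j (t • a)) (y := fun j => p j (t • a))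
      (x' := fun j => p' j (t • a)) (y' := fun j => p' j (t • a)) ht haM (fun j => hp' j t ht)
      (fun j => hp j t ht) hdp hdp
  · simp only [rayDeriv, h.v_eq _ hm, h'.v_eq _ hm]
    exact norm_ray_sum_sub_le (x := fun j => q j (t • a)) (y := fun j => p j (t • a))
      (x' := fun j => q' j (t • a)) (y' := fun j => p' j (t • a)) ht haM (fun j => hq' j t ht)
      (fun j => hp j t ht) hdq hdp

theorem IsTWSolution.exists_norm_rayState_sub_le
    (h : IsTWSolution N q p u w v R L) (h' : IsTWSolution N q' p' u' w' v' R' L')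
    {a : Fin 2 → ℝ} (ha : a ∈ endpoints) : ∃ D : ℝ, ∀ t ∈ Set.Ioc (0 : ℝ) 1,
      ‖rayState q p u w v a t - rayState q' p' u' w' v' a t‖ ≤ D * t ^ 4 := by
  obtain ⟨D, hq, hp, hu, hw, hv⟩ := ((eventually_all.mpr fun j =>
    (h.bc_q j).eventually_bound_ray (h'.bc_q j) (h.diff_q j) (h'.diff_q j) ha).and
    ((eventually_all.mpr fun j =>
      (h.bc_p j).eventually_bound_ray (h'.bc_p j) (h.diff_p j) (h'.diff_p j) ha).and
    ((h.bc_u.eventually_bound_ray h'.bc_u h.diff_u h'.diff_u ha).and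
    ((h.bc_w.eventually_bound_ray h'.bc_w h.diff_w h'.diff_w ha).and
    (h.bc_v.eventually_bound_ray h'.bc_v h.diff_v h'.diff_v ha))))).exists
  refine ⟨D, fun t ht => ?_⟩
  rw [norm_rayState_le_iff ((norm_nonneg _).trans (hu t ht))]
  exact ⟨fun j => hq j t ht, fun j => hp j t ht, hu t ht, hw t ht, hv t ht⟩

/-- Along the ray through a the difference satisfies the singular inequality and is O(t⁴), so it
vanishes at t = 1, the point a itself. -/
theorem IsTWSolution.rayState_unique (hN : 1 ≤ N)
    (h : IsTWSolution N q p u w v R L) (h' : IsTWSolution N q' p' u' w' v' R' L')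
    {a : Fin 2 → ℝ} (ha : a ∈ endpoints) :
    (∀ j, q j a = q' j a) ∧ (∀ j, p j a = p' j a) ∧ u a = u' a ∧ w a = w' a ∧ v a = v' a := by
  obtain ⟨M, hM⟩ := (h.eventually_norm_raySlope_sub_le hN h' ha).exists
  obtain ⟨D, hD⟩ := h.exists_norm_rayState_sub_le h' ha
  have hz := eq_zero_of_singular_ode
    (fun t ht => (h.hasDerivAt_rayState ha ht).sub (h'.hasDerivAt_rayState ha ht)) hM hD
  have h0 := (norm_rayState_le_iff le_rfl).mp (norm_le_zero_iff.mpr hz)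
  simpa [rayState, sub_eq_zero] using h0

theorem pderiv_congr {f g : (Fin 2 → ℝ) → ℂ} (hfg : ∀ a ∈ endpoints, f a = g a) {a : Fin 2 → ℝ}
    (ha : a ∈ endpoints) (k : Fin 2) : pderiv k f a = pderiv k g a :=
  EventuallyEq.deriv_eq ((eventually_update_mem ha k).mono fun _ ht => hfg _ ht)

/-- The Tracy–Widom system with its boundary conditions has at most one solution. -/
theorem IsTWSolution.unique (hN : 1 ≤ N)
    (h : IsTWSolution N q p u w v R L) (h' : IsTWSolution N q' p' u' w' v' R' L')
    {a : Fin 2 → ℝ} (ha : a ∈ endpoints) :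
    (∀ j, q j a = q' j a) ∧ (∀ j, p j a = p' j a) ∧ u a = u' a ∧ w a = w' a ∧ v a = v' a ∧
      (∀ j k, R j k a = R' j k a) ∧ L a = L' a := by
  -- Equality is needed on the whole domain: the diagonal entries involve derivatives of q and p,
  -- and the equation of L is used along the entire ray.
  have hR : ∀ b ∈ endpoints, ∀ j k, R j k b = R' j k b := by
    intro b hb j k
    obtain ⟨hq, hp, -⟩ := h.rayState_unique hN h' hb
    rcases eq_or_ne j k with rfl | hjk
    · rw [h.R_diag b hb, h'.R_diag b hb, hq, hp,
        pderiv_congr (fun c hc => (h.rayState_unique hN h' hc).1 j) hb,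
        pderiv_congr (fun c hc => (h.rayState_unique hN h' hc).2.1 j) hb]
    · rw [h.R_off b hb j k hjk, h'.R_off b hb j k hjk, hq, hq, hp, hp]
  obtain ⟨hq, hp, hu, hw, hv⟩ := h.rayState_unique hN h' ha
  refine ⟨hq, hp, hu, hw, hv, hR a ha, ?_⟩
  obtain ⟨D, hD⟩ := (h.bc_L.eventually_bound_ray h'.bc_L h.diff_L h'.diff_L ha).exists
  -- The difference of the two L has derivative 0 along the ray, so the singular inequality holds
  -- trivially; its O(t⁴) decay fixes the constant.
  have hz := eq_zero_of_singular_ode (C := 0)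
    (fun t ht => (hasDerivAt_ray h.diff_L ha ht).sub (hasDerivAt_ray h'.diff_L ha ht))
    (fun t ht => by
      have hm := smul_mem_endpoints ha ht
      rw [h.L_eq _ hm, h.L_eq _ hm, h'.L_eq _ hm, h'.L_eq _ hm, hR _ hm, hR _ hm, sub_self,
        norm_zero, mul_zero, zero_mul, add_zero]
      exact mul_nonneg zero_le_three (norm_nonneg _)) hD
  simpa [sub_eq_zero] using hz

end Uniqueness

end CUEJanossy

/-! ### The theorem -/

theorem mainTheorem2 (N : ℕ) (hN : 1 ≤ N) :
    -- the resolvent `(𝕀 - K̃_I)⁻¹` is well defined by its Neumann series, and `J̃₁ > 0`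
    (∀ a ∈ CUEJanossy.endpoints,
      (∀ f : ℝ → ℂ, Continuous f → ∀ x ∈ Set.Icc (a 0) (a 1),
        Summable (fun n : ℕ => ((CUEJanossy.intOp (CUEJanossy.condKernel N) a)^[n] f) x) ∧
        CUEJanossy.resolvent (CUEJanossy.condKernel N) a f x -
          CUEJanossy.intOp (CUEJanossy.condKernel N) a
            (CUEJanossy.resolvent (CUEJanossy.condKernel N) a f) x = f x) ∧
      0 < CUEJanossy.janossy N a) ∧
    -- the quantities built from `K̃, φ̃, ψ̃` solve the system with its boundary conditions
    CUEJanossy.IsTWSolution N (CUEJanossy.qVar N) (CUEJanossy.pVar N) (CUEJanossy.uVar N)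
      (CUEJanossy.wVar N) (CUEJanossy.vVar N) (CUEJanossy.RVar N) (CUEJanossy.logJanossy N) ∧
    -- the system with its boundary conditions determines them
    (∀ (q p : Fin 2 → (Fin 2 → ℝ) → ℂ) (u w v : (Fin 2 → ℝ) → ℂ)
      (R : Fin 2 → Fin 2 → (Fin 2 → ℝ) → ℂ) (L : (Fin 2 → ℝ) → ℂ),
      CUEJanossy.IsTWSolution N q p u w v R L →
      ∀ a ∈ CUEJanossy.endpoints,
        (∀ j, q j a = CUEJanossy.qVar N j a) ∧ (∀ j, p j a = CUEJanossy.pVar N j a) ∧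
        u a = CUEJanossy.uVar N a ∧ w a = CUEJanossy.wVar N a ∧ v a = CUEJanossy.vVar N a ∧
        (∀ j k, R j k a = CUEJanossy.RVar N j k a) ∧ L a = CUEJanossy.logJanossy N a) := by
  refine ⟨fun a ha => ⟨fun f hf x _ => ⟨(CUEJanossy.hasSum_neumann hN ha hf x).summable, ?_⟩,
    CUEJanossy.janossy_pos hN ha⟩, CUEJanossy.isTWSolution_vars hN,
    fun q p u w v R L h a ha => h.unique hN (CUEJanossy.isTWSolution_vars hN) ha⟩
  rw [CUEJanossy.resolvent_eq_sol hN ha hf]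
  exact (CUEJanossy.isIntSol_sol hN (CUEJanossy.det_ne_zero hN ha) hf).eq x
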